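/- **Theorem (Error bound for the SVEA).** Let $d,n\in\mathbb{N}$, let $A_1,\dots,A_d\in\mathbb{R}^{n\times n}$ be symmetric, $E\in\mathbb{R}^{n\times n}$ skew-symmetric, $T:\mathbb{R}^n\times\mathbb{R}^n\times\mathbb{R}^n\to\mathbb{R}^n$ trilinear (extended trilinearly to $\mathbb{C}^n$), and put $A(\partial)=\sum_{\ell=1}^d A_\ell\partial_\ell$, $A(\beta)=\sum_{\ell=1}^d\beta_\ell A_\ell$, $\mathcal{L}(\alpha,\beta)=-\alpha I+A(\beta)-\mathrm{i}E$ for $\alpha\in\mathbb{R}$, $\beta\in\mathbb{R}^d$. Let $W=\{f\in\mathcal{S}'(\mathbb{R}^d)^n:\widehat f\in L^1\}$ with $\|f\|_W=\int_{\mathbb{R}^d}|\widehat f(k)|_2\,\mathrm{d}k$, where $\widehat f(k)=(2\pi)^{-d/2}\int f(x)\mathrm{e}^{-\mathrm{i}k\cdot x}\,\mathrm{d}x$, and $W^s=\{f\in W:\partial^\alpha f\in W\text{ for all }|\alpha|_1\le s\}$. Let $\kappa\in\mathbb{R}^d\setminus\{0\}$ and $\omega\in\mathbb{R}$, and assume: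 1. $\ker\mathcal{L}(\omega,\kappa)$ is one-dimensional; $p=p_0+\varepsilon p_1$ with $p_0,p_1\in W^2$ independent of $\varepsilon$ and $p_0(x)\in\ker\mathcal{L}(\omega,\kappa)$ for almost every $x$. 2. There are $\omega_\ell:\mathbb{R}^d\to\mathbb{R}$ and $\psi_\ell:\mathbb{R}^d\to\mathbb{C}^n$, $\ell=1,\dots,n$, which are $C^\infty$ on $\mathbb{R}^d\setminus\{0\}$, such that for every $\beta\in\mathbb{R}^d$ the vectors $\psi_1(\beta),\dots,\psi_n(\beta)$ form an orthonormal basis of $\mathbb{C}^n$ with $\mathcal{L}(0,\beta)\psi_\ell(\beta)=\omega_\ell(\beta)\psi_\ell(\beta)$. Moreover $\omega=\omega_1(\kappa)$; there is a constant $C$ with $|\omega_\ell(\widetilde\beta)-\omega_\ell(\beta)|\le C|\widetilde\beta-\beta|_1$ for all $\widetilde\beta,\beta\in\mathbb{R}^d$ and all $\ell$; and there is a constant $c>0$ with $|\omega-\omega_\ell(\beta)|\ge c$ for all $\beta\in\mathbb{R}^d$ and $\ell=2,\dots,n$. 3. $\mathcal{L}(3\omega,3\kappa)$ is regular and has no eigenvalue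 in common with $\mathcal{L}(\omega,\kappa)$. For $\varepsilon\in(0,1]$ and $t_{\rm end}>0$ consider on $[0,t_{\rm end}/\varepsilon]$ real-valued mild solutions $u\in C([0,t_{\rm end}/\varepsilon],W)$ of $$\partial_t u+A(\partial)u+\tfrac1\varepsilon Eu=\varepsilon T(u,u,u),\qquad u(0,x)=p(x)\mathrm{e}^{\mathrm{i}(\kappa\cdot x)/\varepsilon}+\text{c.c.},$$ and classical solutions $u_1\in\bigcap_{\ell=0}^2C^{2-\ell}([0,t_{\rm end}/\varepsilon],W^\ell)$ of $$\partial_t u_1+\tfrac{\mathrm{i}}{\varepsilon}\mathcal{L}(\omega,\kappa)u_1+A(\partial)u_1=\varepsilon\big(T(u_1,u_1,\overline{u_1})+T(u_1,\overline{u_1},u_1)+T(\overline{u_1},u_1,u_1)\big),\qquad u_1(0,\cdot)=p,$$ and set $\widetilde u^{(1)}(t,x)=\mathrm{e}^{\mathrm{i}(\kappa\cdot x-\omega t)/\varepsilon}u_1(t,x)+\text{c.c.}$ (Here "$X$ + c.c." means $X+\overline X$.) (a) There are $t_{\rm end}>0$ and $M$ such that for every $\varepsilon\in(0,1]$ such solutions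 $u$ and $u_1$ exist on $[0,t_{\rm end}/\varepsilon]$ and satisfy $\|u(t)\|_W\le M$ and $\|u_1(t)\|_W\le M$ for all $t\in[0,t_{\rm end}/\varepsilon]$. (b) For every $t_{\rm end}>0$ and every $M$ there is a constant $C$, independent of $\varepsilon$, such that for every $\varepsilon\in(0,1]$ and all such solutions $u$, $u_1$ on $[0,t_{\rm end}/\varepsilon]$ with $\|u(t)\|_W\le M$ and $\|u_1(t)\|_W\le M$ on this interval, $$\sup_{t\in[0,t_{\rm end}/\varepsilon]}\|u(t)-\widetilde u^{(1)}(t)\|_W\le C\varepsilon^2\qquad\text{and}\qquad\sup_{t\in[0,t_{\rm end}/\varepsilon]}\|u(t)-\widetilde u^{(1)}(t)\|_{L^\infty}\le C\varepsilon^2.$$ -/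

import Mathlib

open MeasureTheory Set
open scoped FourierTransform SchwartzMap

noncomputable section

namespace SVEA

/-! ### The Wiener algebra -/

/-- Physical space and frequency space `ℝ^d` with the Euclidean structure. -/
abbrev Pos (d : ℕ) : Type := EuclideanSpace ℝ (Fin d)

/-- `ℂ^n` with the Euclidean norm. -/
abbrev CVec (n : ℕ) : Type := EuclideanSpace ℂ (Fin n)

/-- `L¹(ℝ^d, ℂ^n)`, with the norm `∫ |g(k)|₂ dk`. -/
abbrev FreqL1 (d n : ℕ) : Type := Lp (CVec n) 1 (volume : Measure (Pos d))

/-- The inverse Fourier transform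
`x ↦ (2π)^{-d/2} ∫ e^{i k·x} g(k) dk` of an integrable function, as a linear map. -/
def invFourier (d n : ℕ) : FreqL1 d n →ₗ[ℂ] (Pos d → CVec n) where
  toFun g := fun x => ((2 * Real.pi) ^ (-(d : ℝ) / 2) : ℝ) •
    ∫ k : Pos d, Complex.exp (Complex.I * (inner ℝ k x : ℝ)) • g k
  map_add' f g := by
    have key : ∀ (h : FreqL1 d n) (x : Pos d), Integrable
        (fun k : Pos d => Complex.exp (Complex.I * (inner ℝ k x : ℝ)) • h k) := by
      intro h x
      have hc : Continuous fun k : Pos d => Complex.exp (Complex.I * (inner ℝ k x : ℝ)) := by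
        fun_prop
      refine (L1.integrable_coeFn h).bdd_smul 1 hc.aestronglyMeasurable
        (ae_of_all _ fun k => ?_)
      rw [mul_comm, Complex.norm_exp_ofReal_mul_I]
    ext1 x
    simp only [Pi.add_apply]
    rw [← smul_add, ← integral_add (key f x) (key g x)]
    congr 1
    refine integral_congr_ae ?_
    filter_upwards [Lp.coeFn_add f g] with k hk
    rw [hk, Pi.add_apply, smul_add]
  map_smul' c g := by
    ext1 x
    simp only [Pi.smul_apply, RingHom.id_apply]
    rw [smul_comm c, ← integral_smul c]
    congr 1
    refine integral_congr_ae ?_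
    filter_upwards [Lp.coeFn_smul c g] with k hk
    rw [hk, Pi.smul_apply, smul_comm]

theorem invFourier_injective (d n : ℕ) : Function.Injective (invFourier d n) := by
  rw [injective_iff_map_eq_zero]
  intro g hg
  have h1 : Integrable (g : Pos d → CVec n) := L1.integrable_coeFn g
  have hF : ∀ w : Pos d, 𝓕 (g : Pos d → CVec n) w = 0 := by
    intro w
    have h2 := congrFun hg (-(2 * Real.pi) • w)
    have hc : ((2 * Real.pi) ^ (-(d : ℝ) / 2) : ℝ) ≠ 0 :=
      (Real.rpow_pos_of_pos (by positivity) _).ne'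
    have h3 := (smul_eq_zero.mp h2).resolve_left hc
    rw [Real.fourier_eq']
    rw [← h3]
    congr 1
    ext1 k
    congr 2
    rw [inner_smul_right]
    push_cast
    ring
  have hmem : g ∈ (Lp.toTemperedDistributionCLM (CVec n) (volume : Measure (Pos d)) 1).ker := by
    rw [LinearMap.mem_ker]
    change (Lp.toTemperedDistribution g : 𝓢'(Pos d, CVec n)) = 0
    refine DFunLike.ext _ _ fun φ => ?_
    rw [Lp.toTemperedDistribution_apply]
    obtain ⟨ψ, rfl⟩ : ∃ ψ : 𝓢(Pos d, ℂ), 𝓕 ψ = φ :=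
      ⟨𝓕⁻ φ, FourierTransform.fourier_fourierInv_eq φ⟩
    have := VectorFourier.integral_fourierIntegral_smul_eq_flip
      (μ := (volume : Measure (Pos d))) (ν := (volume : Measure (Pos d)))
      (L := innerₗ (Pos d)) (f := (ψ : Pos d → ℂ)) (g := (g : Pos d → CVec n))
      Real.continuous_fourierChar (by exact continuous_inner) ψ.integrable h1
    simp only [flip_innerₗ] at this
    calc _ = _ := this
      _ = 0 := integral_eq_zero_of_ae (ae_of_all _ fun w => by
          have := hF w
          simp only [Pi.zero_apply]
          refine smul_eq_zero_of_right _ this)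
  rw [Lp.ker_toTemperedDistributionCLM_eq_bot] at hmem
  exact hmem

/-- The Wiener algebra `W` of `ℂ^n`-valued functions on `ℝ^d`: all `f` whose Fourier transform is
integrable, i.e. all inverse Fourier transforms of integrable functions. An element of `W` is
identified with its (unique) continuous representative. -/
def Wiener (d n : ℕ) : Type := LinearMap.range (invFourier d n)

namespace Wiener

variable {d n : ℕ}

instance : AddCommGroup (Wiener d n) :=
  inferInstanceAs (AddCommGroup (LinearMap.range (invFourier d n)))

instance : Module ℂ (Wiener d n) :=
  inferInstanceAs (Module ℂ (LinearMap.range (invFourier d n)))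

/-- Elements of `W` are functions of `x`. -/
instance : CoeFun (Wiener d n) (fun _ => Pos d → CVec n) := ⟨fun f => f.1⟩

/-- The Fourier transform `W → L¹`. -/
def hat : Wiener d n ≃ₗ[ℂ] FreqL1 d n :=
  (LinearEquiv.ofInjective (invFourier d n) (invFourier_injective d n)).symm

theorem invFourier_hat (f : Wiener d n) : invFourier d n (hat f) = f :=
  congrArg Subtype.val
    ((LinearEquiv.ofInjective (invFourier d n) (invFourier_injective d n)).apply_symm_apply f)

/-- `‖f‖_W` is the `L¹`-norm of the Fourier transform of `f`. -/
instance : NormedAddCommGroup (Wiener d n) :=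
  NormedAddCommGroup.induced (Wiener d n) (FreqL1 d n)
    (hat : Wiener d n ≃ₗ[ℂ] FreqL1 d n).toLinearMap (hat (d := d) (n := n)).injective

instance : NormedSpace ℂ (Wiener d n) :=
  NormedSpace.induced ℂ (Wiener d n) (FreqL1 d n)
    (hat : Wiener d n ≃ₗ[ℂ] FreqL1 d n).toLinearMap

theorem norm_eq (f : Wiener d n) : ‖f‖ = ∫ k, ‖hat f k‖ :=
  L1.norm_eq_integral_norm (hat f)

/-- `g = ∂_μ f` for `f, g ∈ W`. Since both functions are continuous, the distributional and the
classical meaning of this identity coincide. -/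
def IsPartial (μ : Fin d) (f g : Wiener d n) : Prop :=
  ∀ x : Pos d, HasLineDerivAt ℝ f (g x) x (EuclideanSpace.single μ 1)

/-- `f ∈ W^s`: all partial derivatives of `f` of order at most `s` belong to `W`. -/
def MemW : ℕ → Wiener d n → Prop
  | 0, _ => True
  | s + 1, f => ∀ μ : Fin d, ∃ g : Wiener d n, IsPartial μ f g ∧ MemW s g

/-- `u ∈ C^m([0,τ], W^s)`: all partial derivatives in space of order at most `s` of `u`
belong to `C^m([0,τ], W)`. -/
def ContDiffW (m : ℕ) (τ : ℝ) : ℕ → (ℝ → Wiener d n) → Prop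
  | 0, u => ContDiffOn ℝ m u (Icc 0 τ)
  | s + 1, u => ContDiffOn ℝ m u (Icc 0 τ) ∧
      ∀ μ : Fin d, ∃ v : ℝ → Wiener d n,
        (∀ t ∈ Icc 0 τ, IsPartial μ (u t) (v t)) ∧ ContDiffW m τ s v

end Wiener

/-! ### The Friedrichs system -/

/-- The data of the system `∂_t u + A(∂) u + ε⁻¹ E u = ε T(u,u,u)` for `u(t,x) ∈ ℝ^n`. -/
structure FriedrichsSystem (d n : ℕ) where
  /-- the coefficient matrices of `A(∂) = ∑ A_μ ∂_μ` -/
  A : Fin d → Matrix (Fin n) (Fin n) ℝ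
  A_symm : ∀ μ, (A μ).transpose = A μ
  E : Matrix (Fin n) (Fin n) ℝ
  E_skew : E.transpose = -E
  /-- the trilinear nonlinearity -/
  T : (Fin n → ℝ) →ₗ[ℝ] (Fin n → ℝ) →ₗ[ℝ] (Fin n → ℝ) →ₗ[ℝ] (Fin n → ℝ)

/-- Componentwise complex conjugate of a vector. -/
def conjVec {n : ℕ} (v : CVec n) : CVec n := WithLp.toLp 2 fun i => starRingEnd ℂ (v i)

/-- `v + c.c.` -/
def addCC {n : ℕ} (v : CVec n) : CVec n := v + conjVec v

/-- The action of a complex matrix on `ℂ^n`. -/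
abbrev act {n : ℕ} (M : Matrix (Fin n) (Fin n) ℂ) (v : CVec n) : CVec n :=
  Matrix.toEuclideanCLM (n := Fin n) (𝕜 := ℂ) M v

namespace FriedrichsSystem

variable {d n : ℕ} (S : FriedrichsSystem d n)

/-- The complex trilinear extension of `T`. -/
def TC (a b c : CVec n) : CVec n :=
  WithLp.toLp 2 fun i => ∑ p, ∑ q, ∑ r,
    ((S.T (Pi.single p 1) (Pi.single q 1) (Pi.single r 1) i : ℝ) : ℂ) * a p * b q * c r

/-- `A_μ` as a complex matrix. -/
def AC (μ : Fin d) : Matrix (Fin n) (Fin n) ℂ := (S.A μ).map Complex.ofReal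

/-- `E` as a complex matrix. -/
def EC : Matrix (Fin n) (Fin n) ℂ := S.E.map Complex.ofReal

/-- `A(β) = ∑ β_μ A_μ`. -/
def symbol (β : Pos d) : Matrix (Fin n) (Fin n) ℂ := ∑ μ, (β μ : ℂ) • S.AC μ

/-- `L(α,β) = -α I + A(β) - i E`. -/
def L (α : ℝ) (β : Pos d) : Matrix (Fin n) (Fin n) ℂ :=
  -((α : ℂ) • (1 : Matrix (Fin n) (Fin n) ℂ)) + S.symbol β - Complex.I • S.EC

/-- `i A(k) + ε⁻¹ E`, the Fourier symbol of `A(∂) + ε⁻¹ E`, as an operator on `ℂ^n`. -/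
def generator (ε : ℝ) (k : Pos d) : CVec n →L[ℂ] CVec n :=
  Matrix.toEuclideanCLM (n := Fin n) (𝕜 := ℂ)
    (Complex.I • S.symbol k + ((1 / ε : ℝ) : ℂ) • S.EC)

/-- `exp(-t (i A(k) + ε⁻¹ E))`. -/
def propagator (ε t : ℝ) (k : Pos d) : CVec n →L[ℂ] CVec n :=
  NormedSpace.exp (-((t : ℂ) • S.generator ε k))

theorem continuous_propagator (ε t : ℝ) : Continuous (S.propagator ε t) := by
  have h1 : Continuous fun k : Pos d =>
      Complex.I • S.symbol k + ((1 / ε : ℝ) : ℂ) • S.EC := by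
    unfold symbol; fun_prop
  have h2 : Continuous (Matrix.toEuclideanCLM (n := Fin n) (𝕜 := ℂ)) :=
    LinearMap.continuous_of_finiteDimensional
      ((Matrix.toEuclideanCLM (n := Fin n) (𝕜 := ℂ)).toAlgEquiv.toLinearMap)
  have h3 : Continuous (S.generator ε) := h2.comp h1
  let _ : NormedAlgebra ℚ (CVec n →L[ℂ] CVec n) := NormedAlgebra.restrictScalars ℚ ℂ _
  unfold propagator
  exact NormedSpace.exp_continuous.comp (h3.const_smul (t : ℂ)).neg

theorem star_generator (ε : ℝ) (k : Pos d) :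
    star (S.generator ε k) = -S.generator ε k := by
  have hA : ∀ μ, star (S.AC μ) = S.AC μ := by
    intro μ
    ext i j
    have := congrFun (congrFun (S.A_symm μ) i) j
    simp only [Matrix.transpose_apply] at this
    simp [AC, Matrix.star_apply, this]
  have hE : star S.EC = -S.EC := by
    ext i j
    have := congrFun (congrFun S.E_skew i) j
    simp only [Matrix.transpose_apply, Matrix.neg_apply] at this
    simp [EC, Matrix.star_apply, this]
  unfold generator
  rw [← map_star, ← map_neg]
  congr 1
  rw [star_add, star_smul, star_smul, hE, symbol, star_sum]
  simp only [star_smul, hA]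
  simp
  abel

theorem norm_propagator_apply (ε t : ℝ) (k : Pos d) (v : CVec n) :
    ‖S.propagator ε t k v‖ = ‖v‖ := by
  let _ : NormedAlgebra ℚ (CVec n →L[ℂ] CVec n) := NormedAlgebra.restrictScalars ℚ ℂ _
  have h : -((t : ℂ) • S.generator ε k) ∈ skewAdjoint (CVec n →L[ℂ] CVec n) := by
    rw [skewAdjoint.mem_iff, star_neg, star_smul, S.star_generator, Complex.star_def,
      Complex.conj_ofReal, smul_neg]
  have hu := NormedSpace.exp_mem_unitary_of_mem_skewAdjoint h
  exact ContinuousLinearMap.norm_map_of_mem_unitary hu v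

theorem integrable_propagator (ε t : ℝ) (g : FreqL1 d n) :
    Integrable fun k => S.propagator ε t k (g k) := by
  have hg := L1.integrable_coeFn g
  refine hg.mono ?_ (ae_of_all _ fun k => (S.norm_propagator_apply ε t k (g k)).le)
  exact (ContinuousLinearMap.apply ℂ (CVec n)).flip.aestronglyMeasurable_comp₂
    (S.continuous_propagator ε t).aestronglyMeasurable hg.1

/-- The group generated by `-(A(∂) + ε⁻¹ E)`, on the Fourier side: multiplication by
`exp(-t (i A(k) + ε⁻¹ E))` on `L¹`. -/
def flow (ε t : ℝ) (g : FreqL1 d n) : FreqL1 d n := (S.integrable_propagator ε t g).toL1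

/-- `u ∈ C([0,τ], W)` is a (real-valued) mild solution on `[0,τ]` of
`∂_t u + A(∂) u + ε⁻¹ E u = ε T(u,u,u)`, `u(0,x) = p(x) e^{iκ·x/ε} + c.c.`: Duhamel's formula,
written for the Fourier transforms, holds in `L¹`. Here `N(s) = T(u(s),u(s),u(s)) ∈ W`. -/
structure IsMildSolution (κ : Pos d) (ε τ : ℝ) (p : Pos d → CVec n) (u : ℝ → Wiener d n) :
    Prop where
  continuousOn : ContinuousOn u (Icc 0 τ)
  real : ∀ t ∈ Icc 0 τ, ∀ x i, (u t x i).im = 0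
  initial : ∀ x, u 0 x = addCC (Complex.exp (Complex.I * (inner ℝ κ x : ℝ) / ε) • p x)
  duhamel : ∃ N : ℝ → Wiener d n,
    (∀ s ∈ Icc 0 τ, ∀ x, N s x = S.TC (u s x) (u s x) (u s x)) ∧
    ∀ t ∈ Icc 0 τ, (u t).hat =
      S.flow ε t (u 0).hat + ε • ∫ s in (0 : ℝ)..t, S.flow ε (t - s) (N s).hat

/-- `u₁` is a classical solution on `[0,τ]`, with
`u₁ ∈ C^{2-ℓ}([0,τ], W^ℓ)` for `ℓ = 0, 1, 2`, of the equation of the slowly varying envelope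
`∂_t u₁ + (i/ε) L(ω,κ) u₁ + A(∂) u₁ = ε (T(u₁,u₁,ū₁) + T(u₁,ū₁,u₁) + T(ū₁,u₁,u₁))`,
`u₁(0) = p`. -/
structure IsEnvelope (ω : ℝ) (κ : Pos d) (ε τ : ℝ) (p : Pos d → CVec n)
    (u₁ : ℝ → Wiener d n) : Prop where
  regularity : ∀ ℓ ≤ 2, Wiener.ContDiffW (2 - ℓ) τ ℓ u₁
  initial : ∀ x, u₁ 0 x = p x
  pde : ∀ t ∈ Ioc 0 τ, ∀ x,
    (derivWithin u₁ (Icc 0 τ) t : Wiener d n) x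
      + (Complex.I / ε) • act (S.L ω κ) (u₁ t x)
      + ∑ μ, act (S.AC μ) (lineDeriv ℝ (u₁ t) x (EuclideanSpace.single μ 1))
    = ε • (S.TC (u₁ t x) (u₁ t x) (conjVec (u₁ t x))
        + S.TC (u₁ t x) (conjVec (u₁ t x)) (u₁ t x)
        + S.TC (conjVec (u₁ t x)) (u₁ t x) (u₁ t x))

/-- Smooth eigendecomposition of the Hermitian matrices `L(0,β) = A(β) - i E`: the numbers
`ω_ℓ(β)` are the eigenvalues with multiplicity, the `ψ_ℓ(β)` form an orthonormal basis of
eigenvectors, and both are smooth away from `β = 0`. -/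
structure IsSmoothEigendecomposition (eig : Fin n → Pos d → ℝ) (vec : Fin n → Pos d → CVec n) :
    Prop where
  eigen : ∀ ℓ β, act (S.L 0 β) (vec ℓ β) = (eig ℓ β : ℂ) • vec ℓ β
  orthonormal : ∀ β, Orthonormal ℂ fun ℓ => vec ℓ β
  smooth_eig : ∀ ℓ, ContDiffOn ℝ ((⊤ : ℕ∞) : WithTop ℕ∞) (eig ℓ) {0}ᶜ
  smooth_vec : ∀ ℓ, ContDiffOn ℝ ((⊤ : ℕ∞) : WithTop ℕ∞) (vec ℓ) {0}ᶜ

end FriedrichsSystem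

/-- The slowly varying envelope approximation
`ũ(t,x) = e^{i(κ·x - ωt)/ε} u₁(t,x) + c.c.` -/
def approx {d n : ℕ} (ω : ℝ) (κ : Pos d) (ε : ℝ) (u₁ : ℝ → Wiener d n) (t : ℝ) (x : Pos d) :
    CVec n :=
  addCC (Complex.exp (Complex.I * ((inner ℝ κ x : ℝ) - ω * t) / ε) • u₁ t x)

end SVEA

end

/-! Everything is done for Fourier transforms, in $L^1$. Since the $A_\ell$ are symmetric and $E$ is
skew, the linear evolution multiplies by unitary matrices and is an isometry of $L^1$; the cubic
term is a double convolution, hence bounded. With the prefactor $\varepsilon$, Picard iteration in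
the interaction picture reaches times of order $1/\varepsilon$ (`exists_integral_solution`). For
$u_1$ it is run on $(1-\Delta)u_1$, which yields the classical regularity.

For the error bound, $\widetilde u^{(1)}$ satisfies the Duhamel formula of $u$ up to the third
harmonic $\varepsilon\,\mathrm e^{3\mathrm i(\kappa\cdot x-\omega t)/\varepsilon}T(u_1,u_1,u_1)$ and
its conjugate (`IsMildEnvelope.evol_neg_approx`). Grönwall's inequality on $[0,t_{\rm
end}/\varepsilon]$ costs a constant (`norm_sub_approx_le`), so it suffices that the time integral of
$T(u_1,u_1,u_1)$, pulled back by the evolution of $\mathcal L(3\omega,3\kappa+\varepsilon k)$, is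
$O(\varepsilon)$. The trivial bound is $O(1/\varepsilon)$; two powers of $\varepsilon$ must be
gained (`IsNonresonant.norm_third_harmonic_le`).

The envelope is split into a tail with $|k|>\rho/\varepsilon$, the carrier mode and the other modes.

The tail is $O(\varepsilon^2)$, because two derivatives of $u_1$ stay bounded uniformly in
$\varepsilon$ (`IsMildEnvelope.norm_weighted_le`).

The other modes are $O(\varepsilon)$ (`IsNonresonant.offSize_le`): initially by polarization and the
spectral gap, later because the carrier mode forces them only through oscillating terms, the rest
being closed by Grönwall.

Interactions with at most one factor outside the carrier mode have phase velocity
$\varepsilon^{-1}(\lambda-\lambda')$ at $k=0$, where $\lambda$ and $\lambda'$ are eigenvalues of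
$\mathcal L(3\omega,3\kappa)$ and $\mathcal L(\omega,\kappa)$. These differ by assumption, and
Lipschitz continuity of the $\omega_\ell$ keeps the phase large for $|k|\le\rho/\varepsilon$.
Integration by parts in time then gives $O(\varepsilon)$, since the amplitudes have derivatives
$O(\varepsilon)$ (`norm_integral_nonresonant_le`). What remains contains the tail or two small
factors, hence is $O(\varepsilon^2)$ pointwise in time and $O(\varepsilon)$ after integration. -/

noncomputable section

set_option maxSynthPendingDepth 3
open MeasureTheory Set
open scoped FourierTransform SchwartzMap

namespace SVEA

/-! ### Multiplication operators on `L¹` -/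

section MulOp

variable {X : Type*} [MeasurableSpace X] {μ : Measure X}
variable {E F G : Type*} [NormedAddCommGroup E] [NormedSpace ℝ E] [NormedAddCommGroup F]
  [NormedSpace ℝ F] [NormedAddCommGroup G] [NormedSpace ℝ G]

/-- A bounded measurable operator-valued symbol. -/
structure IsSymbol (μ : Measure X) (φ : X → E →L[ℝ] F) : Prop where
  meas : AEStronglyMeasurable φ μ
  bdd : ∃ C : ℝ, ∀ x, ‖φ x‖ ≤ C

theorem IsSymbol.integrable {φ : X → E →L[ℝ] F} (hφ : IsSymbol μ φ) (f : Lp E 1 μ) :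
    Integrable (fun x => φ x (f x)) μ := by
  obtain ⟨C, hC⟩ := hφ.bdd
  have hf := L1.integrable_coeFn f
  refine (hf.norm.const_mul C).mono' ?_ (ae_of_all _ fun x => (φ x).le_of_opNorm_le (hC x) _)
  exact (ContinuousLinearMap.apply ℝ F).flip.aestronglyMeasurable_comp₂ hφ.meas hf.1

theorem IsSymbol.comp {φ : X → F →L[ℝ] G} {ψ : X → E →L[ℝ] F} (hφ : IsSymbol μ φ)
    (hψ : IsSymbol μ ψ) : IsSymbol μ fun x => (φ x).comp (ψ x) := by
  obtain ⟨C, hC⟩ := hφ.bdd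
  obtain ⟨D, hD⟩ := hψ.bdd
  refine ⟨(ContinuousLinearMap.compL ℝ E F G).aestronglyMeasurable_comp₂ hφ.meas hψ.meas,
    C * D, fun x => ?_⟩
  exact ((φ x).opNorm_comp_le _).trans (mul_le_mul (hC x) (hD x) (norm_nonneg _)
    ((norm_nonneg _).trans (hC x)))

theorem IsSymbol.add {φ ψ : X → E →L[ℝ] F} (hφ : IsSymbol μ φ)
    (hψ : IsSymbol μ ψ) : IsSymbol μ fun x => φ x + ψ x := by
  obtain ⟨C, hC⟩ := hφ.bdd
  obtain ⟨D, hD⟩ := hψ.bdd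
  exact ⟨hφ.meas.add hψ.meas, C + D, fun x => (norm_add_le _ _).trans (add_le_add (hC x) (hD x))⟩

theorem IsSymbol.const_smul {φ : X → E →L[ℝ] F} (hφ : IsSymbol μ φ) (c : ℝ) :
    IsSymbol μ fun x => c • φ x := by
  obtain ⟨C, hC⟩ := hφ.bdd
  refine ⟨hφ.meas.const_smul c, |c| * C, fun x => ?_⟩
  rw [norm_smul, Real.norm_eq_abs]
  exact mul_le_mul_of_nonneg_left (hC x) (abs_nonneg c)

theorem IsSymbol.neg {φ : X → E →L[ℝ] F} (hφ : IsSymbol μ φ) : IsSymbol μ fun x => -φ x := by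
  obtain ⟨C, hC⟩ := hφ.bdd
  exact ⟨hφ.meas.neg, C, fun x => by rw [norm_neg]; exact hC x⟩

theorem IsSymbol.sub {φ ψ : X → E →L[ℝ] F} (hφ : IsSymbol μ φ)
    (hψ : IsSymbol μ ψ) : IsSymbol μ fun x => φ x - ψ x := by
  simpa only [sub_eq_add_neg] using hφ.add hψ.neg

open Classical in
/-- Pointwise application of the symbol `φ` on `L¹`; zero if `φ` is not a symbol. -/
def mulOp (μ : Measure X) (φ : X → E →L[ℝ] F) : Lp E 1 μ →L[ℝ] Lp F 1 μ :=
  if hφ : IsSymbol μ φ then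
    LinearMap.mkContinuousOfExistsBound
      { toFun := fun f => (hφ.integrable f).toL1
        map_add' := fun f g => by
          rw [← Integrable.toL1_add, Integrable.toL1_eq_toL1_iff]
          filter_upwards [Lp.coeFn_add f g] with x hx
          rw [hx, Pi.add_apply, map_add, Pi.add_apply]
        map_smul' := fun c f => by
          rw [RingHom.id_apply, ← Integrable.toL1_smul, Integrable.toL1_eq_toL1_iff]
          filter_upwards [Lp.coeFn_smul c f] with x hx
          rw [hx, Pi.smul_apply, map_smul] }
      (by
        obtain ⟨C, hC⟩ := hφ.bdd
        refine ⟨C, fun f => ?_⟩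
        have hf := L1.integrable_coeFn f
        simp only [LinearMap.coe_mk, AddHom.coe_mk]
        rw [L1.norm_of_fun_eq_integral_norm, L1.norm_eq_integral_norm, ← integral_const_mul]
        exact integral_mono (hφ.integrable f).norm (hf.norm.const_mul C)
          fun x => (φ x).le_of_opNorm_le (hC x) _)
  else 0

theorem coeFn_mulOp {φ : X → E →L[ℝ] F} (hφ : IsSymbol μ φ) (f : Lp E 1 μ) :
    mulOp μ φ f =ᵐ[μ] fun x => φ x (f x) := by
  rw [mulOp, dif_pos hφ]
  exact (hφ.integrable f).coeFn_toL1

theorem norm_mulOp_eq {φ : X → E →L[ℝ] F} (hφ : IsSymbol μ φ) (f : Lp E 1 μ) :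
    ‖mulOp μ φ f‖ = ∫ x, ‖φ x (f x)‖ ∂μ := by
  rw [L1.norm_eq_integral_norm]
  exact integral_congr_ae ((coeFn_mulOp hφ f).mono fun x hx => by simp only [hx])

theorem norm_mulOp_apply_le {φ : X → E →L[ℝ] F} {C : ℝ} (hC0 : 0 ≤ C) (hC : ∀ x, ‖φ x‖ ≤ C)
    (f : Lp E 1 μ) : ‖mulOp μ φ f‖ ≤ C * ‖f‖ := by
  by_cases hφ : IsSymbol μ φ
  · rw [norm_mulOp_eq hφ, L1.norm_eq_integral_norm, ← integral_const_mul]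
    exact integral_mono (hφ.integrable f).norm ((L1.integrable_coeFn f).norm.const_mul C)
      fun x => (φ x).le_of_opNorm_le (hC x) _
  · rw [mulOp, dif_neg hφ, zero_apply, norm_zero]
    positivity

theorem opNorm_mulOp_le {φ : X → E →L[ℝ] F} {C : ℝ} (hC0 : 0 ≤ C) (hC : ∀ x, ‖φ x‖ ≤ C) :
    ‖mulOp μ φ‖ ≤ C :=
  ContinuousLinearMap.opNorm_le_bound _ hC0 fun f => norm_mulOp_apply_le hC0 hC f

theorem norm_mulOp_of_isometry {φ : X → E →L[ℝ] F} (hφ : IsSymbol μ φ)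
    (h : ∀ x v, ‖φ x v‖ = ‖v‖) (f : Lp E 1 μ) : ‖mulOp μ φ f‖ = ‖f‖ := by
  rw [norm_mulOp_eq hφ, L1.norm_eq_integral_norm]
  simp only [h]

theorem mulOp_eq_of_ae {φ : X → E →L[ℝ] F} (hφ : IsSymbol μ φ) {f : Lp E 1 μ} {g : Lp F 1 μ}
    (h : ∀ᵐ x ∂μ, g x = φ x (f x)) : mulOp μ φ f = g := by
  refine Lp.ext ?_
  filter_upwards [coeFn_mulOp hφ f, h] with x h1 h2
  rw [h1, h2]

theorem mulOp_congr_ae {φ ψ : X → E →L[ℝ] F} (hφ : IsSymbol μ φ) (hψ : IsSymbol μ ψ)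
    {f : Lp E 1 μ} (h : ∀ᵐ x ∂μ, φ x (f x) = ψ x (f x)) : mulOp μ φ f = mulOp μ ψ f := by
  refine mulOp_eq_of_ae hφ ?_
  filter_upwards [coeFn_mulOp hψ f, h] with x h1 h2
  rw [h1, h2]

theorem mulOp_comp {φ : X → F →L[ℝ] G} {ψ : X → E →L[ℝ] F} (hφ : IsSymbol μ φ)
    (hψ : IsSymbol μ ψ) (f : Lp E 1 μ) :
    mulOp μ φ (mulOp μ ψ f) = mulOp μ (fun x => (φ x).comp (ψ x)) f := by
  refine mulOp_eq_of_ae hφ ?_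
  filter_upwards [coeFn_mulOp hψ f, coeFn_mulOp (hφ.comp hψ) f] with x h1 h2
  rw [h1, h2]; rfl

theorem mulOp_add {φ ψ : X → E →L[ℝ] F} (hφ : IsSymbol μ φ) (hψ : IsSymbol μ ψ) :
    mulOp μ (fun x => φ x + ψ x) = mulOp μ φ + mulOp μ ψ := by
  ext1 f
  refine mulOp_eq_of_ae (hφ.add hψ) ?_
  filter_upwards [coeFn_mulOp hψ f, coeFn_mulOp hφ f, Lp.coeFn_add (mulOp μ φ f) (mulOp μ ψ f)]
    with x h1 h2 h3
  rw [add_apply, h3, Pi.add_apply, h1, h2]; rfl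

theorem mulOp_smul {φ : X → E →L[ℝ] F} (hφ : IsSymbol μ φ) (c : ℝ) :
    mulOp μ (fun x => c • φ x) = c • mulOp μ φ := by
  ext1 f
  refine mulOp_eq_of_ae (hφ.const_smul c) ?_
  filter_upwards [coeFn_mulOp hφ f, Lp.coeFn_smul c (mulOp μ φ f)] with x h1 h2
  rw [smul_apply, h2, Pi.smul_apply, h1]; rfl

theorem mulOp_neg {φ : X → E →L[ℝ] F} (hφ : IsSymbol μ φ) :
    mulOp μ (fun x => -φ x) = -mulOp μ φ := by
  simpa using mulOp_smul hφ (-1)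

theorem mulOp_sub {φ ψ : X → E →L[ℝ] F} (hφ : IsSymbol μ φ) (hψ : IsSymbol μ ψ) :
    mulOp μ (fun x => φ x - ψ x) = mulOp μ φ - mulOp μ ψ := by
  simp only [sub_eq_add_neg]
  rw [mulOp_add hφ hψ.neg, mulOp_neg hψ]

theorem isSymbol_const (A : E →L[ℝ] F) : IsSymbol μ fun _ : X => A :=
  ⟨aestronglyMeasurable_const, ‖A‖, fun _ => le_rfl⟩

theorem mulOp_id : mulOp μ (fun _ : X => ContinuousLinearMap.id ℝ E) = ContinuousLinearMap.id ℝ _ := by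
  ext1 f
  exact mulOp_eq_of_ae (isSymbol_const _) (ae_of_all _ fun x => rfl)

/-- A uniformly bounded family of operators which is strongly continuous acts continuously on
continuous curves. -/
theorem continuous_clm_apply_of_strong {A B : Type*} [NormedAddCommGroup A] [NormedSpace ℝ A]
    [NormedAddCommGroup B] [NormedSpace ℝ B] {U : ℝ → A →L[ℝ] B} {C : ℝ}
    (hU : ∀ t, ‖U t‖ ≤ C) (hs : ∀ a, Continuous fun t => U t a) {f : ℝ → A}
    (hf : Continuous f) : Continuous fun t => U t (f t) := by
  rw [continuous_iff_continuousAt]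
  intro t₀
  have h1 : Filter.Tendsto (fun t => U t (f t - f t₀)) (nhds t₀) (nhds 0) := by
    refine squeeze_zero_norm (a := fun t => C * ‖f t - f t₀‖)
      (fun t => (U t).le_of_opNorm_le (hU t) _) ?_
    have : Continuous fun t => C * ‖f t - f t₀‖ := by fun_prop
    simpa using this.tendsto t₀
  have h2 := h1.add ((hs (f t₀)).tendsto t₀)
  simp only [zero_add, map_sub, sub_add_cancel] at h2
  exact h2

/-- Dominated convergence with majorant $2C|f|$. Only strong continuity can be expected: pointwise
continuity of the symbol in time need not be uniform in frequency. -/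
theorem continuous_mulOp_apply {φ : ℝ → X → E →L[ℝ] F} (hφ : ∀ t, IsSymbol μ (φ t)) {C : ℝ}
    (hC : ∀ t x, ‖φ t x‖ ≤ C) (hc : ∀ x, Continuous fun t => φ t x) (f : Lp E 1 μ) :
    Continuous fun t => mulOp μ (φ t) f := by
  rw [continuous_iff_continuousAt]
  intro t₀
  rw [ContinuousAt, tendsto_iff_norm_sub_tendsto_zero]
  have h : ∀ t, ‖mulOp μ (φ t) f - mulOp μ (φ t₀) f‖ = ∫ x, ‖(φ t x - φ t₀ x) (f x)‖ ∂μ := by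
    intro t
    rw [← sub_apply, ← mulOp_sub (hφ t) (hφ t₀), norm_mulOp_eq]
    exact (hφ t).sub (hφ t₀)
  simp only [h]
  have h0 : (0 : ℝ) = ∫ x, ‖(φ t₀ x - φ t₀ x) (f x)‖ ∂μ := by simp
  rw [h0]
  refine tendsto_integral_filter_of_dominated_convergence (fun x => (C + C) * ‖f x‖) ?_ ?_ ?_ ?_
  · exact Filter.Eventually.of_forall fun t => (((hφ t).sub (hφ t₀)).integrable f).norm.1
  · refine Filter.Eventually.of_forall fun t => ae_of_all _ fun x => ?_
    rw [norm_norm]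
    exact ContinuousLinearMap.le_of_opNorm_le _
      ((norm_sub_le _ _).trans (add_le_add (hC t x) (hC t₀ x))) _
  · exact (L1.integrable_coeFn f).norm.const_mul _
  · refine ae_of_all _ fun x => ?_
    have : Continuous fun t => ‖(φ t x - φ t₀ x) (f x)‖ :=
      (((hc x).sub continuous_const).clm_apply continuous_const).norm
    exact this.tendsto t₀

/-- If the symbols `φ t` are differentiable in `t` with bounded and uniformly Lipschitz derivative,
the multiplication operators are norm differentiable. -/
theorem hasDerivAt_mulOp {φ φ' : ℝ → X → E →L[ℝ] F} (hφ : ∀ t, IsSymbol μ (φ t))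
    (hφ' : ∀ t, IsSymbol μ (φ' t)) (hd : ∀ t x, HasDerivAt (fun s => φ s x) (φ' t x) t) {C : ℝ}
    (hL : ∀ s t x, ‖φ' s x - φ' t x‖ ≤ C * |s - t|) (t : ℝ) :
    HasDerivAt (fun s => mulOp μ (φ s)) (mulOp μ (φ' t)) t := by
  -- A point of `X` is needed to read off `0 ≤ C`; on an empty space all operators coincide.
  by_cases hX : Nonempty X
  swap
  · have h0 : ∀ ψ : X → E →L[ℝ] F, mulOp μ ψ = mulOp μ (φ' t) := fun ψ => by
      congr 1; ext1 x; exact (hX ⟨x⟩).elim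
    have : mulOp μ (φ' t) = 0 := by
      ext1 f
      refine mulOp_eq_of_ae (hφ' t) (ae_of_all _ fun x => (hX ⟨x⟩).elim)
    simp only [h0]
    rw [this]
    exact hasDerivAt_const _ _
  have hC : 0 ≤ C := by
    obtain ⟨x⟩ := hX
    have := (norm_nonneg _).trans (hL 1 0 x)
    simpa using this
  rw [hasDerivAt_iff_isLittleO]
  refine Asymptotics.IsBigO.trans_isLittleO (g := fun s : ℝ => ‖s - t‖ ^ 2) ?_ ?_
  · refine Asymptotics.IsBigO.of_bound C (Filter.Eventually.of_forall fun s => ?_)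
    have : mulOp μ (φ s) - mulOp μ (φ t) - (s - t) • mulOp μ (φ' t)
        = mulOp μ (fun x => φ s x - φ t x - (s - t) • φ' t x) := by
      rw [mulOp_sub ((hφ s).sub (hφ t)) ((hφ' t).const_smul _), mulOp_sub (hφ s) (hφ t),
        mulOp_smul (hφ' t)]
    rw [this]
    refine opNorm_mulOp_le (by positivity) fun x => ?_
    -- Mean value inequality for the symbol minus its linear part: on the segment the derivative is
    -- at most `C * |s - t|`, so the remainder is quadratic, uniformly in `x`.
    have key := Convex.norm_image_sub_le_of_norm_hasDerivWithin_le
      (f := fun r => φ r x - r • φ' t x) (f' := fun r => φ' r x - φ' t x) (s := uIcc t s)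
      (C := C * |s - t|) (x := t) (y := s)
      (fun r _ => by
        have h := ((hd r x).sub ((hasDerivAt_id r).smul_const (φ' t x))).hasDerivWithinAt
          (s := uIcc t s)
        simp only [one_smul] at h
        exact h)
      (fun r hr => (hL r t x).trans (mul_le_mul_of_nonneg_left
        (by simpa [abs_sub_comm] using abs_sub_left_of_mem_uIcc hr) hC))
      (convex_uIcc t s) left_mem_uIcc right_mem_uIcc
    simp only [Real.norm_eq_abs] at key
    calc ‖φ s x - φ t x - (s - t) • φ' t x‖ = ‖φ s x - s • φ' t x - (φ t x - t • φ' t x)‖ := by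
          congr 1; rw [sub_smul]; abel
      _ ≤ _ := key
      _ = C * ‖‖s - t‖ ^ 2‖ := by rw [norm_pow, norm_norm, Real.norm_eq_abs]; ring
  · exact Asymptotics.isLittleO_pow_sub_sub t (m := 2) (by norm_num)

end MulOp


/-! ### Bounded trilinear maps -/

section IsTri

variable {U V W Z Z' : Type*} [NormedAddCommGroup U] [NormedSpace ℝ U] [NormedAddCommGroup V]
  [NormedSpace ℝ V] [NormedAddCommGroup W] [NormedSpace ℝ W] [NormedAddCommGroup Z]
  [NormedSpace ℝ Z] [NormedAddCommGroup Z'] [NormedSpace ℝ Z']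

/-- `B` is a bounded trilinear map. -/
def IsTri (B : U → V → W → Z) : Prop :=
  ∃ T : U →L[ℝ] V →L[ℝ] W →L[ℝ] Z, ∀ a b c, B a b c = T a b c

variable {B : U → V → W → Z}

theorem IsTri.post (hB : IsTri B) (P : Z →L[ℝ] Z') : IsTri fun a b c => P (B a b c) := by
  obtain ⟨T, hT⟩ := hB
  exact ⟨(ContinuousLinearMap.compL ℝ V (W →L[ℝ] Z) (W →L[ℝ] Z')
    (ContinuousLinearMap.compL ℝ W Z Z' P)).comp T, fun a b c => congrArg P (hT a b c)⟩

theorem IsTri.add {B' : U → V → W → Z} (hB : IsTri B) (hB' : IsTri B') :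
    IsTri fun a b c => B a b c + B' a b c := by
  obtain ⟨T, hT⟩ := hB
  obtain ⟨T', hT'⟩ := hB'
  exact ⟨T + T', fun a b c => congrArg₂ (· + ·) (hT a b c) (hT' a b c)⟩

theorem IsTri.bound (hB : IsTri B) :
    ∃ C : ℝ, 0 ≤ C ∧ ∀ a b c, ‖B a b c‖ ≤ C * (‖a‖ * ‖b‖ * ‖c‖) := by
  obtain ⟨T, hT⟩ := hB
  refine ⟨‖T‖, norm_nonneg _, fun a b c => ?_⟩
  rw [hT]
  refine ((T a b).le_opNorm c).trans ?_
  calc _ ≤ ‖T‖ * ‖a‖ * ‖b‖ * ‖c‖ :=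
        mul_le_mul_of_nonneg_right (T.le_opNorm₂ a b) (norm_nonneg _)
    _ = _ := by ring

theorem IsTri.add_left (hB : IsTri B) (a a' : U) (b : V) (c : W) :
    B (a + a') b c = B a b c + B a' b c := by
  obtain ⟨T, hT⟩ := hB; simp [hT]

theorem IsTri.add_middle (hB : IsTri B) (a : U) (b b' : V) (c : W) :
    B a (b + b') c = B a b c + B a b' c := by
  obtain ⟨T, hT⟩ := hB; simp [hT]

theorem IsTri.add_right (hB : IsTri B) (a : U) (b : V) (c c' : W) :
    B a b (c + c') = B a b c + B a b c' := by
  obtain ⟨T, hT⟩ := hB; simp [hT]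

theorem IsTri.sub_left (hB : IsTri B) (a a' : U) (b : V) (c : W) :
    B (a - a') b c = B a b c - B a' b c := by
  obtain ⟨T, hT⟩ := hB; simp [hT]

theorem IsTri.sub_middle (hB : IsTri B) (a : U) (b b' : V) (c : W) :
    B a (b - b') c = B a b c - B a b' c := by
  obtain ⟨T, hT⟩ := hB; simp [hT]

theorem IsTri.sub_right (hB : IsTri B) (a : U) (b : V) (c c' : W) :
    B a b (c - c') = B a b c - B a b c' := by
  obtain ⟨T, hT⟩ := hB; simp [hT]

theorem IsTri.continuous (hB : IsTri B) {X : Type*} [TopologicalSpace X] {f : X → U} {g : X → V}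
    {h : X → W} (hf : Continuous f) (hg : Continuous g) (hh : Continuous h) :
    Continuous fun x => B (f x) (g x) (h x) := by
  obtain ⟨T, hT⟩ := hB
  simp only [hT]
  fun_prop

theorem IsTri.contDiffOn (hB : IsTri B) {m : WithTop ℕ∞} {s : Set ℝ} {f : ℝ → U}
    {g : ℝ → V} {h : ℝ → W} (hf : ContDiffOn ℝ m f s) (hg : ContDiffOn ℝ m g s)
    (hh : ContDiffOn ℝ m h s) : ContDiffOn ℝ m (fun x => B (f x) (g x) (h x)) s := by
  obtain ⟨T, hT⟩ := hB
  simp only [hT]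
  exact ((T.contDiff.comp_contDiffOn hf).clm_apply hg).clm_apply hh

theorem IsTri.hasDerivAt (hB : IsTri B) {f : ℝ → U} {g : ℝ → V} {h : ℝ → W} {f' : U} {g' : V}
    {h' : W} {t : ℝ} (hf : HasDerivAt f f' t) (hg : HasDerivAt g g' t) (hh : HasDerivAt h h' t) :
    HasDerivAt (fun s => B (f s) (g s) (h s))
      (B f' (g t) (h t) + B (f t) g' (h t) + B (f t) (g t) h') t := by
  obtain ⟨T, hT⟩ := hB
  simp only [hT]
  exact ((T.hasFDerivAt.comp_hasDerivAt t hf).clm_apply hg).clm_apply hh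

/-- Telescoping of trilinear differences. -/
theorem IsTri.sub_eq (hB : IsTri B) (a a' : U) (b b' : V) (c c' : W) :
    B a b c - B a' b' c' = B (a - a') b c + B a' (b - b') c + B a' b' (c - c') := by
  rw [hB.sub_left, hB.sub_middle, hB.sub_right]
  abel

end IsTri

/-! ### Tensor products of `L¹` functions -/

section Tensor

variable {X Y Z : Type*} [MeasurableSpace X] [MeasurableSpace Y] [MeasurableSpace Z]
  {μ : Measure X} {ν : Measure Y} {ρ : Measure Z}
variable {E F F' G : Type*} [NormedAddCommGroup E] [NormedSpace ℝ E] [NormedAddCommGroup F]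
  [NormedSpace ℝ F] [NormedAddCommGroup F'] [NormedSpace ℝ F'] [NormedAddCommGroup G]
  [NormedSpace ℝ G]

theorem ae_prod_fst {p : X → Prop} (h : ∀ᵐ x ∂μ, p x) : ∀ᵐ z ∂μ.prod ν, p z.1 :=
  Measure.quasiMeasurePreserving_fst.ae h

theorem ae_prod_snd [SFinite ν] {p : Y → Prop} (h : ∀ᵐ y ∂ν, p y) : ∀ᵐ z ∂μ.prod ν, p z.2 :=
  Measure.quasiMeasurePreserving_snd.ae h

theorem integrable_tens (B : E →L[ℝ] F →L[ℝ] G) (f : Lp E 1 μ) (g : Lp F 1 ν) :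
    Integrable (fun z : X × Y => B (f z.1) (g z.2)) (μ.prod ν) :=
  (L1.integrable_coeFn f).op_fst_snd (op := fun x y => B x y) (by fun_prop)
    ⟨‖B‖, B.le_opNorm₂⟩ (L1.integrable_coeFn g)

variable [SFinite μ] [SFinite ν] [SFinite ρ]

/-- The bilinear map `(f, g) ↦ ((x, y) ↦ B (f x) (g y))` on `L¹`. -/
def tens (μ : Measure X) (ν : Measure Y) [SFinite μ] [SFinite ν] (B : E →L[ℝ] F →L[ℝ] G) :
    Lp E 1 μ →L[ℝ] Lp F 1 ν →L[ℝ] Lp G 1 (μ.prod ν) :=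
  LinearMap.mkContinuous₂
    (LinearMap.mk₂ ℝ (fun f g => (integrable_tens B f g).toL1)
      (fun f₁ f₂ g => by
        rw [← Integrable.toL1_add, Integrable.toL1_eq_toL1_iff]
        filter_upwards [ae_prod_fst (ν := ν) (Lp.coeFn_add f₁ f₂)] with z hz
        rw [hz, Pi.add_apply, map_add]; rfl)
      (fun c f g => by
        rw [← Integrable.toL1_smul, Integrable.toL1_eq_toL1_iff]
        filter_upwards [ae_prod_fst (ν := ν) (Lp.coeFn_smul c f)] with z hz
        rw [hz, Pi.smul_apply, map_smul]; rfl)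
      (fun f g₁ g₂ => by
        rw [← Integrable.toL1_add, Integrable.toL1_eq_toL1_iff]
        filter_upwards [ae_prod_snd (μ := μ) (Lp.coeFn_add g₁ g₂)] with z hz
        rw [hz, Pi.add_apply, map_add]; rfl)
      (fun c f g => by
        rw [← Integrable.toL1_smul, Integrable.toL1_eq_toL1_iff]
        filter_upwards [ae_prod_snd (μ := μ) (Lp.coeFn_smul c g)] with z hz
        rw [hz, Pi.smul_apply, map_smul]))
    ‖B‖
    (fun f g => by
      have hf := L1.integrable_coeFn f
      have hg := L1.integrable_coeFn g
      rw [LinearMap.mk₂_apply, L1.norm_of_fun_eq_integral_norm, L1.norm_eq_integral_norm f,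
        L1.norm_eq_integral_norm g, mul_assoc, ← integral_prod_mul, ← integral_const_mul]
      refine integral_mono (integrable_tens B f g).norm ((hf.norm.mul_prod hg.norm).const_mul _)
        fun z => ?_
      rw [← mul_assoc]
      exact B.le_opNorm₂ _ _)

theorem coeFn_tens (B : E →L[ℝ] F →L[ℝ] G) (f : Lp E 1 μ) (g : Lp F 1 ν) :
    tens μ ν B f g =ᵐ[μ.prod ν] fun z => B (f z.1) (g z.2) :=
  (integrable_tens B f g).coeFn_toL1

theorem integral_tens [CompleteSpace E] [CompleteSpace F] [CompleteSpace G]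
    (B : E →L[ℝ] F →L[ℝ] G) (f : Lp E 1 μ) (g : Lp F 1 ν) :
    ∫ z, tens μ ν B f g z ∂μ.prod ν = B (∫ x, f x ∂μ) (∫ y, g y ∂ν) := by
  rw [integral_congr_ae (coeFn_tens B f g), integral_prod _ (integrable_tens B f g)]
  simp only
  have h : ∀ x, ∫ y, B (f x) (g y) ∂ν = B.flip (∫ y, g y ∂ν) (f x) := fun x =>
    (B (f x)).integral_comp_comm (L1.integrable_coeFn g)
  simp only [h]
  exact (B.flip (∫ y, g y ∂ν)).integral_comp_comm (L1.integrable_coeFn f)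

/-- The trilinear map `(a, b, c) ↦ S a (R b c)`. -/
def compTri {A B C D H : Type*} [NormedAddCommGroup A] [NormedSpace ℝ A] [NormedAddCommGroup B]
    [NormedSpace ℝ B] [NormedAddCommGroup C] [NormedSpace ℝ C] [NormedAddCommGroup D]
    [NormedSpace ℝ D] [NormedAddCommGroup H] [NormedSpace ℝ H] (S : A →L[ℝ] H →L[ℝ] D)
    (R : B →L[ℝ] C →L[ℝ] H) : A →L[ℝ] B →L[ℝ] C →L[ℝ] D :=
  ((ContinuousLinearMap.compL ℝ B (C →L[ℝ] H) (C →L[ℝ] D)).flip R).comp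
    ((ContinuousLinearMap.compL ℝ C H D).comp S)

/-- A trilinear map with its first argument moved to the end. -/
def moveFirst (T : E →L[ℝ] F →L[ℝ] F' →L[ℝ] G) : F →L[ℝ] F' →L[ℝ] E →L[ℝ] G :=
  ((ContinuousLinearMap.flipₗᵢ ℝ E F' G : (E →L[ℝ] F' →L[ℝ] G) →L[ℝ] _)).comp T.flip

/-- The trilinear map `(f, g, h) ↦ ((x, y, z) ↦ T (f x) (g y) (h z))` on `L¹`. -/
def triT (μ : Measure X) (ν : Measure Y) (ρ : Measure Z) [SFinite μ] [SFinite ν] [SFinite ρ]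
    (T : E →L[ℝ] F →L[ℝ] F' →L[ℝ] G) :
    Lp E 1 μ →L[ℝ] Lp F 1 ν →L[ℝ] Lp F' 1 ρ →L[ℝ] Lp G 1 (μ.prod (ν.prod ρ)) :=
  compTri (tens μ (ν.prod ρ) (ContinuousLinearMap.apply ℝ G : E →L[ℝ] (E →L[ℝ] G) →L[ℝ] G))
    (tens ν ρ (moveFirst T))

theorem triT_apply (T : E →L[ℝ] F →L[ℝ] F' →L[ℝ] G) (f : Lp E 1 μ) (g : Lp F 1 ν)
    (h : Lp F' 1 ρ) : triT μ ν ρ T f g h =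
      tens μ (ν.prod ρ) (ContinuousLinearMap.apply ℝ G : E →L[ℝ] (E →L[ℝ] G) →L[ℝ] G) f
        (tens ν ρ (moveFirst T) g h) := rfl

theorem coeFn_triT (T : E →L[ℝ] F →L[ℝ] F' →L[ℝ] G) (f : Lp E 1 μ) (g : Lp F 1 ν)
    (h : Lp F' 1 ρ) : triT μ ν ρ T f g h =ᵐ[μ.prod (ν.prod ρ)]
      fun z => T (f z.1) (g z.2.1) (h z.2.2) := by
  rw [triT_apply]
  filter_upwards [coeFn_tens (μ := μ) (ν := ν.prod ρ)
    (ContinuousLinearMap.apply ℝ G : E →L[ℝ] (E →L[ℝ] G) →L[ℝ] G) f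
        (tens ν ρ (moveFirst T) g h), ae_prod_snd (μ := μ) (coeFn_tens (moveFirst T) g h)]
    with z h1 h2
  rw [h1, h2]; rfl

theorem integral_triT [CompleteSpace E] [CompleteSpace F] [CompleteSpace F'] [CompleteSpace G]
    (T : E →L[ℝ] F →L[ℝ] F' →L[ℝ] G) (f : Lp E 1 μ) (g : Lp F 1 ν) (h : Lp F' 1 ρ) :
    ∫ z, triT μ ν ρ T f g h z ∂μ.prod (ν.prod ρ) =
      T (∫ x, f x ∂μ) (∫ y, g y ∂ν) (∫ z, h z ∂ρ) := by
  rw [triT_apply, integral_tens, integral_tens]; rfl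

theorem norm_triT_le {T : E →L[ℝ] F →L[ℝ] F' →L[ℝ] G} {C : ℝ}
    (hC : ∀ x y z, ‖T x y z‖ ≤ C * (‖x‖ * ‖y‖ * ‖z‖)) (f : Lp E 1 μ) (g : Lp F 1 ν)
    (h : Lp F' 1 ρ) : ‖triT μ ν ρ T f g h‖ ≤ C * (‖f‖ * ‖g‖ * ‖h‖) := by
  have hf := L1.integrable_coeFn f
  have hg := L1.integrable_coeFn g
  have hh := L1.integrable_coeFn h
  rw [L1.norm_eq_integral_norm, integral_congr_ae ((coeFn_triT T f g h).mono
    fun z hz => congrArg norm hz)]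
  calc _ ≤ ∫ z, C * (‖f z.1‖ * (‖g z.2.1‖ * ‖h z.2.2‖)) ∂μ.prod (ν.prod ρ) := by
        refine integral_mono_of_nonneg (ae_of_all _ fun z => norm_nonneg _)
          ((hf.norm.mul_prod (hg.norm.mul_prod hh.norm)).const_mul C) (ae_of_all _ fun z => ?_)
        exact (hC _ _ _).trans_eq (by rw [mul_assoc ‖f z.1‖])
    _ = _ := by
        rw [integral_const_mul,
          integral_prod_mul (fun x => ‖f x‖) (fun z : Y × Z => ‖g z.1‖ * ‖h z.2‖),
          integral_prod_mul (fun x => ‖g x‖) (fun x => ‖h x‖), L1.norm_eq_integral_norm,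
          L1.norm_eq_integral_norm, L1.norm_eq_integral_norm, mul_assoc]

/-- Integration over the second variable. -/
def intOut (μ : Measure X) (ν : Measure Y) [SFinite μ] [SFinite ν] :
    Lp E 1 (μ.prod ν) →L[ℝ] Lp E 1 μ :=
  LinearMap.mkContinuous
    { toFun := fun f => (L1.integrable_coeFn f).integral_prod_left.toL1
      map_add' := fun f g => by
        rw [← Integrable.toL1_add, Integrable.toL1_eq_toL1_iff]
        filter_upwards [Measure.ae_ae_of_ae_prod (Lp.coeFn_add f g),
          (L1.integrable_coeFn f).prod_right_ae, (L1.integrable_coeFn g).prod_right_ae]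
          with x h1 h2 h3
        rw [integral_congr_ae h1]
        exact integral_add h2 h3
      map_smul' := fun c f => by
        rw [RingHom.id_apply, ← Integrable.toL1_smul, Integrable.toL1_eq_toL1_iff]
        filter_upwards [Measure.ae_ae_of_ae_prod (Lp.coeFn_smul c f)] with x h1
        rw [integral_congr_ae h1]
        exact integral_smul c _ } 1
    (fun f => by
      have hf := L1.integrable_coeFn f
      simp only [LinearMap.coe_mk, AddHom.coe_mk]
      rw [L1.norm_of_fun_eq_integral_norm, L1.norm_eq_integral_norm, one_mul,
        integral_prod _ hf.norm]
      exact integral_mono hf.integral_prod_left.norm hf.norm.integral_prod_left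
        fun x => norm_integral_le_integral_norm _)

theorem coeFn_intOut (f : Lp E 1 (μ.prod ν)) :
    intOut μ ν f =ᵐ[μ] fun x => ∫ y, f (x, y) ∂ν :=
  (L1.integrable_coeFn f).integral_prod_left.coeFn_toL1

theorem norm_intOut_le (f : Lp E 1 (μ.prod ν)) : ‖intOut μ ν f‖ ≤ ‖f‖ := by
  refine (ContinuousLinearMap.le_of_opNorm_le _
    (LinearMap.mkContinuous_norm_le _ zero_le_one _) f).trans_eq (one_mul _)

theorem integral_intOut (f : Lp E 1 (μ.prod ν)) :
    ∫ x, intOut μ ν f x ∂μ = ∫ z, f z ∂μ.prod ν := by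
  rw [integral_congr_ae (coeFn_intOut f), integral_prod _ (L1.integrable_coeFn f)]

end Tensor

/-! ### Summation of three frequencies -/

section Push

variable {d : ℕ} {E F G : Type*} [NormedAddCommGroup E] [NormedSpace ℝ E] [NormedAddCommGroup F]
  [NormedSpace ℝ F] [NormedAddCommGroup G] [NormedSpace ℝ G]

/-- Triples of frequencies. -/
abbrev Pos3 (d : ℕ) : Type := Pos d × (Pos d × Pos d)

/-- The sum of three frequencies. -/
def sum3 (z : Pos3 d) : Pos d := z.1 + (z.2.1 + z.2.2)

/-- For fixed second and third frequency this is a translation of the first one. The swaps bring the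
pair to the front, as `skew_product` requires. -/
theorem measurePreserving_shear :
    MeasurePreserving fun z : Pos3 d => (z.1 - (z.2.1 + z.2.2), z.2) := by
  have h1 : MeasurePreserving (fun z : (Pos d × Pos d) × Pos d => (z.1, z.2 - (z.1.1 + z.1.2)))
      (volume.prod volume) (volume.prod volume) :=
    (MeasurePreserving.id (volume : Measure (Pos d × Pos d))).skew_product (by fun_prop)
      (ae_of_all _ fun y => (measurePreserving_sub_right volume (y.1 + y.2)).map_eq)
  exact (Measure.measurePreserving_swap.comp h1).comp Measure.measurePreserving_swap

theorem measurePreserving_shear_symm :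
    MeasurePreserving fun z : Pos3 d => (z.1 + (z.2.1 + z.2.2), z.2) := by
  have h1 : MeasurePreserving (fun z : (Pos d × Pos d) × Pos d => (z.1, z.2 + (z.1.1 + z.1.2)))
      (volume.prod volume) (volume.prod volume) :=
    (MeasurePreserving.id (volume : Measure (Pos d × Pos d))).skew_product (by fun_prop)
      (ae_of_all _ fun y => (measurePreserving_add_right volume (y.1 + y.2)).map_eq)
  exact (Measure.measurePreserving_swap.comp h1).comp Measure.measurePreserving_swap

/-- The sum of the frequencies is the first component of the inverse shear. -/
theorem quasiMeasurePreserving_sum3 :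
    Measure.QuasiMeasurePreserving (sum3 : Pos3 d → Pos d) :=
  Measure.quasiMeasurePreserving_fst.comp measurePreserving_shear_symm.quasiMeasurePreserving

/-- The map `(push F)(k) = ∫∫ F(k - k₂ - k₃, k₂, k₃) dk₂ dk₃` on `L¹`. -/
def push (E : Type*) [NormedAddCommGroup E] [NormedSpace ℝ E] (d : ℕ) :
    Lp E 1 (volume : Measure (Pos3 d)) →L[ℝ] Lp E 1 (volume : Measure (Pos d)) :=
  (intOut volume (volume : Measure (Pos d × Pos d))).comp
    (Lp.compMeasurePreservingₗᵢ ℝ _ measurePreserving_shear).toContinuousLinearMap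

theorem norm_push_le (f : Lp E 1 (volume : Measure (Pos3 d))) : ‖push E d f‖ ≤ ‖f‖ :=
  (norm_intOut_le _).trans_eq (LinearIsometry.norm_map _ f)

theorem IsSymbol.comp_sum3 {φ : Pos d → E →L[ℝ] F} (hφ : IsSymbol volume φ) :
    IsSymbol volume fun z : Pos3 d => φ (sum3 z) := by
  obtain ⟨C, hC⟩ := hφ.bdd
  exact ⟨hφ.meas.comp_quasiMeasurePreserving quasiMeasurePreserving_sum3, C, fun z => hC _⟩

/-- After the shear the sum of the frequencies is the first coordinate, constant in the integration
variables, so `φ k` passes through the integral. Multipliers acting on a cubic term can thereby be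
moved to the space of frequency triples. -/
theorem mulOp_push [CompleteSpace E] [CompleteSpace F] {φ : Pos d → E →L[ℝ] F} (hφ : IsSymbol volume φ)
    (f : Lp E 1 (volume : Measure (Pos3 d))) :
    mulOp volume φ (push E d f) = push F d (mulOp volume (fun z => φ (sum3 z)) f) := by
  refine mulOp_eq_of_ae hφ ?_
  set g := Lp.compMeasurePreservingₗᵢ ℝ _ (measurePreserving_shear (d := d)) f with hg
  have e1 := Lp.coeFn_compMeasurePreserving f (measurePreserving_shear (d := d))
  have e2 := Lp.coeFn_compMeasurePreserving (mulOp volume (fun z => φ (sum3 z)) f)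
    (measurePreserving_shear (d := d))
  have e3 := (measurePreserving_shear (d := d)).quasiMeasurePreserving.ae
    (coeFn_mulOp hφ.comp_sum3 f)
  have e4 : ∀ᵐ z : Pos3 d, (Lp.compMeasurePreservingₗᵢ ℝ _ (measurePreserving_shear (d := d))
      (mulOp volume (fun z => φ (sum3 z)) f)) z = φ z.1 (g z) := by
    filter_upwards [e1, e2, e3] with z h1 h2 h3
    refine h2.trans (h3.trans ?_)
    have : sum3 (z.1 - (z.2.1 + z.2.2), z.2) = z.1 := by simp [sum3]
    rw [this]
    exact congrArg _ h1.symm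
  filter_upwards [coeFn_intOut g, coeFn_intOut (Lp.compMeasurePreservingₗᵢ ℝ _
    (measurePreserving_shear (d := d)) (mulOp volume (fun z => φ (sum3 z)) f)),
    Measure.ae_ae_of_ae_prod e4, (L1.integrable_coeFn g).prod_right_ae] with k h1 h2 h3 h4
  refine h2.trans ?_
  rw [integral_congr_ae h3]
  refine ((φ k).integral_comp_comm h4).trans ?_
  exact congrArg _ h1.symm

theorem integral_push (f : Lp E 1 (volume : Measure (Pos3 d))) :
    ∫ k, push E d f k = ∫ z, f z := by
  refine (integral_intOut _).trans ?_
  refine (integral_congr_ae (Lp.coeFn_compMeasurePreserving f measurePreserving_shear)).trans ?_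
  have h := measurePreserving_shear (d := d)
  have := integral_map h.aemeasurable (f := (f : Pos3 d → E)) (by
    rw [h.map_eq]; exact (L1.integrable_coeFn f).1)
  rw [h.map_eq] at this
  exact this.symm

variable {F' : Type*} [NormedAddCommGroup F'] [NormedSpace ℝ F']

/-- The function `(k₁, k₂, k₃) ↦ T (f k₁) (g k₂) (h k₃)` in `L¹`. -/
def tri3 (T : E →L[ℝ] F →L[ℝ] F' →L[ℝ] G) (f : Lp E 1 (volume : Measure (Pos d)))
    (g : Lp F 1 (volume : Measure (Pos d))) (h : Lp F' 1 (volume : Measure (Pos d))) :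
    Lp G 1 (volume : Measure (Pos3 d)) :=
  triT volume volume volume T f g h

theorem isTri_tri3 (T : E →L[ℝ] F →L[ℝ] F' →L[ℝ] G) : IsTri (tri3 (d := d) T) :=
  ⟨triT volume volume volume T, fun _ _ _ => rfl⟩

theorem coeFn_tri3 (T : E →L[ℝ] F →L[ℝ] F' →L[ℝ] G) (f : Lp E 1 (volume : Measure (Pos d)))
    (g : Lp F 1 (volume : Measure (Pos d))) (h : Lp F' 1 (volume : Measure (Pos d))) :
    ∀ᵐ z : Pos3 d, tri3 T f g h z = T (f z.1) (g z.2.1) (h z.2.2) :=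
  coeFn_triT T f g h

theorem integral_tri3 [CompleteSpace E] [CompleteSpace F] [CompleteSpace F'] [CompleteSpace G]
    (T : E →L[ℝ] F →L[ℝ] F' →L[ℝ] G) (f : Lp E 1 (volume : Measure (Pos d)))
    (g : Lp F 1 (volume : Measure (Pos d))) (h : Lp F' 1 (volume : Measure (Pos d))) :
    ∫ z : Pos3 d, tri3 T f g h z = T (∫ x, f x) (∫ y, g y) (∫ z, h z) :=
  integral_triT T f g h

theorem norm_tri3_le {T : E →L[ℝ] F →L[ℝ] F' →L[ℝ] G} {C : ℝ}
    (hC : ∀ x y z, ‖T x y z‖ ≤ C * (‖x‖ * ‖y‖ * ‖z‖)) (f : Lp E 1 (volume : Measure (Pos d)))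
    (g : Lp F 1 (volume : Measure (Pos d))) (h : Lp F' 1 (volume : Measure (Pos d))) :
    ‖tri3 T f g h‖ ≤ C * (‖f‖ * ‖g‖ * ‖h‖) :=
  norm_triT_le hC f g h

theorem ae_fst3 {p : Pos d → Prop} (h : ∀ᵐ k, p k) : ∀ᵐ z : Pos3 d, p z.1 :=
  ae_prod_fst h

theorem ae_snd3 {p : Pos d → Prop} (h : ∀ᵐ k, p k) : ∀ᵐ z : Pos3 d, p z.2.1 :=
  ae_prod_snd (ae_prod_fst h)

theorem ae_trd3 {p : Pos d → Prop} (h : ∀ᵐ k, p k) : ∀ᵐ z : Pos3 d, p z.2.2 :=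
  ae_prod_snd (ae_prod_snd h)

end Push


/-! ### The cubic nonlinearity on the Fourier side -/

/-- A trilinear map on a finite-dimensional space as a continuous trilinear map. -/
def mkTri {E F : Type*} [NormedAddCommGroup E] [NormedSpace ℝ E] [FiniteDimensional ℝ E]
    [NormedAddCommGroup F] [NormedSpace ℝ F] (t : E → E → E → F)
    (h1 : ∀ a a' b c, t (a + a') b c = t a b c + t a' b c)
    (h2 : ∀ a b b' c, t a (b + b') c = t a b c + t a b' c)
    (h3 : ∀ a b c c', t a b (c + c') = t a b c + t a b c')
    (s1 : ∀ (r : ℝ) a b c, t (r • a) b c = r • t a b c)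
    (s2 : ∀ (r : ℝ) a b c, t a (r • b) c = r • t a b c)
    (s3 : ∀ (r : ℝ) a b c, t a b (r • c) = r • t a b c) : E →L[ℝ] E →L[ℝ] E →L[ℝ] F :=
  LinearMap.toContinuousLinearMap
    { toFun := fun a => LinearMap.toContinuousLinearMap
        { toFun := fun b => LinearMap.toContinuousLinearMap
            { toFun := fun c => t a b c
              map_add' := h3 a b
              map_smul' := fun r => s3 r a b }
          map_add' := fun b b' => by ext c; exact h2 a b b' c
          map_smul' := fun r b => by ext c; exact s2 r a b c }
      map_add' := fun a a' => by ext b c; exact h1 a a' b c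
      map_smul' := fun r a => by ext b c; exact s1 r a b c }

variable {d n : ℕ}

theorem norm_conjVec (v : CVec n) : ‖conjVec v‖ = ‖v‖ := by
  simp [EuclideanSpace.norm_eq, conjVec]

theorem conjVec_conjVec (v : CVec n) : conjVec (conjVec v) = v := by
  ext i; simp [conjVec]

theorem conjVec_smul (c : ℂ) (v : CVec n) : conjVec (c • v) = starRingEnd ℂ c • conjVec v := by
  ext i; simp [conjVec]

/-- Complex conjugation of vectors as a real-linear map. -/
def conjL (n : ℕ) : CVec n →L[ℝ] CVec n :=
  LinearMap.mkContinuous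
    { toFun := conjVec
      map_add' := fun v w => by ext i; simp [conjVec]
      map_smul' := fun c v => by ext i; simp [conjVec] } 1
    fun v => by rw [one_mul]; exact (norm_conjVec v).le

@[simp] theorem conjL_apply (v : CVec n) : conjL n v = conjVec v := rfl

namespace FriedrichsSystem

variable (S : FriedrichsSystem d n)

theorem conjVec_TC (a b c : CVec n) :
    conjVec (S.TC a b c) = S.TC (conjVec a) (conjVec b) (conjVec c) := by
  ext i; simp [conjVec, TC]

theorem TC_add_left (a a' b c : CVec n) : S.TC (a + a') b c = S.TC a b c + S.TC a' b c := by
  ext i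
  simp only [TC, PiLp.add_apply, ← Finset.sum_add_distrib]
  refine Finset.sum_congr rfl fun p _ => Finset.sum_congr rfl fun q _ =>
    Finset.sum_congr rfl fun r _ => ?_
  ring

theorem TC_add_middle (a b b' c : CVec n) : S.TC a (b + b') c = S.TC a b c + S.TC a b' c := by
  ext i
  simp only [TC, PiLp.add_apply, ← Finset.sum_add_distrib]
  refine Finset.sum_congr rfl fun p _ => Finset.sum_congr rfl fun q _ =>
    Finset.sum_congr rfl fun r _ => ?_
  ring

theorem TC_add_right (a b c c' : CVec n) : S.TC a b (c + c') = S.TC a b c + S.TC a b c' := by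
  ext i
  simp only [TC, PiLp.add_apply, ← Finset.sum_add_distrib]
  refine Finset.sum_congr rfl fun p _ => Finset.sum_congr rfl fun q _ =>
    Finset.sum_congr rfl fun r _ => ?_
  ring

theorem TC_smul (x y z : ℂ) (a b c : CVec n) :
    S.TC (x • a) (y • b) (z • c) = (x * y * z) • S.TC a b c := by
  ext i
  simp only [TC, PiLp.smul_apply, smul_eq_mul, Finset.mul_sum]
  refine Finset.sum_congr rfl fun p _ => Finset.sum_congr rfl fun q _ =>
    Finset.sum_congr rfl fun r _ => ?_
  ring

theorem coe_smul_vec (r : ℝ) (a : CVec n) : r • a = (r : ℂ) • a := by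
  ext i
  simp

theorem TC_real_smul (x y z : ℝ) (a b c : CVec n) :
    S.TC (x • a) (y • b) (z • c) = (x * y * z) • S.TC a b c := by
  simp only [coe_smul_vec, TC_smul]
  push_cast
  rfl

/-- `TC` as a continuous real-trilinear map. -/
def TL : CVec n →L[ℝ] CVec n →L[ℝ] CVec n →L[ℝ] CVec n :=
  mkTri S.TC S.TC_add_left S.TC_add_middle S.TC_add_right
    (fun r a b c => by simpa using S.TC_real_smul r 1 1 a b c)
    (fun r a b c => by simpa using S.TC_real_smul 1 r 1 a b c)
    (fun r a b c => by simpa using S.TC_real_smul 1 1 r a b c)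

@[simp] theorem TL_apply (a b c : CVec n) : S.TL a b c = S.TC a b c := rfl

end FriedrichsSystem

/-- `L¹` functions on frequency space. -/
abbrev FL (d : ℕ) (E : Type*) [NormedAddCommGroup E] : Type _ :=
  Lp E 1 (volume : Measure (Pos d))

section Shift

variable {E F : Type*} [NormedAddCommGroup E] [NormedSpace ℝ E] [NormedAddCommGroup F]
  [NormedSpace ℝ F]

/-- Translation of `L¹` functions: `(shift a f)(k) = f(k - a)`. -/
def shift (E : Type*) [NormedAddCommGroup E] [NormedSpace ℝ E] (a : Pos d) : FL d E →L[ℝ] FL d E :=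
  (Lp.compMeasurePreservingₗᵢ ℝ _ (measurePreserving_sub_right volume a)).toContinuousLinearMap

theorem coeFn_shift (a : Pos d) (f : FL d E) : shift E a f =ᵐ[volume] fun k => f (k - a) :=
  Lp.coeFn_compMeasurePreserving f (measurePreserving_sub_right volume a)

@[simp] theorem norm_shift (a : Pos d) (f : FL d E) : ‖shift E a f‖ = ‖f‖ :=
  LinearIsometry.norm_map _ f

/-- Reflection of `L¹` functions: `f ↦ f(-·)`. -/
def reflect (E : Type*) [NormedAddCommGroup E] [NormedSpace ℝ E] (d : ℕ) : FL d E →L[ℝ] FL d E :=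
  (Lp.compMeasurePreservingₗᵢ ℝ _
    (Measure.measurePreserving_neg (volume : Measure (Pos d)))).toContinuousLinearMap

theorem coeFn_reflect (f : FL d E) : reflect E d f =ᵐ[volume] fun k => f (-k) :=
  Lp.coeFn_compMeasurePreserving f (Measure.measurePreserving_neg (volume : Measure (Pos d)))

@[simp] theorem norm_reflect (f : FL d E) : ‖reflect E d f‖ = ‖f‖ :=
  LinearIsometry.norm_map _ f

theorem ae_neg {p : Pos d → Prop} (h : ∀ᵐ k, p k) : ∀ᵐ k : Pos d, p (-k) :=
  (Measure.measurePreserving_neg (volume : Measure (Pos d))).quasiMeasurePreserving.ae h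

theorem ae_sub {p : Pos d → Prop} (a : Pos d) (h : ∀ᵐ k, p k) : ∀ᵐ k : Pos d, p (k - a) :=
  (measurePreserving_sub_right volume a).quasiMeasurePreserving.ae h

end Shift

/-- `f ↦ conj f(-·)`, the Fourier side of complex conjugation. -/
def bar (d n : ℕ) : FreqL1 d n →L[ℝ] FreqL1 d n :=
  (mulOp volume fun _ => conjL n).comp (reflect (CVec n) d)

theorem coeFn_bar (f : FreqL1 d n) : bar d n f =ᵐ[volume] fun k => conjVec (f (-k)) := by
  filter_upwards [coeFn_mulOp (isSymbol_const (conjL n)) (reflect (CVec n) d f), coeFn_reflect f]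
    with k h1 h2
  refine h1.trans ?_
  rw [h2]; rfl

@[simp] theorem norm_bar (f : FreqL1 d n) : ‖bar d n f‖ = ‖f‖ := by
  refine (norm_mulOp_of_isometry (isSymbol_const _) (fun _ v => ?_) _).trans (norm_reflect f)
  exact norm_conjVec v

theorem bar_bar (f : FreqL1 d n) : bar d n (bar d n f) = f := by
  refine Lp.ext ?_
  filter_upwards [coeFn_bar (bar d n f), ae_neg (coeFn_bar f)] with k h1 h2
  rw [h1, h2, conjVec_conjVec, neg_neg]

/-! ### Inverse Fourier transforms -/

/-- The constant `(2π)^{-d/2}`. -/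
def fourierConst (d : ℕ) : ℝ := (2 * Real.pi) ^ (-(d : ℝ) / 2)

theorem fourierConst_pos (d : ℕ) : 0 < fourierConst d := Real.rpow_pos_of_pos (by positivity) _

theorem fourierConst_le_one (d : ℕ) : fourierConst d ≤ 1 := by
  refine Real.rpow_le_one_of_one_le_of_nonpos ?_ ?_
  · linarith [Real.pi_gt_three]
  · have : (0 : ℝ) ≤ d := Nat.cast_nonneg d
    linarith

/-- The character `e^{i k·x}`. -/
def chr (x k : Pos d) : ℂ := Complex.exp (Complex.I * (inner ℝ k x : ℝ))

theorem norm_chr (x k : Pos d) : ‖chr x k‖ = 1 := by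
  rw [chr, mul_comm, Complex.norm_exp_ofReal_mul_I]

theorem chr_add (x k l : Pos d) : chr x (k + l) = chr x k * chr x l := by
  rw [chr, chr, chr, ← Complex.exp_add, inner_add_left]
  push_cast
  ring_nf

theorem conj_chr (x k : Pos d) : starRingEnd ℂ (chr x k) = chr x (-k) := by
  rw [chr, chr, ← Complex.exp_conj, inner_neg_left]
  simp

/-- Multiplication by a complex number as a real-linear map. -/
def scal (n : ℕ) (c : ℂ) : CVec n →L[ℝ] CVec n := c • ContinuousLinearMap.id ℝ (CVec n)

@[simp] theorem scal_apply (c : ℂ) (v : CVec n) : scal n c v = c • v := rfl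

theorem norm_scal_le (c : ℂ) : ‖scal n c‖ ≤ ‖c‖ :=
  ContinuousLinearMap.opNorm_le_bound _ (norm_nonneg _) fun v => (norm_smul c v).le

theorem continuous_scal : Continuous (scal n) := by
  unfold scal; fun_prop

theorem isSymbol_scal {X : Type*} [MeasurableSpace X] {μ : Measure X} {m : X → ℂ}
    (hm : AEStronglyMeasurable m μ) {C : ℝ} (hC : ∀ x, ‖m x‖ ≤ C) :
    IsSymbol μ fun x => scal n (m x) :=
  ⟨continuous_scal.comp_aestronglyMeasurable hm, C, fun x => (norm_scal_le _).trans (hC x)⟩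

theorem continuous_chr (x : Pos d) : Continuous (chr x) := by unfold chr; fun_prop

theorem isSymbol_chr (x : Pos d) : IsSymbol (volume : Measure (Pos d)) fun k => scal n (chr x k) :=
  isSymbol_scal (continuous_chr x).aestronglyMeasurable fun k => (norm_chr x k).le

theorem invFourier_eq (f : FreqL1 d n) (x : Pos d) :
    invFourier d n f x = fourierConst d • ∫ k, mulOp volume (fun k => scal n (chr x k)) f k := by
  rw [integral_congr_ae (coeFn_mulOp (isSymbol_chr x) f)]
  rfl

theorem invFourier_eq' (f : FreqL1 d n) (x : Pos d) :
    invFourier d n f x = fourierConst d • ∫ k, chr x k • f k := rfl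

theorem norm_invFourier_le (f : FreqL1 d n) (x : Pos d) : ‖invFourier d n f x‖ ≤ ‖f‖ := by
  rw [invFourier_eq', norm_smul, Real.norm_of_nonneg (fourierConst_pos d).le]
  refine (mul_le_of_le_one_left (norm_nonneg _) (fourierConst_le_one d)).trans ?_
  refine (norm_integral_le_integral_norm _).trans_eq ?_
  rw [L1.norm_eq_integral_norm]
  simp [norm_smul, norm_chr]

theorem invFourier_shift (a : Pos d) (f : FreqL1 d n) (x : Pos d) :
    invFourier d n (shift _ a f) x = chr x a • invFourier d n f x := by
  rw [invFourier_eq', invFourier_eq', smul_comm]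
  congr 1
  rw [← integral_smul, ← integral_sub_right_eq_self (fun k => chr x a • chr x k • f k) a]
  refine integral_congr_ae ?_
  filter_upwards [coeFn_shift a f] with k hk
  rw [hk, smul_smul, ← chr_add, add_sub_cancel]

theorem invFourier_bar (f : FreqL1 d n) (x : Pos d) :
    invFourier d n (bar d n f) x = conjVec (invFourier d n f x) := by
  rw [invFourier_eq', invFourier_eq', ← conjL_apply, map_smul]
  congr 1
  have hi : Integrable (fun k => chr x k • f k) :=
    ((isSymbol_chr (n := n) x).integrable f)
  rw [← ContinuousLinearMap.integral_comp_comm _ hi, ← integral_neg_eq_self]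
  refine integral_congr_ae ?_
  filter_upwards [ae_neg (coeFn_bar f)] with k hk
  rw [hk, neg_neg, conjL_apply, conjVec_smul, conj_chr]

theorem invFourier_ext {f g : FreqL1 d n} (h : ∀ x, invFourier d n f x = invFourier d n g x) :
    f = g := invFourier_injective d n (funext h)

theorem invFourier_real_smul (c : ℝ) (f : FreqL1 d n) (x : Pos d) :
    invFourier d n (c • f) x = c • invFourier d n f x := by
  have h : c • f = (c : ℂ) • f := by
    refine Lp.ext ?_
    filter_upwards [Lp.coeFn_smul c f, Lp.coeFn_smul (c : ℂ) f] with k h1 h2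
    rw [h1, h2]
    simp only [Pi.smul_apply]
    ext i
    simp
  rw [h, map_smul]
  ext i
  simp

namespace FriedrichsSystem

variable (S : FriedrichsSystem d n)

/-- The Fourier transform of `T(u, v, w)`. -/
def That (f g h : FreqL1 d n) : FreqL1 d n :=
  fourierConst d ^ 2 • push (CVec n) d (tri3 S.TL f g h)

theorem That_apply (f g h : FreqL1 d n) : S.That f g h =
    fourierConst d ^ 2 • push (CVec n) d (tri3 S.TL f g h) := rfl

theorem isTri_That : IsTri S.That :=
  (isTri_tri3 S.TL).post (fourierConst d ^ 2 • push (CVec n) d)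

theorem mulOp_chr_tri3 (f g h : FreqL1 d n) (x : Pos d) :
    mulOp volume (fun z : Pos3 d => scal n (chr x (sum3 z))) (tri3 S.TL f g h) = tri3 S.TL
        (mulOp volume (fun k => scal n (chr x k)) f) (mulOp volume (fun k => scal n (chr x k)) g)
        (mulOp volume (fun k => scal n (chr x k)) h) := by
  refine mulOp_eq_of_ae (isSymbol_chr x).comp_sum3 ?_
  filter_upwards [coeFn_tri3 S.TL f g h, coeFn_tri3 S.TL
      (mulOp volume (fun k => scal n (chr x k)) f) (mulOp volume (fun k => scal n (chr x k)) g)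
      (mulOp volume (fun k => scal n (chr x k)) h), ae_fst3 (coeFn_mulOp (isSymbol_chr x) f),
      ae_snd3 (coeFn_mulOp (isSymbol_chr x) g), ae_trd3 (coeFn_mulOp (isSymbol_chr x) h)]
    with z h1 h2 h3 h4 h5
  rw [h1, h2, h3, h4, h5]
  simp only [scal_apply, TL_apply, TC_smul, sum3, chr_add, mul_assoc]

/-- The character of a sum of frequencies is a product of characters, so the triple integral
factors. One constant $(2\pi)^{-d/2}$ of the inverse transform and two from `That` give the three on
the right. -/
theorem invFourier_That (f g h : FreqL1 d n) (x : Pos d) :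
    invFourier d n (S.That f g h) x =
      S.TC (invFourier d n f x) (invFourier d n g x) (invFourier d n h x) := by
  rw [That_apply, invFourier_real_smul, invFourier_eq, mulOp_push (isSymbol_chr x), integral_push,
    mulOp_chr_tri3, integral_tri3, invFourier_eq, invFourier_eq, invFourier_eq, TL_apply,
    TC_real_smul, smul_smul]
  congr 1
  ring

theorem bar_That (f g h : FreqL1 d n) :
    bar d n (S.That f g h) = S.That (bar d n f) (bar d n g) (bar d n h) := by
  refine invFourier_ext fun x => ?_
  simp only [invFourier_bar, invFourier_That, conjVec_TC]

/-- In physical space translations of the transform are multiplications by characters, and the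
characters multiply. -/
theorem shift_That (a b c : Pos d) (f g h : FreqL1 d n) :
    S.That (shift _ a f) (shift _ b g) (shift _ c h) = shift _ (a + b + c) (S.That f g h) := by
  refine invFourier_ext fun x => ?_
  simp only [invFourier_shift, invFourier_That, TC_smul, chr_add]

end FriedrichsSystem

/-! ### The Wiener algebra as a copy of `L¹` -/

namespace Wiener

/-- The Fourier transform as a real-linear isometry. -/
def hatₗᵢ (d n : ℕ) : Wiener d n ≃ₗᵢ[ℝ] FreqL1 d n where
  toLinearEquiv := (hat (d := d) (n := n)).toAddEquiv.toLinearEquiv fun c f => by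
    have h1 : c • f = (c : ℂ) • f := rfl
    refine invFourier_ext fun x => ?_
    rw [invFourier_real_smul, h1]
    have : hat ((c : ℂ) • f) = (c : ℂ) • hat f := map_smul _ _ _
    refine (congrArg (fun g => invFourier d n g x) this).trans ?_
    simp only [map_smul]
    ext i
    simp
  norm_map' f := rfl

@[simp] theorem norm_hat (f : Wiener d n) : ‖hat f‖ = ‖f‖ := rfl

theorem coe_eq (f : Wiener d n) (x : Pos d) : f x = invFourier d n (hat f) x :=
  congrFun (invFourier_hat f).symm x

theorem coe_hat_symm (f : FreqL1 d n) (x : Pos d) : (hat.symm f) x = invFourier d n f x := by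
  rw [coe_eq, LinearEquiv.apply_symm_apply]

theorem ext' {f g : Wiener d n} (h : ∀ x, f x = g x) : f = g := Subtype.ext (funext h)

end Wiener


/-! ### The linear evolution -/

namespace FriedrichsSystem

variable {d n : ℕ} (S : FriedrichsSystem d n)

theorem hasDerivAt_propagator (ε t : ℝ) (k : Pos d) :
    HasDerivAt (fun s => S.propagator ε s k)
      (-((S.generator ε k).comp (S.propagator ε t k))) t := by
  have h := hasDerivAt_exp_smul_const' (𝕂 := ℝ) (-S.generator ε k) t
  have e : ∀ s : ℝ, S.propagator ε s k = NormedSpace.exp (s • (-S.generator ε k)) := by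
    intro s
    rw [propagator]
    congr 1
    rw [smul_neg]
    rfl
  simp only [e]
  refine h.congr_deriv ?_
  rw [neg_mul]
  rfl

theorem hasDerivAt_propagator_apply (ε t : ℝ) (k : Pos d) (v : CVec n) :
    HasDerivAt (fun s => S.propagator ε s k v)
      (-(S.generator ε k (S.propagator ε t k v))) t := by
  have h := (((ContinuousLinearMap.apply ℂ (CVec n)) v).restrictScalars ℝ).hasFDerivAt.comp_hasDerivAt
    t (S.hasDerivAt_propagator ε t k)
  exact h

theorem propagator_zero (ε : ℝ) (k : Pos d) : S.propagator ε 0 k = 1 := by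
  simp [propagator]

/-- Uniqueness for the linear ordinary differential equation with generator `generator ε k`. -/
theorem eq_propagator {ε : ℝ} {k : Pos d} {w : ℝ → CVec n}
    (hw : ∀ t, HasDerivAt w (-(S.generator ε k (w t))) t) (t : ℝ) :
    w t = S.propagator ε t k (w 0) := by
  have hv : ∀ t : ℝ, LipschitzOnWith ‖S.generator ε k‖₊ (fun x => -(S.generator ε k x)) univ :=
    fun _ => ((S.generator ε k).lipschitz.neg).lipschitzOnWith
  have := ODE_solution_unique_univ (t₀ := 0) (fun t => hv t)
    (fun t => ⟨hw t, mem_univ _⟩)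
    (fun t => ⟨S.hasDerivAt_propagator_apply ε t k (w 0), mem_univ _⟩)
    (by rw [propagator_zero]; rfl)
  exact congrFun this t

theorem propagator_add_apply (ε s t : ℝ) (k : Pos d) (v : CVec n) :
    S.propagator ε (s + t) k v = S.propagator ε s k (S.propagator ε t k v) := by
  have h := S.eq_propagator (ε := ε) (k := k) (w := fun r => S.propagator ε (r + t) k v)
    (fun r => (S.hasDerivAt_propagator_apply ε (r + t) k v).comp_add_const r t) s
  simpa using h

theorem act_apply (M : Matrix (Fin n) (Fin n) ℂ) (v : CVec n) (i : Fin n) :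
    act M v i = ∑ j, M i j * v j := by
  rw [act, Matrix.ofLp_toEuclideanCLM]
  rfl

theorem act_add_left (M N : Matrix (Fin n) (Fin n) ℂ) (v : CVec n) :
    act (M + N) v = act M v + act N v := by
  simp only [act, map_add]; rfl

theorem act_smul_left (c : ℂ) (M : Matrix (Fin n) (Fin n) ℂ) (v : CVec n) :
    act (c • M) v = c • act M v := by
  simp only [act, map_smul]; rfl

theorem act_one (v : CVec n) : act 1 v = v := by
  simp only [act, map_one]; rfl

theorem conjVec_act_ofReal (M : Matrix (Fin n) (Fin n) ℝ) (v : CVec n) :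
    conjVec (act (M.map Complex.ofReal) v) = act (M.map Complex.ofReal) (conjVec v) := by
  ext i
  change starRingEnd ℂ (act _ v i) = _
  rw [act_apply, act_apply, map_sum]
  simp [conjVec]

theorem conjVec_AC (μ : Fin d) (v : CVec n) : conjVec (act (S.AC μ) v) = act (S.AC μ) (conjVec v) :=
  conjVec_act_ofReal _ _

theorem conjVec_EC (v : CVec n) : conjVec (act S.EC v) = act S.EC (conjVec v) :=
  conjVec_act_ofReal _ _

theorem act_symbol (β : Pos d) (v : CVec n) :
    act (S.symbol β) v = ∑ μ, (β μ : ℂ) • act (S.AC μ) v := by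
  simp only [← act_smul_left]
  simp only [act, symbol, map_sum, sum_apply]

theorem generator_apply (ε : ℝ) (k : Pos d) (v : CVec n) :
    S.generator ε k v = Complex.I • act (S.symbol k) v + ((1 / ε : ℝ) : ℂ) • act S.EC v := by
  rw [← act_smul_left, ← act_smul_left, ← act_add_left]; rfl

theorem act_L (α : ℝ) (β : Pos d) (v : CVec n) :
    act (S.L α β) v = -((α : ℂ) • v) + act (S.symbol β) v - Complex.I • act S.EC v := by
  have : S.L α β = (-(α : ℂ)) • (1 : Matrix (Fin n) (Fin n) ℂ) + S.symbol β
    + (-Complex.I) • S.EC := by rw [L, neg_smul, neg_smul, sub_eq_add_neg]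
  rw [this, act_add_left, act_add_left, act_smul_left, act_smul_left, act_one, neg_smul, neg_smul,
    sub_eq_add_neg]

theorem act_symbol_add (β γ : Pos d) (v : CVec n) :
    act (S.symbol (β + γ)) v = act (S.symbol β) v + act (S.symbol γ) v := by
  simp only [act_symbol, PiLp.add_apply, Complex.ofReal_add, add_smul, Finset.sum_add_distrib]

theorem act_symbol_smul (r : ℝ) (β : Pos d) (v : CVec n) :
    act (S.symbol (r • β)) v = (r : ℂ) • act (S.symbol β) v := by
  simp only [act_symbol, PiLp.smul_apply, Finset.smul_sum, smul_smul, smul_eq_mul,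
    Complex.ofReal_mul]

theorem conjVec_generator (ε : ℝ) (k : Pos d) (v : CVec n) :
    conjVec (S.generator ε k v) = S.generator ε (-k) (conjVec v) := by
  have h : -k = (-1 : ℝ) • k := by simp
  rw [generator_apply, generator_apply, h, act_symbol_smul, act_symbol, act_symbol, ← conjL_apply]
  simp only [map_add, conjL_apply, conjVec_smul, conjVec_EC]
  simp only [← conjL_apply, map_sum]
  simp only [conjL_apply, conjVec_smul, conjVec_AC]
  simp

theorem conjVec_propagator (ε t : ℝ) (k : Pos d) (v : CVec n) :
    conjVec (S.propagator ε t k v) = S.propagator ε t (-k) (conjVec v) := by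
  have h := S.eq_propagator (ε := ε) (k := -k) (w := fun r => conjVec (S.propagator ε r k v))
    (fun r => by
      have := (conjL n).hasFDerivAt.comp_hasDerivAt r (S.hasDerivAt_propagator_apply ε r k v)
      refine this.congr_deriv ?_
      rw [map_neg, conjL_apply, conjVec_generator]) t
  simpa [propagator_zero] using h

/-- Translating the frequency by $\beta/\varepsilon$ turns $\mathrm iA(k)$ into $(\mathrm
i/\varepsilon)A(\beta+\varepsilon k)$, and $E/\varepsilon=(\mathrm i/\varepsilon)(-\mathrm iE)$.
This identifies the generator seen in the frame of a carrier wave. -/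
theorem generator_eq_act_L {ε : ℝ} (hε : ε ≠ 0) (α : ℝ) (β k : Pos d) (v : CVec n) :
    S.generator ε (k + ε⁻¹ • β) v - (Complex.I * α / ε) • v =
      (Complex.I / ε) • act (S.L α (β + ε • k)) v := by
  have hε' : (ε : ℂ) ≠ 0 := by exact_mod_cast hε
  rw [generator_apply, act_L, act_symbol_add, act_symbol_smul, act_symbol_add, act_symbol_smul]
  ext i
  simp only [PiLp.add_apply, PiLp.sub_apply, PiLp.smul_apply, PiLp.neg_apply, smul_eq_mul]
  push_cast
  field_simp
  linear_combination (act S.EC v i) * Complex.I_sq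

/-- The Fourier symbol of the evolution in the frame of the carrier wave with frequency `α` and
wave vector `β`, i.e. `exp(-(i t / ε) L(α, β + ε k))`. -/
def prop (ε α : ℝ) (β : Pos d) (t : ℝ) (k : Pos d) : CVec n →L[ℝ] CVec n :=
  (scal n (Complex.exp (Complex.I * α / ε * t))).comp
    ((S.propagator ε t (k + ε⁻¹ • β)).restrictScalars ℝ)

/-- The generator `(i / ε) L(α, β + ε k)` of `prop`. -/
def propGen (ε α : ℝ) (β k : Pos d) : CVec n →L[ℝ] CVec n :=
  (S.generator ε (k + ε⁻¹ • β)).restrictScalars ℝ - scal n (Complex.I * α / ε)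

theorem propGen_apply {ε : ℝ} (hε : ε ≠ 0) (α : ℝ) (β k : Pos d) (v : CVec n) :
    S.propGen ε α β k v = (Complex.I / ε) • act (S.L α (β + ε • k)) v :=
  S.generator_eq_act_L hε α β k v

theorem prop_apply (ε α : ℝ) (β : Pos d) (t : ℝ) (k : Pos d) (v : CVec n) :
    S.prop ε α β t k v =
      Complex.exp (Complex.I * α / ε * t) • S.propagator ε t (k + ε⁻¹ • β) v := rfl

theorem norm_phase (α ε t : ℝ) : ‖Complex.exp (Complex.I * α / ε * t)‖ = 1 := by
  rw [show Complex.I * α / ε * t = ((α / ε * t : ℝ) : ℂ) * Complex.I by push_cast; ring,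
    Complex.norm_exp_ofReal_mul_I]

theorem norm_prop_apply (ε α : ℝ) (β : Pos d) (t : ℝ) (k : Pos d) (v : CVec n) :
    ‖S.prop ε α β t k v‖ = ‖v‖ := by
  rw [prop_apply, norm_smul, norm_phase, one_mul, norm_propagator_apply]

theorem norm_prop_le (ε α : ℝ) (β : Pos d) (t : ℝ) (k : Pos d) : ‖S.prop ε α β t k‖ ≤ 1 :=
  ContinuousLinearMap.opNorm_le_bound _ zero_le_one fun v => by
    rw [norm_prop_apply, one_mul]

theorem hasDerivAt_prop (ε α : ℝ) (β : Pos d) (t : ℝ) (k : Pos d) :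
    HasDerivAt (fun s => S.prop ε α β s k)
      (-((S.propGen ε α β k).comp (S.prop ε α β t k))) t := by
  have h1 : HasDerivAt (fun s : ℝ => Complex.exp (Complex.I * α / ε * s))
      (Complex.exp (Complex.I * α / ε * t) * (Complex.I * α / ε)) t := by
    have := ((hasDerivAt_id t).ofReal_comp.const_mul (Complex.I * α / ε)).cexp
    simpa using this
  have h2 := (ContinuousLinearMap.restrictScalarsL ℂ (CVec n) (CVec n) ℝ ℝ).hasFDerivAt.comp_hasDerivAt
    t (S.hasDerivAt_propagator ε t (k + ε⁻¹ • β))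
  have h3 := h1.smul h2
  refine h3.congr_deriv ?_
  ext1 v
  change Complex.exp (Complex.I * α / ε * t) • (-S.generator ε (k + ε⁻¹ • β)
      (S.propagator ε t (k + ε⁻¹ • β) v)) +
    (Complex.exp (Complex.I * α / ε * t) * (Complex.I * α / ε)) • S.propagator ε t (k + ε⁻¹ • β) v =
    -(S.generator ε (k + ε⁻¹ • β) (Complex.exp (Complex.I * α / ε * t) •
      S.propagator ε t (k + ε⁻¹ • β) v) - (Complex.I * α / ε) •
      (Complex.exp (Complex.I * α / ε * t) • S.propagator ε t (k + ε⁻¹ • β) v))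
  rw [map_smul, smul_neg, smul_smul, neg_sub, mul_comm (Complex.exp _)]
  abel

theorem continuous_prop (ε α : ℝ) (β : Pos d) (t : ℝ) : Continuous (S.prop ε α β t) := by
  have h1 : Continuous fun k : Pos d => S.propagator ε t (k + ε⁻¹ • β) :=
    (S.continuous_propagator ε t).comp (by fun_prop)
  have h2 := (ContinuousLinearMap.restrictScalarsL ℂ (CVec n) (CVec n) ℝ ℝ).continuous.comp h1
  exact continuous_const.clm_comp h2

theorem isSymbol_prop (ε α : ℝ) (β : Pos d) (t : ℝ) : IsSymbol volume (S.prop ε α β t) :=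
  ⟨(S.continuous_prop ε α β t).aestronglyMeasurable, 1, S.norm_prop_le ε α β t⟩

theorem prop_zero (ε α : ℝ) (β k : Pos d) : S.prop ε α β 0 k = ContinuousLinearMap.id ℝ _ := by
  ext1 v
  rw [prop_apply, propagator_zero]
  simp

theorem prop_add (ε α : ℝ) (β : Pos d) (s t : ℝ) (k : Pos d) :
    S.prop ε α β (s + t) k = (S.prop ε α β s k).comp (S.prop ε α β t k) := by
  ext1 v
  rw [ContinuousLinearMap.comp_apply, prop_apply, prop_apply, prop_apply, map_smul, smul_smul,
    ← Complex.exp_add, propagator_add_apply]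
  congr 2
  push_cast
  ring

/-- The evolution in the frame of the carrier wave with frequency `α` and wave vector `β`. -/
def evol (ε α : ℝ) (β : Pos d) (t : ℝ) : FreqL1 d n →L[ℝ] FreqL1 d n :=
  mulOp volume (S.prop ε α β t)

theorem norm_evol_apply (ε α : ℝ) (β : Pos d) (t : ℝ) (f : FreqL1 d n) :
    ‖S.evol ε α β t f‖ = ‖f‖ :=
  norm_mulOp_of_isometry (S.isSymbol_prop ε α β t) (S.norm_prop_apply ε α β t) f

theorem norm_evol_le (ε α : ℝ) (β : Pos d) (t : ℝ) : ‖S.evol ε α β t‖ ≤ 1 :=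
  opNorm_mulOp_le zero_le_one (S.norm_prop_le ε α β t)

theorem evol_zero (ε α : ℝ) (β : Pos d) (f : FreqL1 d n) : S.evol ε α β 0 f = f := by
  have : S.prop ε α β 0 = fun _ => ContinuousLinearMap.id ℝ _ := funext (S.prop_zero ε α β)
  rw [evol, this, mulOp_id]; rfl

theorem evol_evol (ε α : ℝ) (β : Pos d) (s t : ℝ) (f : FreqL1 d n) :
    S.evol ε α β s (S.evol ε α β t f) = S.evol ε α β (s + t) f := by
  rw [evol, evol, evol, mulOp_comp (S.isSymbol_prop ε α β s) (S.isSymbol_prop ε α β t)]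
  simp only [← prop_add]

theorem evol_neg_evol (ε α : ℝ) (β : Pos d) (t : ℝ) (f : FreqL1 d n) :
    S.evol ε α β (-t) (S.evol ε α β t f) = f := by
  rw [evol_evol, neg_add_cancel, evol_zero]

theorem evol_evol_neg (ε α : ℝ) (β : Pos d) (t : ℝ) (f : FreqL1 d n) :
    S.evol ε α β t (S.evol ε α β (-t) f) = f := by
  rw [evol_evol, add_neg_cancel, evol_zero]

theorem continuous_prop_time (ε α : ℝ) (β k : Pos d) : Continuous fun t => S.prop ε α β t k :=
  continuous_iff_continuousAt.2 fun t => (S.hasDerivAt_prop ε α β t k).continuousAt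

theorem continuous_evol (ε α : ℝ) (β : Pos d) (f : FreqL1 d n) :
    Continuous fun t => S.evol ε α β t f :=
  continuous_mulOp_apply (S.isSymbol_prop ε α β) (S.norm_prop_le ε α β)
    (S.continuous_prop_time ε α β) f

theorem continuous_evol_apply (ε α : ℝ) (β : Pos d) {f : ℝ → FreqL1 d n} (hf : Continuous f) :
    Continuous fun t => S.evol ε α β t (f t) :=
  continuous_clm_apply_of_strong (S.norm_evol_le ε α β) (S.continuous_evol ε α β) hf

theorem continuous_evol_neg_apply (ε α : ℝ) (β : Pos d) {f : ℝ → FreqL1 d n}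
    (hf : Continuous f) : Continuous fun t => S.evol ε α β (-t) (f t) :=
  continuous_clm_apply_of_strong (fun t => S.norm_evol_le ε α β (-t))
    (fun f => (S.continuous_evol ε α β f).comp continuous_neg) hf

theorem flow_eq_evol (ε t : ℝ) (f : FreqL1 d n) : S.flow ε t f = S.evol ε 0 0 t f := by
  refine (mulOp_eq_of_ae (S.isSymbol_prop ε 0 0 t) ?_).symm
  filter_upwards [(S.integrable_propagator ε t f).coeFn_toL1] with k hk
  refine hk.trans ?_
  rw [prop_apply]
  simp

theorem bar_evol (ε t : ℝ) (f : FreqL1 d n) :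
    bar d n (S.evol ε 0 0 t f) = S.evol ε 0 0 t (bar d n f) := by
  refine (mulOp_eq_of_ae (S.isSymbol_prop ε 0 0 t) ?_).symm
  filter_upwards [coeFn_bar (S.evol ε 0 0 t f), coeFn_bar f,
    ae_neg (coeFn_mulOp (S.isSymbol_prop ε 0 0 t) f)] with k h1 h2 h3
  rw [h1, h2, evol, h3, prop_apply, prop_apply]
  simp [conjVec_propagator]

/-- Passing to the frame of the carrier wave. -/
theorem evol_shift (ε α : ℝ) (β : Pos d) (t : ℝ) (f : FreqL1 d n) :
    S.evol ε 0 0 t (shift _ (ε⁻¹ • β) f) =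
      Complex.exp (-(Complex.I * α / ε * t)) • shift _ (ε⁻¹ • β) (S.evol ε α β t f) := by
  refine mulOp_eq_of_ae (S.isSymbol_prop ε 0 0 t) ?_
  filter_upwards [coeFn_shift (ε⁻¹ • β) f, coeFn_shift (ε⁻¹ • β) (S.evol ε α β t f),
    ae_sub (ε⁻¹ • β) (coeFn_mulOp (S.isSymbol_prop ε α β t) f),
    Lp.coeFn_smul (Complex.exp (-(Complex.I * α / ε * t)))
      (shift _ (ε⁻¹ • β) (S.evol ε α β t f))] with k h1 h2 h3 h4
  rw [h4, Pi.smul_apply, h2, h1, evol, h3, prop_apply, prop_apply, smul_smul, ← Complex.exp_add,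
    sub_add_cancel]
  simp

end FriedrichsSystem

/-! ### Integral inequalities and integral equations -/

/-- Grönwall's inequality in integral form. -/
theorem le_mul_exp_of_le_integral {φ : ℝ → ℝ} {A B τ : ℝ} (hB : 0 ≤ B) (hφ : Continuous φ)
    (h : ∀ t ∈ Icc 0 τ, φ t ≤ A + B * ∫ s in (0 : ℝ)..t, φ s) :
    ∀ t ∈ Icc 0 τ, φ t ≤ A * Real.exp (B * t) := by
  intro t ht
  have hI : ∀ s, HasDerivAt (fun r => ∫ x in (0 : ℝ)..r, φ x) (φ s) s := fun s =>
    hφ.integral_hasStrictDerivAt 0 s |>.hasDerivAt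
  have hE : ∀ s, HasDerivAt (fun r => Real.exp (-(B * r))) (Real.exp (-(B * s)) * (-B)) s := by
    intro s
    have := (((hasDerivAt_id s).const_mul B).neg).exp
    simpa using this
  have hd : ∀ s, HasDerivAt (fun r => Real.exp (-(B * r)) * (A + B * ∫ x in (0 : ℝ)..r, φ x))
      (Real.exp (-(B * s)) * (-B) * (A + B * ∫ x in (0 : ℝ)..s, φ x) +
        Real.exp (-(B * s)) * (B * φ s)) s := fun s =>
    (hE s).mul (((hI s).const_mul B).const_add A)
  -- The derivative is $B\mathrm e^{-Br}\bigl(\varphi(r)-A-B\int_0^r\varphi\bigr)$, which is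
  -- nonpositive by hypothesis.
  have hanti : AntitoneOn (fun r => Real.exp (-(B * r)) * (A + B * ∫ x in (0 : ℝ)..r, φ x))
      (Icc 0 τ) := by
    refine antitoneOn_of_deriv_nonpos (convex_Icc 0 τ)
      (fun s _ => (hd s).continuousAt.continuousWithinAt)
      (fun s _ => (hd s).differentiableAt.differentiableWithinAt) fun s hs => ?_
    rw [(hd s).deriv]
    have h1 := h s (interior_subset hs)
    have h2 : 0 ≤ Real.exp (-(B * s)) * B * (A + B * (∫ x in (0 : ℝ)..s, φ x) - φ s) :=
      mul_nonneg (mul_nonneg (Real.exp_pos _).le hB) (by linarith)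
    linarith
  have h0 := hanti (left_mem_Icc.2 (ht.1.trans ht.2)) ht ht.1
  simp only [mul_zero, neg_zero, Real.exp_zero, intervalIntegral.integral_same, add_zero,
    one_mul] at h0
  have h1 := mul_le_mul_of_nonneg_left h0 (Real.exp_pos (B * t)).le
  rw [← mul_assoc, ← Real.exp_add, add_neg_cancel, Real.exp_zero, one_mul] at h1
  exact (h t ht).trans (h1.trans_eq (mul_comm _ _))

/-- Retraction of the real line to `[0, τ]`. -/
def clamp (τ t : ℝ) : ℝ := max 0 (min τ t)

theorem continuous_clamp (τ : ℝ) : Continuous (clamp τ) := by unfold clamp; fun_prop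

theorem clamp_mem {τ : ℝ} (hτ : 0 ≤ τ) (t : ℝ) : clamp τ t ∈ Icc 0 τ :=
  ⟨le_max_left _ _, max_le hτ (min_le_left _ _)⟩

theorem clamp_of_mem {τ t : ℝ} (ht : t ∈ Icc 0 τ) : clamp τ t = t := by
  rw [clamp, min_eq_right ht.2, max_eq_right ht.1]

/-- Curves on `[0, τ]` are extended by constants, so that later integral estimates can assume
continuity on the whole line. -/
theorem continuous_comp_clamp {E : Type*} [TopologicalSpace E] {f : ℝ → E} {τ : ℝ} (hτ : 0 ≤ τ)
    (hf : ContinuousOn f (Icc 0 τ)) : Continuous fun t => f (clamp τ t) :=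
  hf.comp_continuous (continuous_clamp τ) (clamp_mem hτ)

theorem norm_integral_le_integral_of_le {E : Type*} [NormedAddCommGroup E] [NormedSpace ℝ E]
    {f : ℝ → E} {φ : ℝ → ℝ} {t : ℝ} (ht : 0 ≤ t) (hf : ∀ s ∈ Icc 0 t, ‖f s‖ ≤ φ s)
    (hφ : Continuous φ) : ‖∫ s in (0 : ℝ)..t, f s‖ ≤ ∫ s in (0 : ℝ)..t, φ s :=
  intervalIntegral.norm_integral_le_of_norm_le ht
    (ae_of_all _ fun s hs => hf s (Ioc_subset_Icc_self hs)) (hφ.intervalIntegrable _ _)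

theorem norm_integral_le_const_mul {E : Type*} [NormedAddCommGroup E] [NormedSpace ℝ E]
    {f : ℝ → E} {C t : ℝ} (ht : 0 ≤ t) (hf : ∀ s ∈ Icc 0 t, ‖f s‖ ≤ C) :
    ‖∫ s in (0 : ℝ)..t, f s‖ ≤ C * t := by
  have := intervalIntegral.norm_integral_le_of_norm_le_const (a := 0) (b := t) (f := f) (C := C)
    fun s hs => hf s (Ioc_subset_Icc_self (by rwa [uIoc_of_le ht] at hs))
  rwa [sub_zero, abs_of_nonneg ht] at this

section Banach

variable {E F : Type*} [NormedAddCommGroup E] [NormedSpace ℝ E] [NormedAddCommGroup F] [NormedSpace ℝ F] [CompleteSpace F]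

/-- The fundamental theorem of calculus for an integral curve with continuous integrand. -/
theorem hasDerivAt_add_smul_integral [CompleteSpace E] {g : ℝ → E} (hg : Continuous g) (x : E) (c t : ℝ) :
    HasDerivAt (fun r => x + c • ∫ s in (0 : ℝ)..r, g s) (c • g t) t :=
  (((hg.integral_hasStrictDerivAt 0 t).hasDerivAt).const_smul c).const_add x

/-- Integration by parts for an oscillating family of operators. -/
theorem norm_integral_clm_apply_le {M M' : ℝ → E →L[ℝ] F} {Z Z' : ℝ → E} {m z z' τ : ℝ}
    (hM : ∀ s, HasDerivAt M (M' s) s) (hZ : ∀ s, HasDerivAt Z (Z' s) s)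
    (hMZ : Continuous fun s => M' s (Z s)) (hZ' : Continuous Z') (hm : ∀ s, ‖M s‖ ≤ m)
    (hz : ∀ s ∈ Icc 0 τ, ‖Z s‖ ≤ z) (hz' : ∀ s ∈ Icc 0 τ, ‖Z' s‖ ≤ z') {t : ℝ}
    (ht : t ∈ Icc 0 τ) :
    ‖∫ s in (0 : ℝ)..t, M' s (Z s)‖ ≤ m * (2 * z + z' * τ) := by
  have hMc : Continuous M := continuous_iff_continuousAt.2 fun s => (hM s).continuousAt
  have hMZ' : Continuous fun s => M s (Z' s) := hMc.clm_apply hZ'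
  have h1 := intervalIntegral.integral_eq_sub_of_hasDerivAt (a := 0) (b := t)
    (fun s _ => (hM s).clm_apply (hZ s))
    ((hMZ.add hMZ').intervalIntegrable _ _)
  have h2 := intervalIntegral.integral_add (hMZ.intervalIntegrable (μ := volume) 0 t)
    (hMZ'.intervalIntegrable 0 t)
  -- `M` is the small primitive of the oscillating family `M'`. The two boundary terms give `2 * z`,
  -- the remaining integral gives `z' * τ`.
  have h3 : ∫ s in (0 : ℝ)..t, M' s (Z s) =
      M t (Z t) - M 0 (Z 0) - ∫ s in (0 : ℝ)..t, M s (Z' s) := by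
    rw [← h1, h2]; abel
  have hm0 : 0 ≤ m := (norm_nonneg _).trans (hm 0)
  have h0 : (0 : ℝ) ∈ Icc 0 τ := ⟨le_rfl, ht.1.trans ht.2⟩
  have hz'0 : 0 ≤ z' := (norm_nonneg _).trans (hz' 0 h0)
  have h4 : ‖∫ s in (0 : ℝ)..t, M s (Z' s)‖ ≤ m * z' * t :=
    norm_integral_le_const_mul ht.1 fun s hs =>
      ((M s).le_of_opNorm_le (hm s) _).trans (mul_le_mul_of_nonneg_left
        (hz' s ⟨hs.1, hs.2.trans ht.2⟩) hm0)
  have h5 : ∀ s ∈ Icc 0 τ, ‖M s (Z s)‖ ≤ m * z := fun s hs =>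
    ((M s).le_of_opNorm_le (hm s) _).trans (mul_le_mul_of_nonneg_left (hz s hs) hm0)
  have h6 : m * z' * t ≤ m * z' * τ := mul_le_mul_of_nonneg_left ht.2 (mul_nonneg hm0 hz'0)
  rw [h3]
  have := norm_sub_le (M t (Z t) - M 0 (Z 0)) (∫ s in (0 : ℝ)..t, M s (Z' s))
  have := norm_sub_le (M t (Z t)) (M 0 (Z 0))
  have := h5 t ht
  have := h5 0 h0
  linarith

/-- Solutions of the integral equation with a cubic nonlinearity, uniformly on the time scale
`1 / ε`. -/
theorem exists_integral_solution [CompleteSpace E] {U V : ℝ → E →L[ℝ] E} {Q : E → E} {C R T : ℝ}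
    (hU : ∀ t, ‖U t‖ ≤ 1) (hUc : ∀ f : ℝ → E, Continuous f → Continuous fun t => U t (f t))
    (hV : ∀ t, ‖V t‖ ≤ 1) (hVc : ∀ f : ℝ → E, Continuous f → Continuous fun t => V t (f t))
    (hC : 0 ≤ C) (hQ0 : ∀ x, ‖Q x‖ ≤ C * ‖x‖ ^ 3)
    (hQ : ∀ x y r, ‖x‖ ≤ r → ‖y‖ ≤ r → ‖Q x - Q y‖ ≤ 3 * C * r ^ 2 * ‖x - y‖)
    (hQc : Continuous Q) (hR : 0 ≤ R) (hT : 0 ≤ T) (hTR : C * (2 * R) ^ 3 * T ≤ R) {ε : ℝ}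
    (hε : 0 < ε) {x₀ : E} (hx₀ : ‖x₀‖ ≤ R) :
    ∃ a : ℝ → E, Continuous a ∧ (∀ t, ‖a t‖ ≤ 2 * R) ∧
      ∀ t ∈ Icc 0 (T / ε), a t = x₀ + ε • ∫ s in (0 : ℝ)..t, V s (Q (U s (a s))) := by
  have hτ : (0 : ℝ) ≤ T / ε := div_nonneg hT hε.le
  have hball : ∀ x ∈ Metric.closedBall x₀ R, ‖x‖ ≤ 2 * R := fun x hx => by
    rw [mem_closedBall_iff_norm] at hx
    have := norm_le_norm_add_norm_sub x₀ x
    rw [norm_sub_rev] at this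
    linarith
  have hUx : ∀ s x, ‖U s x‖ ≤ ‖x‖ := fun s x => ((U s).le_of_opNorm_le (hU s) x).trans_eq (one_mul _)
  have hVx : ∀ s x, ‖V s x‖ ≤ ‖x‖ := fun s x => ((V s).le_of_opNorm_le (hV s) x).trans_eq (one_mul _)
  -- On the ball of radius `R` about `x₀` all vectors have norm at most `2 * R`, so the speed is at
  -- most `ε * (C * (2 * R) ^ 3)`. Over a time `T / ε` the factor `ε` cancels, and `hTR` keeps the
  -- curve in the ball.
  have hf : IsPicardLindelof (fun t x => ε • V t (Q (U t x))) (tmin := 0) (tmax := T / ε)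
      ⟨0, le_rfl, hτ⟩ x₀ R.toNNReal 0 (ε * (C * (2 * R) ^ 3)).toNNReal
      (ε * (3 * C * (2 * R) ^ 2)).toNNReal := by
    constructor
    · intro t _
      rw [Real.coe_toNNReal _ hR]
      refine LipschitzOnWith.of_dist_le_mul fun x hx y hy => ?_
      rw [Real.coe_toNNReal _ (by positivity), dist_eq_norm, dist_eq_norm, ← smul_sub, ← map_sub,
        norm_smul, Real.norm_of_nonneg hε.le, mul_assoc]
      refine mul_le_mul_of_nonneg_left ((hVx _ _).trans ?_) hε.le
      refine (hQ _ _ (2 * R) ((hUx _ _).trans (hball x hx)) ((hUx _ _).trans (hball y hy))).trans ?_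
      rw [← map_sub]
      exact mul_le_mul_of_nonneg_left (hUx _ _) (by positivity)
    · intro x _
      exact ((hVc _ (hQc.comp (hUc _ continuous_const))).const_smul ε).continuousOn
    · intro t _ x hx
      rw [Real.coe_toNNReal _ hR] at hx
      rw [Real.coe_toNNReal _ (by positivity), norm_smul, Real.norm_of_nonneg hε.le]
      refine mul_le_mul_of_nonneg_left ((hVx _ _).trans ((hQ0 _).trans ?_)) hε.le
      exact mul_le_mul_of_nonneg_left (pow_le_pow_left₀ (norm_nonneg _)
        ((hUx _ _).trans (hball x hx)) 3) hC
    · rw [Real.coe_toNNReal _ (by positivity), Real.coe_toNNReal _ hR]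
      simp only [sub_zero, sub_self, NNReal.coe_zero]
      rw [max_eq_left hτ]
      refine le_trans (le_of_eq ?_) hTR
      field_simp
  have hx : x₀ ∈ Metric.closedBall x₀ ((0 : NNReal) : ℝ) := Metric.mem_closedBall_self (by simp)
  -- The fixed point itself is used: it satisfies the integral equation directly, and its extension
  -- `compProj` is continuous on the line and stays in the ball.
  obtain ⟨α, hα⟩ := ODE.FunSpace.exists_isFixedPt_next hf hx
  refine ⟨α.compProj, α.continuous_compProj, fun t => hball _ ?_, fun t ht => ?_⟩
  · have := α.compProj_mem_closedBall hf.mul_max_le (t := t)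
    rwa [Real.coe_toNNReal _ hR] at this
  · have h1 : α.compProj t = ODE.FunSpace.next hf hx α ⟨t, ht⟩ := by
      rw [hα, ODE.FunSpace.compProj_of_mem ht]
    rw [h1, ODE.FunSpace.next_apply, ODE.picard_apply, intervalIntegral.integral_smul]

/-- Uniqueness for the integral equation with a cubic nonlinearity. -/
theorem eq_of_integral_solution {U V : ℝ → E →L[ℝ] E} {Q : E → E} {C R τ ε : ℝ}
    (hU : ∀ t, ‖U t‖ ≤ 1) (hUc : ∀ f : ℝ → E, Continuous f → Continuous fun t => U t (f t))
    (hV : ∀ t, ‖V t‖ ≤ 1) (hVc : ∀ f : ℝ → E, Continuous f → Continuous fun t => V t (f t))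
    (hC : 0 ≤ C) (hQ : ∀ x y r, ‖x‖ ≤ r → ‖y‖ ≤ r → ‖Q x - Q y‖ ≤ 3 * C * r ^ 2 * ‖x - y‖)
    (hQc : Continuous Q) (hε : 0 ≤ ε) {x₀ : E} {a b : ℝ → E} (ha : Continuous a)
    (hb : Continuous b) (haR : ∀ t, ‖a t‖ ≤ R) (hbR : ∀ t, ‖b t‖ ≤ R)
    (ha' : ∀ t ∈ Icc 0 τ, a t = x₀ + ε • ∫ s in (0 : ℝ)..t, V s (Q (U s (a s))))
    (hb' : ∀ t ∈ Icc 0 τ, b t = x₀ + ε • ∫ s in (0 : ℝ)..t, V s (Q (U s (b s)))) :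
    ∀ t ∈ Icc 0 τ, a t = b t := by
  have hUx : ∀ s x, ‖U s x‖ ≤ ‖x‖ := fun s x => ((U s).le_of_opNorm_le (hU s) x).trans_eq (one_mul _)
  have hVx : ∀ s x, ‖V s x‖ ≤ ‖x‖ := fun s x => ((V s).le_of_opNorm_le (hV s) x).trans_eq (one_mul _)
  have hci : ∀ c : ℝ → E, Continuous c → Continuous fun s => V s (Q (U s (c s))) := fun c hc =>
    hVc _ (hQc.comp (hUc _ hc))
  have key := le_mul_exp_of_le_integral (φ := fun t => ‖a t - b t‖) (A := 0)
    (B := ε * (3 * C * R ^ 2)) (τ := τ) (by positivity) (ha.sub hb).norm fun t ht => by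
      rw [zero_add, ha' t ht, hb' t ht, add_sub_add_left_eq_sub, ← smul_sub,
        ← intervalIntegral.integral_sub ((hci a ha).intervalIntegrable _ _)
          ((hci b hb).intervalIntegrable _ _), norm_smul, Real.norm_of_nonneg hε, mul_assoc,
        ← intervalIntegral.integral_const_mul]
      refine mul_le_mul_of_nonneg_left (norm_integral_le_integral_of_le ht.1 (fun s _ => ?_)
        ((ha.sub hb).norm.const_mul _)) hε
      rw [← map_sub]
      refine (hVx _ _).trans ((hQ _ _ R ((hUx _ _).trans (haR s)) ((hUx _ _).trans (hbR s))).trans ?_)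
      rw [← map_sub]
      exact mul_le_mul_of_nonneg_left (hUx _ _) (by positivity)
  intro t ht
  have := key t ht
  rw [zero_mul] at this
  exact sub_eq_zero.1 (norm_le_zero_iff.1 this)

end Banach


/-! ### Cubic maps -/

/-- Bounds for a continuous cubic map. -/
structure IsCubic {E F : Type*} [NormedAddCommGroup E] [NormedAddCommGroup F] (C : ℝ)
    (Q : E → F) : Prop where
  nonneg : 0 ≤ C
  norm_le : ∀ x, ‖Q x‖ ≤ C * ‖x‖ ^ 3
  sub_le : ∀ x y r, ‖x‖ ≤ r → ‖y‖ ≤ r → ‖Q x - Q y‖ ≤ 3 * C * r ^ 2 * ‖x - y‖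
  continuous : Continuous Q

theorem IsCubic.add {E F : Type*} [NormedAddCommGroup E] [NormedAddCommGroup F] {C C' : ℝ}
    {Q Q' : E → F} (h : IsCubic C Q) (h' : IsCubic C' Q') :
    IsCubic (C + C') fun x => Q x + Q' x where
  nonneg := add_nonneg h.nonneg h'.nonneg
  norm_le x := (norm_add_le _ _).trans ((add_le_add (h.norm_le x) (h'.norm_le x)).trans_eq
    (by ring))
  sub_le x y r hx hy := by
    rw [add_sub_add_comm]
    exact (norm_add_le _ _).trans ((add_le_add (h.sub_le x y r hx hy)
      (h'.sub_le x y r hx hy)).trans_eq (by ring))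
  continuous := h.continuous.add h'.continuous

theorem mul_three_le {C a b c a' b' c' : ℝ} (hC : 0 ≤ C) (ha : 0 ≤ a) (hb : 0 ≤ b) (hc : 0 ≤ c)
    (h1 : a ≤ a') (h2 : b ≤ b') (h3 : c ≤ c') : C * (a * b * c) ≤ C * (a' * b' * c') :=
  mul_le_mul_of_nonneg_left (mul_le_mul (mul_le_mul h1 h2 hb (ha.trans h1)) h3 hc
    (mul_nonneg (ha.trans h1) (hb.trans h2))) hC

/-- Differences of values of a trilinear map. -/
theorem norm_tri_sub_le {U V W Z : Type*} [NormedAddCommGroup U] [NormedSpace ℝ U]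
    [NormedAddCommGroup V] [NormedSpace ℝ V] [NormedAddCommGroup W] [NormedSpace ℝ W]
    [NormedAddCommGroup Z] [NormedSpace ℝ Z] {B : U → V → W → Z} (hB : IsTri B) {C : ℝ}
    (hC0 : 0 ≤ C) (hC : ∀ a b c, ‖B a b c‖ ≤ C * (‖a‖ * ‖b‖ * ‖c‖)) {a a' : U} {b b' : V}
    {c c' : W} {r δ : ℝ} (hb : ‖b‖ ≤ r) (hc : ‖c‖ ≤ r) (ha' : ‖a'‖ ≤ r)
    (hb' : ‖b'‖ ≤ r) (h1 : ‖a - a'‖ ≤ δ) (h2 : ‖b - b'‖ ≤ δ) (h3 : ‖c - c'‖ ≤ δ) :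
    ‖B a b c - B a' b' c'‖ ≤ 3 * C * r ^ 2 * δ := by
  rw [hB.sub_eq]
  have e1 := (hC (a - a') b c).trans (mul_three_le hC0 (norm_nonneg _) (norm_nonneg _)
    (norm_nonneg _) h1 hb hc)
  have e2 := (hC a' (b - b') c).trans (mul_three_le hC0 (norm_nonneg _) (norm_nonneg _)
    (norm_nonneg _) ha' h2 hc)
  have e3 := (hC a' b' (c - c')).trans (mul_three_le hC0 (norm_nonneg _) (norm_nonneg _)
    (norm_nonneg _) ha' hb' h3)
  refine norm_add₃_le.trans ((add_le_add_three e1 e2 e3).trans_eq ?_)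
  ring

theorem IsTri.isCubic {E V Z : Type*} [NormedAddCommGroup E] [NormedSpace ℝ E]
    [NormedAddCommGroup V] [NormedSpace ℝ V] [NormedAddCommGroup Z] [NormedSpace ℝ Z]
    {B : V → V → V → Z} (hB : IsTri B) {C : ℝ}
    (hC0 : 0 ≤ C) (hC : ∀ a b c, ‖B a b c‖ ≤ C * (‖a‖ * ‖b‖ * ‖c‖)) (P₁ P₂ P₃ : E →L[ℝ] V)
    (h₁ : ∀ x, ‖P₁ x‖ ≤ ‖x‖) (h₂ : ∀ x, ‖P₂ x‖ ≤ ‖x‖) (h₃ : ∀ x, ‖P₃ x‖ ≤ ‖x‖) :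
    IsCubic C fun x => B (P₁ x) (P₂ x) (P₃ x) where
  nonneg := hC0
  norm_le x := (hC _ _ _).trans ((mul_three_le hC0 (norm_nonneg _) (norm_nonneg _)
    (norm_nonneg _) (h₁ x) (h₂ x) (h₃ x)).trans_eq (by ring))
  sub_le x y r hx hy := by
    refine norm_tri_sub_le hB hC0 hC ((h₂ x).trans hx) ((h₃ x).trans hx) ((h₁ y).trans hy)
      ((h₂ y).trans hy) ?_ ?_ ?_
    · rw [← map_sub]; exact h₁ _
    · rw [← map_sub]; exact h₂ _
    · rw [← map_sub]; exact h₃ _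
  continuous := hB.continuous P₁.continuous P₂.continuous P₃.continuous

namespace Wiener

variable {d n : ℕ}

theorem coe_add (f g : Wiener d n) (x : Pos d) : (f + g) x = f x + g x := rfl

theorem coe_sub (f g : Wiener d n) (x : Pos d) : (f - g) x = f x - g x := rfl

theorem coe_real_smul (c : ℝ) (f : Wiener d n) (x : Pos d) : (c • f) x = c • f x := by
  ext i
  change ((c : ℂ) • f x) i = _
  simp

end Wiener

/-! ### Existence of mild solutions. -/

namespace FriedrichsSystem

variable {d n : ℕ} (S : FriedrichsSystem d n)

theorem chr_inv_smul (ε : ℝ) (κ x : Pos d) :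
    chr x (ε⁻¹ • κ) = Complex.exp (Complex.I * (inner ℝ κ x : ℝ) / ε) := by
  rw [chr, real_inner_smul_left]
  congr 1
  push_cast
  ring

/-- Fourier transform of the initial datum of the mild solution. -/
def initHat (κ : Pos d) (ε : ℝ) (p : FreqL1 d n) : FreqL1 d n :=
  shift _ (ε⁻¹ • κ) p + bar d n (shift _ (ε⁻¹ • κ) p)

theorem invFourier_initHat (κ : Pos d) (ε : ℝ) (p : Wiener d n) (x : Pos d) :
    invFourier d n (initHat κ ε p.hat) x =
      addCC (Complex.exp (Complex.I * (inner ℝ κ x : ℝ) / ε) • p x) := by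
  rw [initHat, map_add, Pi.add_apply, invFourier_bar, invFourier_shift, chr_inv_smul,
    ← Wiener.coe_eq, addCC]

theorem bar_initHat (κ : Pos d) (ε : ℝ) (p : FreqL1 d n) :
    bar d n (initHat κ ε p) = initHat κ ε p := by
  rw [initHat, map_add, bar_bar, add_comm]

theorem norm_initHat_le (κ : Pos d) (ε : ℝ) (p : FreqL1 d n) : ‖initHat κ ε p‖ ≤ 2 * ‖p‖ := by
  refine (norm_add_le _ _).trans_eq ?_
  rw [norm_bar, norm_shift]
  ring

theorem isCubic_That {C : ℝ} (hC0 : 0 ≤ C)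
    (hC : ∀ f g h, ‖S.That f g h‖ ≤ C * (‖f‖ * ‖g‖ * ‖h‖)) :
    IsCubic C fun f => S.That f f f :=
  S.isTri_That.isCubic hC0 hC (.id ℝ _) (.id ℝ _) (.id ℝ _) (fun _ => le_rfl) (fun _ => le_rfl)
    fun _ => le_rfl

/-- Picard iteration for the interaction-picture variable `a`, from which the linear evolution has
been removed. As the evolution is isometric, bounds for `a` are bounds for the solution. -/
theorem exists_isMildSolution {C : ℝ} (hC0 : 0 ≤ C)
    (hC : ∀ f g h, ‖S.That f g h‖ ≤ C * (‖f‖ * ‖g‖ * ‖h‖)) {R T : ℝ} (hR : 0 ≤ R) (hT : 0 ≤ T)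
    (hTR : C * (2 * R) ^ 3 * T ≤ R) {ε : ℝ} (hε : 0 < ε) (κ : Pos d) (p : Wiener d n)
    (hp : 2 * ‖p‖ ≤ R) :
    ∃ u : ℝ → Wiener d n, S.IsMildSolution κ ε (T / ε) (fun x => p x) u ∧
      ∀ t ∈ Icc 0 (T / ε), ‖u t‖ ≤ 2 * R := by
  have hτ : 0 ≤ T / ε := div_nonneg hT hε.le
  set x₀ := initHat κ ε p.hat with hx₀
  have hQ := S.isCubic_That hC0 hC
  have hUc := fun (f : ℝ → FreqL1 d n) (hf : Continuous f) => S.continuous_evol_apply ε 0 0 hf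
  have hVc := fun (f : ℝ → FreqL1 d n) (hf : Continuous f) => S.continuous_evol_neg_apply ε 0 0 hf
  obtain ⟨a, hac, haR, ha⟩ := exists_integral_solution (U := fun t => S.evol ε 0 0 t)
    (V := fun t => S.evol ε 0 0 (-t)) (S.norm_evol_le ε 0 0) hUc
    (fun t => S.norm_evol_le ε 0 0 (-t)) hVc hC0 hQ.norm_le hQ.sub_le hQ.continuous hR hT hTR hε
    (x₀ := x₀) ((norm_initHat_le κ ε p.hat).trans hp)
  have hint : Continuous fun s => S.evol ε 0 0 (-s) (S.That (S.evol ε 0 0 s (a s))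
      (S.evol ε 0 0 s (a s)) (S.evol ε 0 0 s (a s))) := hVc _ (hQ.continuous.comp (hUc _ hac))
  -- The nonlinearity, the evolution and the initial datum commute with conjugation, so the
  -- conjugate of `a` solves the same equation. Uniqueness makes the solution real.
  have hreal : ∀ t ∈ Icc 0 (T / ε), a t = bar d n (a t) := by
    refine eq_of_integral_solution (U := fun t => S.evol ε 0 0 t)
      (V := fun t => S.evol ε 0 0 (-t)) (Q := fun f => S.That f f f) (x₀ := x₀)
      (S.norm_evol_le ε 0 0) hUc (fun t => S.norm_evol_le ε 0 0 (-t)) hVc hC0 hQ.sub_le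
      hQ.continuous hε.le hac ((bar d n).continuous.comp hac) haR
      (fun t => (norm_bar _).trans_le (haR t)) ha fun t ht => ?_
    rw [ha t ht, map_add, map_smul, bar_initHat,
      ← ContinuousLinearMap.intervalIntegral_comp_comm _ (hint.intervalIntegrable _ _)]
    simp only [bar_evol, bar_That, hx₀]
  set û : ℝ → FreqL1 d n := fun t => S.evol ε 0 0 t (a t) with hû
  have ha0 : a 0 = x₀ := by simpa using ha 0 ⟨le_rfl, hτ⟩
  have hû0 : û 0 = x₀ := by rw [hû, ← ha0]; exact S.evol_zero ε 0 0 _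
  refine ⟨fun t => Wiener.hat.symm (û t), ⟨?_, ?_, ?_, ?_⟩, ?_⟩
  · exact ((Wiener.hatₗᵢ d n).symm.continuous.comp (hUc _ hac)).continuousOn
  · intro t ht x i
    have h1 : bar d n (û t) = û t := by rw [hû, bar_evol, ← hreal t ht]
    have h2 := invFourier_bar (û t) x
    rw [h1] at h2
    rw [Wiener.coe_hat_symm]
    have h3 := congrArg (fun v : CVec n => v i) h2
    exact Complex.conj_eq_iff_im.1 h3.symm
  · intro x
    rw [Wiener.coe_hat_symm, hû0, hx₀, invFourier_initHat]
  · refine ⟨fun s => Wiener.hat.symm (S.That (û s) (û s) (û s)), fun s _ x => ?_, fun t ht => ?_⟩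
    · rw [Wiener.coe_hat_symm, invFourier_That, Wiener.coe_hat_symm]
    · simp only [LinearEquiv.apply_symm_apply, flow_eq_evol]
      rw [hû0, hû]
      simp only
      rw [ha t ht, map_add, map_smul,
        ← ContinuousLinearMap.intervalIntegral_comp_comm _ (hint.intervalIntegrable _ _)]
      simp only [evol_evol, sub_eq_add_neg]
  · intro t _
    refine le_trans (le_of_eq ?_) (haR t)
    change ‖Wiener.hat (Wiener.hat.symm (û t))‖ = _
    rw [LinearEquiv.apply_symm_apply, hû, norm_evol_apply]

end FriedrichsSystem

/-! ### Frequency cutoffs -/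

section Cutoff

variable {d : ℕ} {E F : Type*} [NormedAddCommGroup E] [NormedSpace ℝ E] [NormedAddCommGroup F]
  [NormedSpace ℝ F]

open Classical in
/-- The indicator function of the ball of radius `r`. -/
def ballInd (r : ℝ) (k : Pos d) : ℝ := if ‖k‖ ≤ r then 1 else 0

theorem ballInd_of_le {r : ℝ} {k : Pos d} (h : ‖k‖ ≤ r) : ballInd r k = 1 := if_pos h

theorem ballInd_of_lt {r : ℝ} {k : Pos d} (h : r < ‖k‖) : ballInd r k = 0 := if_neg h.not_ge

theorem abs_ballInd_le (r : ℝ) (k : Pos d) : |ballInd r k| ≤ 1 := by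
  rcases le_or_gt ‖k‖ r with h | h
  · simp [ballInd_of_le h]
  · simp [ballInd_of_lt h]

theorem measurable_ballInd (r : ℝ) : Measurable (ballInd (d := d) r) :=
  Measurable.ite (measurableSet_le measurable_norm measurable_const) measurable_const
    measurable_const

theorem IsSymbol.ballInd_smul {φ : Pos d → E →L[ℝ] F} (hφ : AEStronglyMeasurable φ volume) {r : ℝ}
    {C : ℝ} (hC : ∀ k, ‖k‖ ≤ r → ‖φ k‖ ≤ C) :
    IsSymbol volume fun k => ballInd r k • φ k := by
  refine ⟨(measurable_ballInd r).aestronglyMeasurable.smul hφ, max C 0, fun k => ?_⟩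
  rcases le_or_gt ‖k‖ r with h | h
  · rw [ballInd_of_le h, one_smul]; exact (hC k h).trans (le_max_left _ _)
  · rw [ballInd_of_lt h, zero_smul, norm_zero]; exact le_max_right _ _

/-- The cutoff operator to frequencies in the ball of radius `r`. -/
def cut (E : Type*) [NormedAddCommGroup E] [NormedSpace ℝ E] (r : ℝ) : FL d E →L[ℝ] FL d E :=
  mulOp volume fun k => ballInd r k • ContinuousLinearMap.id ℝ E

theorem isSymbol_cut (r : ℝ) :
    IsSymbol volume fun k : Pos d => ballInd r k • ContinuousLinearMap.id ℝ E :=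
  IsSymbol.ballInd_smul aestronglyMeasurable_const (C := ‖ContinuousLinearMap.id ℝ E‖)
    fun _ _ => le_rfl

theorem coeFn_cut (r : ℝ) (f : FL d E) : cut E r f =ᵐ[volume] fun k => ballInd r k • f k :=
  coeFn_mulOp (isSymbol_cut r) f

theorem cut_mulOp {φ : Pos d → E →L[ℝ] F} (hφ : IsSymbol volume φ) (r : ℝ) (f : FL d E) :
    cut F r (mulOp volume φ f) = mulOp volume (fun k => ballInd r k • φ k) f := by
  rw [cut, mulOp_comp (isSymbol_cut r) hφ]
  congr 1

theorem mulOp_cut {φ : Pos d → E →L[ℝ] F} (hφ : IsSymbol volume φ) (r : ℝ) (f : FL d E) :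
    mulOp volume φ (cut E r f) = mulOp volume (fun k => ballInd r k • φ k) f := by
  have h : (fun k => (φ k).comp (ballInd r k • ContinuousLinearMap.id ℝ E)) =
      fun k => ballInd r k • φ k := by
    funext k
    refine ContinuousLinearMap.ext fun v => ?_
    simp
  rw [cut, mulOp_comp hφ (isSymbol_cut r), h]

/-- Identities involving an unbounded generator can thus be checked on bounded frequency sets, where
the operators are norm differentiable in time. -/
theorem eq_of_cut_eq {f g : FL d E} (h : ∀ N : ℕ, cut E (N : ℝ) f = cut E (N : ℝ) g) : f = g := by
  refine Lp.ext ?_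
  have h1 : ∀ᵐ k : Pos d, ∀ N : ℕ, ballInd (N : ℝ) k • f k = ballInd (N : ℝ) k • g k := by
    rw [ae_all_iff]
    intro N
    filter_upwards [coeFn_cut (N : ℝ) f, coeFn_cut (N : ℝ) g] with k h1 h2
    rw [← h1, ← h2, h N]
  filter_upwards [h1] with k hk
  obtain ⟨N, hN⟩ := exists_nat_ge ‖k‖
  simpa [ballInd_of_le hN] using hk N

/-- Multiplication operators with symbols solving a linear differential equation are norm
differentiable after a frequency cutoff. -/
theorem hasDerivAt_mulOp_cut {P : ℝ → Pos d → E →L[ℝ] E} {G : Pos d → E →L[ℝ] E}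
    (hP : ∀ t, IsSymbol volume (P t)) (hP1 : ∀ t k, ‖P t k‖ ≤ 1) (hG : Continuous G)
    (hd : ∀ t k, HasDerivAt (fun s => P s k) ((G k).comp (P t k)) t) (r t : ℝ) :
    HasDerivAt (fun s => mulOp volume fun k => ballInd r k • P s k)
      (mulOp volume fun k => ballInd r k • (G k).comp (P t k)) t := by
  -- On the ball the generator is bounded, by compactness. With this bound `D` the derivative `G P`
  -- has norm at most `D` and Lipschitz constant `D * D` in time.
  obtain ⟨C, hC⟩ := (isCompact_closedBall (0 : Pos d) r).exists_bound_of_continuousOn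
    hG.continuousOn
  have hC' : ∀ k : Pos d, ‖k‖ ≤ r → ‖G k‖ ≤ max C 0 := fun k hk =>
    (hC k (mem_closedBall_zero_iff.2 hk)).trans (le_max_left _ _)
  set D := max C 0 with hD
  have hD0 : 0 ≤ D := le_max_right _ _
  have hGP : ∀ t k, ‖k‖ ≤ r → ‖(G k).comp (P t k)‖ ≤ D := fun t k hk =>
    ((G k).opNorm_comp_le _).trans ((mul_le_mul (hC' k hk) (hP1 t k) (norm_nonneg _) hD0).trans_eq
      (mul_one _))
  refine hasDerivAt_mulOp (C := D * D)
    (fun s => IsSymbol.ballInd_smul (hP s).meas (C := 1) fun k _ => hP1 s k)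
    (fun s => IsSymbol.ballInd_smul
      ((ContinuousLinearMap.compL ℝ E E E).aestronglyMeasurable_comp₂ hG.aestronglyMeasurable
        (hP s).meas) (hGP s))
    (fun s k => (hd s k).const_smul (ballInd r k)) (fun s u k => ?_) t
  rcases le_or_gt ‖k‖ r with h | h
  · rw [ballInd_of_le h, one_smul, one_smul]
    change ‖(G k).comp (P s k) - (G k).comp (P u k)‖ ≤ _
    rw [← ContinuousLinearMap.comp_sub]
    refine ((G k).opNorm_comp_le _).trans ?_
    rw [mul_assoc]
    refine mul_le_mul (hC' k h) ?_ (norm_nonneg _) hD0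
    have := Convex.norm_image_sub_le_of_norm_hasDerivWithin_le (s := univ) (x := u) (y := s)
      (fun x _ => (hd x k).hasDerivWithinAt) (fun x _ => hGP x k h) convex_univ (mem_univ _)
      (mem_univ _)
    rwa [Real.norm_eq_abs] at this
  · rw [ballInd_of_lt h, zero_smul, zero_smul, sub_zero, norm_zero]
    positivity

end Cutoff

/-! ### Partial derivatives on the Fourier side -/

section Partial

variable {d n : ℕ}

/-- Evaluation of the inverse Fourier transform. -/
def evalL (n : ℕ) (x : Pos d) : FreqL1 d n →L[ℝ] CVec n :=
  LinearMap.mkContinuous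
    { toFun := fun f => invFourier d n f x
      map_add' := fun f g => by rw [map_add]; rfl
      map_smul' := fun c f => invFourier_real_smul c f x } 1
    fun f => by rw [one_mul]; exact norm_invFourier_le f x

@[simp] theorem evalL_apply (x : Pos d) (f : FreqL1 d n) : evalL n x f = invFourier d n f x := rfl

/-- The Fourier side of the translation group in the direction `y`. -/
def modul (n : ℕ) (y : Pos d) (t : ℝ) : FreqL1 d n →L[ℝ] FreqL1 d n :=
  mulOp volume fun k => scal n (chr (t • y) k)

theorem chr_smul_right (t : ℝ) (y k : Pos d) :
    chr (t • y) k = Complex.exp (Complex.I * (inner ℝ k y : ℝ) * t) := by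
  rw [chr, real_inner_smul_right]
  push_cast
  ring_nf

theorem invFourier_modul (f : FreqL1 d n) (x y : Pos d) (t : ℝ) :
    invFourier d n (modul n y t f) x = invFourier d n f (x + t • y) := by
  rw [invFourier_eq', invFourier_eq']
  congr 1
  refine integral_congr_ae ?_
  filter_upwards [coeFn_mulOp (isSymbol_chr (n := n) (t • y)) f] with k hk
  rw [modul, hk, scal_apply, smul_smul, chr, chr, chr, ← Complex.exp_add, inner_add_right]
  congr 2
  push_cast
  ring

theorem hasDerivAt_chr (y k : Pos d) (t : ℝ) : HasDerivAt (fun s : ℝ => scal n (chr (s • y) k))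
    ((scal n (Complex.I * (inner ℝ k y : ℝ))).comp (scal n (chr (t • y) k))) t := by
  have h1 : HasDerivAt (fun s : ℝ => Complex.exp (Complex.I * (inner ℝ k y : ℝ) * s))
      (Complex.exp (Complex.I * (inner ℝ k y : ℝ) * t) * (Complex.I * (inner ℝ k y : ℝ))) t := by
    have := ((hasDerivAt_id t).ofReal_comp.const_mul (Complex.I * (inner ℝ k y : ℝ))).cexp
    simpa using this
  simp only [chr_smul_right]
  refine (h1.smul_const (ContinuousLinearMap.id ℝ (CVec n))).congr_deriv ?_
  ext1 v
  simp [scal, smul_smul, mul_comm]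

theorem norm_scal_chr_le (x k : Pos d) : ‖scal n (chr x k)‖ ≤ 1 :=
  (norm_scal_le _).trans (norm_chr x k).le

theorem continuous_modul (y : Pos d) (f : FreqL1 d n) : Continuous fun t => modul n y t f :=
  continuous_mulOp_apply (fun t => isSymbol_chr (t • y)) (fun t k => norm_scal_chr_le (t • y) k)
    (fun k => continuous_iff_continuousAt.2 fun t => (hasDerivAt_chr y k t).continuousAt) f

theorem continuous_deriv_symbol (y : Pos d) :
    Continuous fun k : Pos d => scal n (Complex.I * (inner ℝ k y : ℝ)) := by
  refine continuous_scal.comp ?_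
  fun_prop

theorem hasDerivAt_cut_modul (y : Pos d) (r t : ℝ) (f : FreqL1 d n) :
    HasDerivAt (fun s => cut (CVec n) r (modul n y s f))
      (mulOp volume (fun k => ballInd r k • (scal n (Complex.I * (inner ℝ k y : ℝ))).comp
        (scal n (chr (t • y) k))) f) t := by
  have h := (hasDerivAt_mulOp_cut (fun s => isSymbol_chr (n := n) (s • y))
    (fun s k => norm_scal_chr_le (s • y) k) (continuous_deriv_symbol y)
    (fun s k => hasDerivAt_chr y k s) r t).clm_apply (hasDerivAt_const t f)
  simp only [modul, cut_mulOp (isSymbol_chr _)]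
  simpa using h

theorem inner_single (k : Pos d) (μ : Fin d) :
    (inner ℝ k (EuclideanSpace.single μ (1 : ℝ)) : ℝ) = k μ := by
  simp [EuclideanSpace.inner_single_right]

namespace Wiener

/-- Translation along the coordinate axis is the modulation group on the Fourier side, and the
derivative of that group at time zero is multiplication by $\mathrm ik_\mu$. It is taken after a
cutoff, where the generator is bounded. -/
theorem IsPartial.hat_eq {μ : Fin d} {f g : Wiener d n} (h : IsPartial μ f g) :
    ∀ᵐ k, hat g k = (Complex.I * k μ) • hat f k := by
  set e : Pos d := EuclideanSpace.single μ 1 with he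
  have hline : ∀ x t, HasDerivAt (fun s : ℝ => invFourier d n (hat f) (x + s • e))
      (invFourier d n (hat g) (x + t • e)) t := by
    intro x t
    have h1 : HasDerivAt (fun s : ℝ => f ((x + t • e) + s • e)) (g (x + t • e)) 0 := h (x + t • e)
    rw [show (0 : ℝ) = t - t by simp] at h1
    have h2 := h1.comp_sub_const t t
    rw [coe_eq] at h2
    refine h2.congr_of_eventuallyEq (Filter.Eventually.of_forall fun s => ?_)
    simp only [coe_eq, add_assoc, ← add_smul, add_sub_cancel]
  -- The fundamental theorem of calculus along each line, lifted to $L^1$ by injectivity of the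
  -- inverse Fourier transform.
  have hint : ∀ t, modul n e t (hat f) = hat f + (1 : ℝ) • ∫ s in (0 : ℝ)..t, modul n e s (hat g) := by
    intro t
    refine invFourier_ext fun x => ?_
    have hc := (continuous_modul e (hat g)).intervalIntegrable (μ := volume) 0 t
    rw [one_smul, map_add, Pi.add_apply, ← evalL_apply x (∫ s in (0 : ℝ)..t, modul n e s (hat g)),
      ← ContinuousLinearMap.intervalIntegral_comp_comm _ hc]
    simp only [evalL_apply, invFourier_modul]
    have hcont : Continuous fun s : ℝ => invFourier d n (hat g) (x + s • e) := by
      have h := (evalL n x).continuous.comp (continuous_modul e (hat g))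
      simpa only [Function.comp_def, evalL_apply, invFourier_modul] using h
    rw [intervalIntegral.integral_eq_sub_of_hasDerivAt (fun s _ => hline x s)
      (hcont.intervalIntegrable _ _)]
    simp
  have hcut : ∀ r : ℝ, cut (CVec n) r (hat g) = mulOp volume (fun k => ballInd r k •
      (scal n (Complex.I * (inner ℝ k e : ℝ))).comp (scal n (chr ((0 : ℝ) • e) k))) (hat f) := by
    intro r
    have h1 := hasDerivAt_cut_modul e r 0 (hat f)
    have h2 := (cut (CVec n) r).hasFDerivAt.comp_hasDerivAt (0 : ℝ)
      (hasDerivAt_add_smul_integral (continuous_modul e (hat g)) (hat f) 1 0)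
    simp only [Function.comp_def, ← hint] at h2
    have h3 := h2.unique h1
    rw [← h3, one_smul]
    congr 1
    refine invFourier_ext fun x => ?_
    rw [invFourier_modul]; simp
  have hsym : ∀ r : ℝ, IsSymbol volume (fun k => ballInd r k •
      (scal n (Complex.I * (inner ℝ k e : ℝ))).comp (scal n (chr ((0 : ℝ) • e) k))) := by
    intro r
    obtain ⟨C, hC⟩ := (isCompact_closedBall (0 : Pos d) r).exists_bound_of_continuousOn
      ((continuous_deriv_symbol (n := n) e).clm_comp (continuous_scal.comp
        (continuous_chr ((0 : ℝ) • e)))).continuousOn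
    exact IsSymbol.ballInd_smul ((continuous_deriv_symbol (n := n) e).clm_comp (continuous_scal.comp
        (continuous_chr ((0 : ℝ) • e)))).aestronglyMeasurable
        fun k hk => hC k (mem_closedBall_zero_iff.2 hk)
  have hall : ∀ᵐ k : Pos d, ∀ N : ℕ, ballInd (N : ℝ) k • hat g k = (ballInd (N : ℝ) k •
      (scal n (Complex.I * (inner ℝ k e : ℝ))).comp (scal n (chr ((0 : ℝ) • e) k))) (hat f k) := by
    rw [ae_all_iff]
    intro N
    filter_upwards [coeFn_cut (N : ℝ) (hat g), coeFn_mulOp (hsym N) (hat f)] with k h1 h2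
    rw [← h1, ← h2, hcut N]
  filter_upwards [hall] with k hk
  obtain ⟨N, hN⟩ := exists_nat_ge ‖k‖
  have := hk N
  rw [ballInd_of_le hN, one_smul, one_smul] at this
  rw [this, he, inner_single]
  simp [chr]

/-- The integrated translation identity is now obtained from the multiplier, after cutoffs. Point
evaluation of the resulting curve in $L^1$ gives the line derivative. -/
theorem isPartial_of_hat_eq {μ : Fin d} {f g : Wiener d n}
    (h : ∀ᵐ k, hat g k = (Complex.I * k μ) • hat f k) : IsPartial μ f g := by
  set e : Pos d := EuclideanSpace.single μ 1 with he
  have hint : ∀ t, modul n e t (hat f) =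
      hat f + (1 : ℝ) • ∫ s in (0 : ℝ)..t, modul n e s (hat g) := by
    intro t
    refine eq_of_cut_eq fun N => ?_
    have hc := (continuous_modul e (hat g))
    rw [one_smul, map_add,
      ← ContinuousLinearMap.intervalIntegral_comp_comm _ (hc.intervalIntegrable 0 t)]
    have hd : ∀ s, HasDerivAt (fun s => cut (CVec n) (N : ℝ) (modul n e s (hat f)))
        (cut (CVec n) (N : ℝ) (modul n e s (hat g))) s := by
      intro s
      refine (hasDerivAt_cut_modul e N s (hat f)).congr_deriv ?_
      obtain ⟨C, hC⟩ := (isCompact_closedBall (0 : Pos d) N).exists_bound_of_continuousOn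
        ((continuous_deriv_symbol (n := n) e).clm_comp (continuous_scal.comp
          (continuous_chr (s • e)))).continuousOn
      refine mulOp_eq_of_ae (IsSymbol.ballInd_smul ((continuous_deriv_symbol (n := n) e).clm_comp
        (continuous_scal.comp (continuous_chr (s • e)))).aestronglyMeasurable
        fun k hk => hC k (mem_closedBall_zero_iff.2 hk)) ?_
      filter_upwards [coeFn_cut (N : ℝ) (modul n e s (hat g)),
        coeFn_mulOp (isSymbol_chr (n := n) (s • e)) (hat g), h] with k h1 h2 h3
      rw [h1, modul, h2, h3, ← inner_single k μ]
      simp [smul_smul, mul_comm, he]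
    rw [intervalIntegral.integral_eq_sub_of_hasDerivAt (fun s _ => hd s)
      (((cut (CVec n) (N : ℝ)).continuous.comp hc).intervalIntegrable _ _)]
    have h0 : modul n e 0 (hat f) = hat f := by
      refine invFourier_ext fun x => ?_
      rw [invFourier_modul]; simp
    rw [h0]; abel
  intro x
  have h1 := (evalL n x).hasFDerivAt.comp_hasDerivAt (0 : ℝ)
      (hasDerivAt_add_smul_integral (continuous_modul e (hat g)) (hat f) 1 0)
  simp only [Function.comp_def, ← hint, evalL_apply, invFourier_modul] at h1
  rw [HasLineDerivAt]
  simp only [coe_eq]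
  refine h1.congr_deriv ?_
  simp [invFourier_modul]

end Wiener

end Partial

namespace FriedrichsSystem

variable {d n : ℕ} (S : FriedrichsSystem d n)

/-! ### The generator of the evolution -/

/-- A bound for the matrices `A(β)` with `|β| ≤ 1`. -/
def symbolBound : ℝ := ∑ μ, ‖Matrix.toEuclideanCLM (n := Fin n) (𝕜 := ℂ) (S.AC μ)‖

theorem symbolBound_nonneg : 0 ≤ S.symbolBound := Finset.sum_nonneg fun _ _ => norm_nonneg _

theorem norm_act_symbol_le (β : Pos d) (v : CVec n) :
    ‖act (S.symbol β) v‖ ≤ S.symbolBound * ‖β‖ * ‖v‖ := by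
  rw [act_symbol, symbolBound, Finset.sum_mul, Finset.sum_mul]
  refine norm_sum_le_of_le _ fun μ _ => ?_
  rw [norm_smul, Complex.norm_real, mul_comm _ ‖β‖, mul_assoc]
  exact mul_le_mul (PiLp.norm_apply_le β μ) (ContinuousLinearMap.le_opNorm _ _) (norm_nonneg _)
    (norm_nonneg _)

/-- The constant depends on `ε`. It serves only for measurability, boundedness of symbols and
differentiability, and never enters the uniform estimates. -/
theorem exists_norm_propGen_le (ε α : ℝ) (β : Pos d) :
    ∃ C, 0 ≤ C ∧ ∀ k, ‖S.propGen ε α β k‖ ≤ C * (1 + ‖k‖) := by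
  set e := ‖((1 / ε : ℝ) : ℂ)‖ * ‖Matrix.toEuclideanCLM (n := Fin n) (𝕜 := ℂ) S.EC‖ with he
  have hs := S.symbolBound_nonneg
  refine ⟨S.symbolBound + S.symbolBound * ‖ε⁻¹ • β‖ + e + ‖Complex.I * α / ε‖, by positivity,
    fun k => ContinuousLinearMap.opNorm_le_bound _ (by positivity) fun v => ?_⟩
  have h1 : S.propGen ε α β k v = (Complex.I • act (S.symbol (k + ε⁻¹ • β)) v +
      ((1 / ε : ℝ) : ℂ) • act S.EC v) - (Complex.I * α / ε) • v := by
    rw [← generator_apply]; rfl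
  have h2 : ‖act (S.symbol (k + ε⁻¹ • β)) v‖ ≤ S.symbolBound * (‖k‖ + ‖ε⁻¹ • β‖) * ‖v‖ :=
    (S.norm_act_symbol_le _ v).trans (by gcongr; exact norm_add_le _ _)
  have h3 : ‖((1 / ε : ℝ) : ℂ) • act S.EC v‖ ≤ e * ‖v‖ := by
    rw [norm_smul, he, mul_assoc]
    exact mul_le_mul_of_nonneg_left (ContinuousLinearMap.le_opNorm _ _) (norm_nonneg _)
  have h4 : ‖S.propGen ε α β k v‖ ≤ S.symbolBound * (‖k‖ + ‖ε⁻¹ • β‖) * ‖v‖ + e * ‖v‖ +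
      ‖Complex.I * α / ε‖ * ‖v‖ := by
    rw [h1]
    refine (norm_sub_le _ _).trans (add_le_add ((norm_add_le _ _).trans (add_le_add ?_ h3))
      (norm_smul_le _ _))
    rwa [norm_smul, Complex.norm_I, one_mul]
  refine h4.trans ?_
  have : 0 ≤ (S.symbolBound + (S.symbolBound * ‖ε⁻¹ • β‖ + e + ‖Complex.I * α / ε‖) * ‖k‖) * ‖v‖ := by
    positivity
  nlinarith

theorem continuous_propGen (ε α : ℝ) (β : Pos d) : Continuous (S.propGen ε α β) := by
  have h1 : Continuous fun k : Pos d =>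
      Complex.I • S.symbol k + ((1 / ε : ℝ) : ℂ) • S.EC := by
    unfold symbol; fun_prop
  have h2 : Continuous (Matrix.toEuclideanCLM (n := Fin n) (𝕜 := ℂ)) :=
    LinearMap.continuous_of_finiteDimensional
      ((Matrix.toEuclideanCLM (n := Fin n) (𝕜 := ℂ)).toAlgEquiv.toLinearMap)
  have h3 : Continuous (S.generator ε) := h2.comp h1
  have h4 : Continuous fun k : Pos d => S.generator ε (k + ε⁻¹ • β) := h3.comp (by fun_prop)
  exact ((ContinuousLinearMap.restrictScalarsL ℂ (CVec n) (CVec n) ℝ ℝ).continuous.comp h4).sub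
    continuous_const

/-- Both sides come from differentiating the group law `prop (t + s) = prop t ∘ prop s` at `s = 0`.
-/
theorem prop_comp_propGen (ε α : ℝ) (β : Pos d) (t : ℝ) (k : Pos d) :
    (S.prop ε α β t k).comp (S.propGen ε α β k) = (S.propGen ε α β k).comp (S.prop ε α β t k) := by
  have h1 : HasDerivAt (fun s => S.prop ε α β (t + s) k)
      (-((S.propGen ε α β k).comp (S.prop ε α β t k))) 0 := by
    have := (S.hasDerivAt_prop ε α β (t + 0) k).comp_const_add t 0
    simpa using this
  have h2 : HasDerivAt (fun s => (S.prop ε α β t k).comp (S.prop ε α β s k))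
      ((S.prop ε α β t k).comp (-((S.propGen ε α β k).comp (S.prop ε α β 0 k)))) 0 :=
    (ContinuousLinearMap.compL ℝ (CVec n) (CVec n) (CVec n)
      (S.prop ε α β t k)).hasFDerivAt.comp_hasDerivAt 0 (S.hasDerivAt_prop ε α β 0 k)
  simp only [← prop_add] at h2
  have h3 := h1.unique h2
  rw [prop_zero, ContinuousLinearMap.comp_id, ContinuousLinearMap.comp_neg, neg_inj] at h3
  exact h3.symm

theorem hasDerivAt_cut_evol (ε α : ℝ) (β : Pos d) (r t : ℝ) :
    HasDerivAt (fun s => mulOp volume fun k => ballInd r k • S.prop ε α β s k)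
      (mulOp volume fun k => ballInd r k • (-(S.propGen ε α β k)).comp (S.prop ε α β t k)) t :=
  hasDerivAt_mulOp_cut (S.isSymbol_prop ε α β) (S.norm_prop_le ε α β)
    (S.continuous_propGen ε α β).neg
    (fun t k => (S.hasDerivAt_prop ε α β t k).congr_deriv
      (ContinuousLinearMap.neg_comp (S.propGen ε α β k) _).symm) r t

theorem isSymbol_cut_gen (ε α : ℝ) (β : Pos d) (r t : ℝ) :
    IsSymbol volume fun k => ballInd r k • (S.propGen ε α β k).comp (S.prop ε α β t k) := by
  obtain ⟨C, hC0, hC⟩ := S.exists_norm_propGen_le ε α β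
  refine IsSymbol.ballInd_smul (C := C * (1 + r)) ((S.continuous_propGen ε α β).clm_comp
    (S.continuous_prop ε α β t)).aestronglyMeasurable fun k hk => ?_
  refine (ContinuousLinearMap.opNorm_comp_le _ _).trans ?_
  refine (mul_le_of_le_one_right (norm_nonneg _) (S.norm_prop_le ε α β t k)).trans ((hC k).trans ?_)
  gcongr

/-- Duhamel's formula for a differentiable function. -/
theorem evol_neg_eq_of_hasDerivAt (ε α : ℝ) (β : Pos d) {τ : ℝ} {f D F : ℝ → FreqL1 d n}
    (hf : ContinuousOn f (Icc 0 τ)) (hF : Continuous F)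
    (hd : ∀ t ∈ Ioo 0 τ, HasDerivAt f (D t) t)
    (hD : ∀ t ∈ Ioo 0 τ, ∀ᵐ k, D t k = F t k - S.propGen ε α β k (f t k)) :
    ∀ t ∈ Icc 0 τ, S.evol ε α β (-t) (f t) = f 0 + ∫ s in (0 : ℝ)..t, S.evol ε α β (-s) (F s) := by
  intro t ht
  -- After the cutoff the backward evolution is norm differentiable, the product rule applies, and
  -- the two generator terms cancel.
  refine eq_of_cut_eq fun N => ?_
  have hFc := S.continuous_evol_neg_apply ε α β hF
  rw [map_add, ← ContinuousLinearMap.intervalIntegral_comp_comm _ (hFc.intervalIntegrable 0 t)]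
  have hcut : ∀ s g, cut (CVec n) (N : ℝ) (S.evol ε α β s g) =
      mulOp volume (fun k => ballInd (N : ℝ) k • S.prop ε α β s k) g := fun s g =>
    cut_mulOp (S.isSymbol_prop ε α β s) _ _
  have hop : ∀ s, HasDerivAt (fun s => mulOp volume fun k => ballInd (N : ℝ) k • S.prop ε α β (-s) k)
      (mulOp volume fun k => ballInd (N : ℝ) k • (S.propGen ε α β k).comp (S.prop ε α β (-s) k)) s := by
    intro s
    have h := (S.hasDerivAt_cut_evol ε α β N (-s)).scomp s (hasDerivAt_neg s)
    refine h.congr_deriv ?_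
    rw [neg_one_smul, ← mulOp_neg]
    · congr 1
      funext k
      rw [ContinuousLinearMap.neg_comp, smul_neg, neg_neg]
    · simpa only [ContinuousLinearMap.neg_comp, smul_neg] using
        (S.isSymbol_cut_gen ε α β N (-s)).neg
  have hderiv : ∀ s ∈ Ioo 0 t, HasDerivAt
      (fun s => cut (CVec n) (N : ℝ) (S.evol ε α β (-s) (f s)))
      (cut (CVec n) (N : ℝ) (S.evol ε α β (-s) (F s))) s := by
    intro s hs
    have hs' : s ∈ Ioo 0 τ := ⟨hs.1, hs.2.trans_le ht.2⟩
    simp only [hcut]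
    refine ((hop s).clm_apply (hd s hs')).congr_deriv ?_
    rw [← hcut, ← hcut]
    refine Lp.ext ?_
    filter_upwards [coeFn_cut (N : ℝ) (S.evol ε α β (-s) (F s)),
      coeFn_cut (N : ℝ) (S.evol ε α β (-s) (D s)), coeFn_mulOp (S.isSymbol_prop ε α β (-s)) (F s),
      coeFn_mulOp (S.isSymbol_prop ε α β (-s)) (D s),
      coeFn_mulOp (S.isSymbol_cut_gen ε α β N (-s)) (f s), hD s hs', Lp.coeFn_add
        (mulOp volume (fun k => ballInd (N : ℝ) k • (S.propGen ε α β k).comp (S.prop ε α β (-s) k))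
          (f s)) (cut (CVec n) (N : ℝ) (S.evol ε α β (-s) (D s)))] with k h1 h2 h3 h4 h5 h6 h7
    rw [h7, Pi.add_apply, h5, h2, h1, evol, h3, h4, h6, map_sub, ← prop_comp_propGen]
    simp [smul_sub]
  have hcont : ContinuousOn (fun s => cut (CVec n) (N : ℝ) (S.evol ε α β (-s) (f s))) (Icc 0 t) := by
    have h1 : ContinuousOn (fun s => mulOp volume fun k => ballInd (N : ℝ) k • S.prop ε α β (-s) k)
        (Icc 0 t) := fun s _ => (hop s).continuousAt.continuousWithinAt
    simp only [hcut]
    exact h1.clm_apply (hf.mono (Icc_subset_Icc_right ht.2))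
  rw [intervalIntegral.integral_eq_sub_of_hasDerivAt_of_le ht.1 hcont hderiv
    (((cut (CVec n) (N : ℝ)).continuous.comp hFc).intervalIntegrable _ _), neg_zero, evol_zero]
  abel

/-- Differentiability of `m(D) evol(t) V(t)` for smoothing multipliers `m` and a primitive `V` of
a continuous function. -/
theorem hasDerivAt_mulOp_evol (ε α : ℝ) (β : Pos d) {m : Pos d → CVec n →L[ℝ] CVec n}
    (hm : IsSymbol volume m) (hmG : IsSymbol volume fun k => (m k).comp (S.propGen ε α β k))
    {F : ℝ → FreqL1 d n} (hF : Continuous F) {V : ℝ → FreqL1 d n}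
    (hV : ∀ t, HasDerivAt V (F t) t) (t : ℝ) :
    HasDerivAt (fun s => mulOp volume m (S.evol ε α β s (V s)))
      (mulOp volume m (S.evol ε α β t (F t)) -
        mulOp volume (fun k => (m k).comp (S.propGen ε α β k)) (S.evol ε α β t (V t))) t := by
  have hVc : Continuous V := continuous_iff_continuousAt.2 fun s => (hV s).continuousAt
  set R : ℝ → FreqL1 d n := fun t => mulOp volume m (S.evol ε α β t (F t)) -
        mulOp volume (fun k => (m k).comp (S.propGen ε α β k)) (S.evol ε α β t (V t)) with hR
  have hRc : Continuous R :=
    ((mulOp volume m).continuous.comp (S.continuous_evol_apply ε α β hF)).sub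
      ((mulOp volume _).continuous.comp (S.continuous_evol_apply ε α β hVc))
  -- The evolution alone is only strongly continuous. The integrated identity is proved on bounded
  -- frequencies; its integrand `R` is continuous without a cutoff because `m` absorbs the
  -- generator, so the integral may be differentiated.
  have key : ∀ t, mulOp volume m (S.evol ε α β t (V t)) =
      mulOp volume m (V 0) + (1 : ℝ) • ∫ s in (0 : ℝ)..t, R s := by
    intro t
    refine eq_of_cut_eq fun N => ?_
    rw [one_smul, map_add,
      ← ContinuousLinearMap.intervalIntegral_comp_comm _ (hRc.intervalIntegrable 0 t)]
    have hcut : ∀ s g, cut (CVec n) (N : ℝ) (mulOp volume m (S.evol ε α β s g)) =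
        mulOp volume m (mulOp volume (fun k => ballInd (N : ℝ) k • S.prop ε α β s k) g) := by
      intro s g
      rw [cut_mulOp hm, ← mulOp_cut hm, evol, cut_mulOp (S.isSymbol_prop ε α β s)]
    have hderiv : ∀ s, HasDerivAt
        (fun s => cut (CVec n) (N : ℝ) (mulOp volume m (S.evol ε α β s (V s))))
        (cut (CVec n) (N : ℝ) (R s)) s := by
      intro s
      simp only [hcut]
      refine ((mulOp volume m).hasFDerivAt.comp_hasDerivAt s
        ((S.hasDerivAt_cut_evol ε α β N s).clm_apply (hV s))).congr_deriv ?_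
      have h0 := (S.isSymbol_cut_gen ε α β N s)
      have h1 : (mulOp volume fun k => ballInd (N : ℝ) k •
          (-(S.propGen ε α β k)).comp (S.prop ε α β s k)) (V s) = -(mulOp volume (fun k =>
            ballInd (N : ℝ) k • (S.propGen ε α β k).comp (S.prop ε α β s k)) (V s)) := by
        simp only [ContinuousLinearMap.neg_comp, smul_neg]
        rw [mulOp_neg h0]; rfl
      have h2 : mulOp volume m (mulOp volume (fun k =>
            ballInd (N : ℝ) k • (S.propGen ε α β k).comp (S.prop ε α β s k)) (V s)) =
          cut (CVec n) (N : ℝ) (mulOp volume (fun k => (m k).comp (S.propGen ε α β k))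
            (S.evol ε α β s (V s))) := by
        rw [cut_mulOp hmG, evol, mulOp_comp hm h0]
        refine mulOp_eq_of_ae (hm.comp h0) ?_
        have h3 : IsSymbol volume fun k => ballInd (N : ℝ) k • (m k).comp (S.propGen ε α β k) := by
          obtain ⟨C, hC⟩ := hmG.bdd
          exact IsSymbol.ballInd_smul hmG.meas fun k _ => hC k
        filter_upwards [coeFn_mulOp h3 (mulOp volume (S.prop ε α β s) (V s)),
          coeFn_mulOp (S.isSymbol_prop ε α β s) (V s)] with k e1 e2
        rw [e1, e2]
        simp
      rw [map_add, h1, map_neg, h2, ← hcut, hR, map_sub]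
      abel
    rw [intervalIntegral.integral_eq_sub_of_hasDerivAt (fun s _ => hderiv s)
      (((cut (CVec n) (N : ℝ)).continuous.comp hRc).intervalIntegrable _ _), evol_zero]
    abel
  simp only [key]
  simpa only [one_smul] using hasDerivAt_add_smul_integral hRc (mulOp volume m (V 0)) 1 t

end FriedrichsSystem

theorem IsTri.comp {U V W Z U' V' W' : Type*} [NormedAddCommGroup U] [NormedSpace ℝ U]
    [NormedAddCommGroup V] [NormedSpace ℝ V] [NormedAddCommGroup W] [NormedSpace ℝ W]
    [NormedAddCommGroup Z] [NormedSpace ℝ Z] [NormedAddCommGroup U'] [NormedSpace ℝ U']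
    [NormedAddCommGroup V'] [NormedSpace ℝ V'] [NormedAddCommGroup W'] [NormedSpace ℝ W']
    {B : U → V → W → Z} (hB : IsTri B) (P : U' →L[ℝ] U) (Q : V' →L[ℝ] V) (R : W' →L[ℝ] W) :
    IsTri fun a b c => B (P a) (Q b) (R c) := by
  obtain ⟨T, hT⟩ := hB
  exact ⟨(ContinuousLinearMap.compL ℝ V' (W →L[ℝ] Z) (W' →L[ℝ] Z)
    ((ContinuousLinearMap.compL ℝ W' W Z).flip R)).comp (T.bilinearComp P Q),
    fun a b c => hT _ _ _⟩

variable {d n : ℕ}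

/-! ### Two derivatives in `L¹` -/

/-- The weight `1 + |k|²`. -/
def wt (k : Pos d) : ℝ := 1 + ‖k‖ ^ 2

theorem one_le_wt (k : Pos d) : 1 ≤ wt k := le_add_of_nonneg_right (sq_nonneg _)

theorem wt_pos (k : Pos d) : 0 < wt k := zero_lt_one.trans_le (one_le_wt k)

theorem continuous_wt : Continuous (wt (d := d)) := by unfold wt; fun_prop

theorem norm_le_wt (k : Pos d) : ‖k‖ ≤ wt k := by
  unfold wt; nlinarith [sq_nonneg (‖k‖ - 1), norm_nonneg k]

theorem one_add_norm_le_wt (k : Pos d) : 1 + ‖k‖ ≤ 2 * wt k := by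
  unfold wt; nlinarith [sq_nonneg (‖k‖ - 1), norm_nonneg k]

theorem wt_eq (k : Pos d) : wt k = 1 + ∑ μ, k μ ^ 2 := by
  rw [wt, EuclideanSpace.real_norm_sq_eq]

/-- The symbol of `(1 - Δ)⁻¹`. -/
def smSymbol (n : ℕ) (k : Pos d) : CVec n →L[ℝ] CVec n := (wt k)⁻¹ • ContinuousLinearMap.id ℝ _

theorem smSymbol_apply (k : Pos d) (v : CVec n) : smSymbol n k v = (wt k)⁻¹ • v := rfl

theorem norm_smSymbol_le (k : Pos d) : ‖smSymbol n k‖ ≤ (wt k)⁻¹ := by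
  refine (norm_smul_le _ _).trans ?_
  rw [Real.norm_of_nonneg (inv_nonneg.2 (wt_pos k).le)]
  exact mul_le_of_le_one_right (inv_nonneg.2 (wt_pos k).le) ContinuousLinearMap.norm_id_le

theorem norm_smSymbol_le_one (k : Pos d) : ‖smSymbol n k‖ ≤ 1 :=
  (norm_smSymbol_le k).trans (inv_le_one_of_one_le₀ (one_le_wt k))

theorem continuous_smSymbol : Continuous (smSymbol (d := d) n) :=
  (continuous_wt.inv₀ fun k => (wt_pos k).ne').smul continuous_const

theorem isSymbol_smSymbol : IsSymbol volume (smSymbol (d := d) n) :=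
  ⟨continuous_smSymbol.aestronglyMeasurable, 1, norm_smSymbol_le_one⟩

/-- The operator `(1 - Δ)⁻¹` on the Fourier side. -/
def sm (d n : ℕ) : FreqL1 d n →L[ℝ] FreqL1 d n := mulOp volume (smSymbol n)

theorem coeFn_sm (f : FreqL1 d n) : sm d n f =ᵐ[volume] fun k => (wt k)⁻¹ • f k :=
  coeFn_mulOp isSymbol_smSymbol f

theorem norm_sm_le (f : FreqL1 d n) : ‖sm d n f‖ ≤ ‖f‖ :=
  (norm_mulOp_apply_le zero_le_one norm_smSymbol_le_one f).trans_eq (one_mul _)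

theorem sm_injective : Function.Injective (sm d n) := by
  intro f g h
  refine Lp.ext ?_
  filter_upwards [coeFn_sm f, coeFn_sm g] with k h1 h2
  rw [h, h2] at h1
  exact (smul_right_injective _ (inv_ne_zero (wt_pos k).ne') h1).symm

theorem bar_sm (f : FreqL1 d n) : bar d n (sm d n f) = sm d n (bar d n f) := by
  refine Lp.ext ?_
  filter_upwards [coeFn_bar (sm d n f), ae_neg (coeFn_sm f), coeFn_sm (bar d n f), coeFn_bar f]
    with k h1 h2 h3 h4
  rw [h1, h2, h3, h4, ← conjL_apply, map_smul, conjL_apply]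
  simp [wt]

/-- If `h μ` is the transform of $\partial_\mu^2p$, then `p - ∑ μ, h μ` is that of $(1-\Delta)p$. -/
theorem sm_sub_sum {p : FreqL1 d n} {h : Fin d → FreqL1 d n}
    (hh : ∀ μ, ∀ᵐ k, h μ k = -(((k μ) ^ 2 : ℝ) • p k)) : sm d n (p - ∑ μ, h μ) = p := by
  refine mulOp_eq_of_ae isSymbol_smSymbol ?_
  have h1 : ∀ᵐ k, ∀ μ, h μ k = -(((k μ) ^ 2 : ℝ) • p k) := ae_all_iff.2 hh
  have h2 : ∀ᵐ k, (∑ μ, h μ : FreqL1 d n) k = ∑ μ, h μ k := by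
    filter_upwards [Lp.coeFn_finsetSum Finset.univ h] with k hk
    rw [hk, Finset.sum_apply]
  filter_upwards [h1, h2, Lp.coeFn_sub p (∑ μ, h μ)] with k e1 e2 e3
  rw [e3, Pi.sub_apply, e2, smSymbol_apply, Finset.sum_congr rfl fun μ _ => e1 μ,
    Finset.sum_neg_distrib, sub_neg_eq_add, ← Finset.sum_smul]
  nth_rewrite 2 [← one_smul ℝ (p k)]
  rw [← add_smul, ← wt_eq, smul_smul, inv_mul_cancel₀ (wt_pos k).ne', one_smul]

theorem Wiener.IsPartial.hat_eq_sq {μ : Fin d} {f g h : Wiener d n} (h1 : Wiener.IsPartial μ f g)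
    (h2 : Wiener.IsPartial μ g h) : ∀ᵐ k, h.hat k = -(((k μ) ^ 2 : ℝ) • f.hat k) := by
  filter_upwards [h1.hat_eq, h2.hat_eq] with k e1 e2
  rw [e2, e1, smul_smul, FriedrichsSystem.coe_smul_vec, ← neg_smul]
  congr 1
  push_cast
  linear_combination (k μ : ℂ) ^ 2 * Complex.I_sq

/-- Membership in $W^2$ is used in this form: the function is $(1-\Delta)^{-1}$ of something with
integrable transform. Only the unmixed second derivatives are needed. -/
theorem Wiener.MemW.exists_sm_eq {p : Wiener d n} (hp : Wiener.MemW 2 p) :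
    ∃ P : FreqL1 d n, sm d n P = p.hat := by
  choose g hg hg' using hp
  choose h hh _ using fun μ => hg' μ μ
  exact ⟨_, sm_sub_sum fun μ => (hg μ).hat_eq_sq (hh μ)⟩

namespace FriedrichsSystem

variable (S : FriedrichsSystem d n)

theorem sm_evol (ε α : ℝ) (β : Pos d) (t : ℝ) (f : FreqL1 d n) :
    sm d n (S.evol ε α β t f) = S.evol ε α β t (sm d n f) := by
  refine Lp.ext ?_
  filter_upwards [coeFn_sm (S.evol ε α β t f), coeFn_mulOp (S.isSymbol_prop ε α β t) f,
    coeFn_mulOp (S.isSymbol_prop ε α β t) (sm d n f), coeFn_sm f] with k h1 h2 h3 h4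
  rw [h1, evol, h2, h3, h4, map_smul]

/-! ### The nonlinearity in the weighted space -/

/-- The symbol relating the weight of a sum of frequencies to the sum of the weights. -/
def wtQuot (z : Pos3 d) : ℝ := wt (sum3 z) / (wt z.1 + wt z.2.1 + wt z.2.2)

theorem wtQuot_nonneg (z : Pos3 d) : 0 ≤ wtQuot z := by
  have := wt_pos (sum3 z); have := wt_pos z.1; have := wt_pos z.2.1; have := wt_pos z.2.2
  unfold wtQuot; positivity

/-- This is $|a+b+c|^2\le3(|a|^2+|b|^2+|c|^2)$; it makes the weighted space an algebra. -/
theorem wtQuot_le (z : Pos3 d) : wtQuot z ≤ 3 := by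
  have h1 := wt_pos z.1; have h2 := wt_pos z.2.1; have h3 := wt_pos z.2.2
  rw [wtQuot, div_le_iff₀ (by positivity)]
  have h : ‖sum3 z‖ ≤ ‖z.1‖ + ‖z.2.1‖ + ‖z.2.2‖ := by
    rw [sum3, ← add_assoc]; exact norm_add₃_le
  have h' : ‖sum3 z‖ ^ 2 ≤ (‖z.1‖ + ‖z.2.1‖ + ‖z.2.2‖) ^ 2 := by gcongr
  unfold wt
  nlinarith [sq_nonneg (‖z.1‖ - ‖z.2.1‖), sq_nonneg (‖z.1‖ - ‖z.2.2‖),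
    sq_nonneg (‖z.2.1‖ - ‖z.2.2‖)]

theorem continuous_wtQuot : Continuous (wtQuot (d := d)) := by
  have h : Continuous (sum3 (d := d)) := by unfold sum3; fun_prop
  refine (continuous_wt.comp h).div (((continuous_wt.comp continuous_fst).add
    (continuous_wt.comp (continuous_fst.comp continuous_snd))).add
    (continuous_wt.comp (continuous_snd.comp continuous_snd))) fun z => ?_
  have h1 := wt_pos z.1; have h2 := wt_pos z.2.1; have h3 := wt_pos z.2.2
  exact (by positivity : 0 < wt z.1 + wt z.2.1 + wt z.2.2).ne'

theorem norm_wtQuot_le (z : Pos3 d) : ‖wtQuot z • ContinuousLinearMap.id ℝ (CVec n)‖ ≤ 3 := by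
  refine (norm_smul_le _ _).trans ?_
  rw [Real.norm_of_nonneg (wtQuot_nonneg z)]
  exact (mul_le_of_le_one_right (wtQuot_nonneg z) ContinuousLinearMap.norm_id_le).trans (wtQuot_le z)

theorem isSymbol_wtQuot : IsSymbol (volume : Measure (Pos3 d)) fun z =>
    wtQuot z • ContinuousLinearMap.id ℝ (CVec n) :=
  ⟨(continuous_wtQuot.smul continuous_const).aestronglyMeasurable, 3, norm_wtQuot_le⟩

/-- The function `F` with `(1 - Δ)⁻¹ F = T((1 - Δ)⁻¹ f, (1 - Δ)⁻¹ g, (1 - Δ)⁻¹ h)`. -/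
def Tsm (f g h : FreqL1 d n) : FreqL1 d n :=
  fourierConst d ^ 2 • push (CVec n) d (mulOp volume
    (fun z => wtQuot z • ContinuousLinearMap.id ℝ (CVec n))
      (tri3 S.TL f (sm d n g) (sm d n h) + tri3 S.TL (sm d n f) g (sm d n h) +
        tri3 S.TL (sm d n f) (sm d n g) h))

theorem isTri_Tsm : IsTri S.Tsm :=
  (((((isTri_tri3 S.TL).comp (.id ℝ _) (sm d n) (sm d n)).add
    ((isTri_tri3 S.TL).comp (sm d n) (.id ℝ _) (sm d n))).add
    ((isTri_tri3 S.TL).comp (sm d n) (sm d n) (.id ℝ _))).post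
      (mulOp volume (fun z => wtQuot z • ContinuousLinearMap.id ℝ (CVec n)))).post
        (fourierConst d ^ 2 • push (CVec n) d)

/-- For weights $w_i$ of the three frequencies, the three terms carry the reciprocal weights
$1/(w_2w_3)$, $1/(w_1w_3)$, $1/(w_1w_2)$, with sum $(w_1+w_2+w_3)/(w_1w_2w_3)$. The factor `wtQuot`
and the outer smoothing turn this into $1/(w_1w_2w_3)$. -/
theorem sm_Tsm (f g h : FreqL1 d n) :
    sm d n (S.Tsm f g h) = S.That (sm d n f) (sm d n g) (sm d n h) := by
  rw [Tsm, map_smul, sm, mulOp_push isSymbol_smSymbol, ← sm, That_apply]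
  congr 2
  refine mulOp_eq_of_ae isSymbol_smSymbol.comp_sum3 ?_
  set A := tri3 S.TL f (sm d n g) (sm d n h)
  set B := tri3 S.TL (sm d n f) g (sm d n h)
  set C := tri3 S.TL (sm d n f) (sm d n g) h
  filter_upwards [coeFn_tri3 S.TL (sm d n f) (sm d n g) (sm d n h),
    coeFn_tri3 S.TL f (sm d n g) (sm d n h), coeFn_tri3 S.TL (sm d n f) g (sm d n h),
    coeFn_tri3 S.TL (sm d n f) (sm d n g) h, coeFn_mulOp isSymbol_wtQuot (A + B + C),
    Lp.coeFn_add (A + B) C, Lp.coeFn_add A B, ae_fst3 (coeFn_sm f), ae_snd3 (coeFn_sm g),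
    ae_trd3 (coeFn_sm h)] with z h1 h2 h3 h4 h5 h6 h7 h8 h9 h10
  rw [h5, h6, Pi.add_apply, h7, Pi.add_apply, h1, h2, h3, h4, h8, h9, h10, smSymbol_apply]
  have e1 := wt_pos z.1; have e2 := wt_pos z.2.1; have e3 := wt_pos z.2.2
  have e4 := wt_pos (sum3 z)
  simp only [map_smul, smul_apply, ContinuousLinearMap.id_apply, smul_smul, ← add_smul]
  congr 1
  rw [wtQuot]
  field_simp

/-- Each term has a single factor without smoothing. The weighted norm thus enters linearly and
cannot blow up while the norm in $W$ is bounded. -/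
theorem norm_Tsm_le {C : ℝ} (hC : ∀ x y z, ‖S.TL x y z‖ ≤ C * (‖x‖ * ‖y‖ * ‖z‖))
    (f g h : FreqL1 d n) : ‖S.Tsm f g h‖ ≤ 3 * (C * (‖f‖ * ‖sm d n g‖ * ‖sm d n h‖) +
      C * (‖sm d n f‖ * ‖g‖ * ‖sm d n h‖) + C * (‖sm d n f‖ * ‖sm d n g‖ * ‖h‖)) := by
  rw [Tsm, norm_smul]
  have hc : ‖fourierConst d ^ 2‖ ≤ 1 := by
    rw [norm_pow, Real.norm_of_nonneg (fourierConst_pos d).le]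
    exact pow_le_one₀ (fourierConst_pos d).le (fourierConst_le_one d)
  refine (mul_le_of_le_one_left (norm_nonneg _) hc).trans ((norm_push_le _).trans ?_)
  refine (norm_mulOp_apply_le (by norm_num) norm_wtQuot_le _).trans ?_
  gcongr
  exact norm_add₃_le.trans (add_le_add_three (norm_tri3_le hC _ _ _) (norm_tri3_le hC _ _ _)
    (norm_tri3_le hC _ _ _))

theorem norm_That_le {C : ℝ} (hC : ∀ x y z, ‖S.TL x y z‖ ≤ C * (‖x‖ * ‖y‖ * ‖z‖))
    (f g h : FreqL1 d n) : ‖S.That f g h‖ ≤ C * (‖f‖ * ‖g‖ * ‖h‖) := by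
  rw [That_apply, norm_smul]
  have hc : ‖fourierConst d ^ 2‖ ≤ 1 := by
    rw [norm_pow, Real.norm_of_nonneg (fourierConst_pos d).le]
    exact pow_le_one₀ (fourierConst_pos d).le (fourierConst_le_one d)
  exact (mul_le_of_le_one_left (norm_nonneg _) hc).trans ((norm_push_le _).trans
    (norm_tri3_le hC _ _ _))

/-- The cubic nonlinearity `B(f,f,f̄) + B(f,f̄,f) + B(f̄,f,f)` of the envelope equation. -/
def envCubic (B : FreqL1 d n → FreqL1 d n → FreqL1 d n → FreqL1 d n) (f : FreqL1 d n) :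
    FreqL1 d n :=
  B f f (bar d n f) + B f (bar d n f) f + B (bar d n f) f f

theorem isCubic_envCubic {B : FreqL1 d n → FreqL1 d n → FreqL1 d n → FreqL1 d n} (hB : IsTri B)
    {C : ℝ} (hC0 : 0 ≤ C) (hC : ∀ f g h, ‖B f g h‖ ≤ C * (‖f‖ * ‖g‖ * ‖h‖)) :
    IsCubic (C + C + C) (envCubic B) :=
  have hid : ∀ f : FreqL1 d n, ‖ContinuousLinearMap.id ℝ _ f‖ ≤ ‖f‖ := fun _ => le_rfl
  have hbar : ∀ f : FreqL1 d n, ‖bar d n f‖ ≤ ‖f‖ := fun f => (norm_bar f).le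
  ((hB.isCubic hC0 hC (.id ℝ _) (.id ℝ _) (bar d n) hid hid hbar).add
    (hB.isCubic hC0 hC (.id ℝ _) (bar d n) (.id ℝ _) hid hbar hid)).add
    (hB.isCubic hC0 hC (bar d n) (.id ℝ _) (.id ℝ _) hbar hid hid)

theorem sm_envCubic (f : FreqL1 d n) :
    sm d n (envCubic S.Tsm f) = envCubic S.That (sm d n f) := by
  simp only [envCubic, map_add, sm_Tsm, bar_sm]

/-- The factor 27 collects three positions of the conjugate, three terms in `Tsm` and the bound 3
for `wtQuot`. -/
theorem norm_envCubic_Tsm_le {C : ℝ} (hC : ∀ x y z, ‖S.TL x y z‖ ≤ C * (‖x‖ * ‖y‖ * ‖z‖))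
    (f : FreqL1 d n) : ‖envCubic S.Tsm f‖ ≤ 27 * C * ‖sm d n f‖ ^ 2 * ‖f‖ := by
  refine norm_add₃_le.trans ((add_le_add_three (S.norm_Tsm_le hC _ _ _) (S.norm_Tsm_le hC _ _ _)
    (S.norm_Tsm_le hC _ _ _)).trans_eq ?_)
  simp only [← bar_sm, norm_bar]
  ring

/-! ### The linear part of the envelope equation in physical space -/

theorem invFourier_mulOp_const (A : CVec n →L[ℂ] CVec n) (f : FreqL1 d n) (x : Pos d) :
    invFourier d n (mulOp volume (fun _ => A.restrictScalars ℝ) f) x = A (invFourier d n f x) := by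
  have hi : Integrable (fun k => chr x k • f k) := (isSymbol_chr (n := n) x).integrable f
  have h := (A.restrictScalars ℝ).map_smul (fourierConst d) (∫ k, chr x k • f k)
  rw [← ContinuousLinearMap.integral_comp_comm _ hi] at h
  rw [invFourier_eq', invFourier_eq']
  refine Eq.trans ?_ h.symm
  congr 1
  refine integral_congr_ae ?_
  filter_upwards [coeFn_mulOp (isSymbol_const (A.restrictScalars ℝ)) f] with k hk
  rw [hk, ContinuousLinearMap.coe_restrictScalars', map_smul]

/-- The Fourier transform of `(i/ε) L(ω,κ) u + A(∂) u`, where `v μ = ∂_μ u`. -/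
def linHat (ε ω : ℝ) (κ : Pos d) (u : Wiener d n) (v : Fin d → Wiener d n) : FreqL1 d n :=
  mulOp volume (fun _ => ((Complex.I / ε) • Matrix.toEuclideanCLM (n := Fin n) (𝕜 := ℂ)
      (S.L ω κ)).restrictScalars ℝ) u.hat +
    ∑ μ, mulOp volume (fun _ => (Matrix.toEuclideanCLM (n := Fin n) (𝕜 := ℂ)
      (S.AC μ)).restrictScalars ℝ) (v μ).hat

theorem invFourier_linHat (ε ω : ℝ) (κ : Pos d) (u : Wiener d n) (v : Fin d → Wiener d n)
    (x : Pos d) : invFourier d n (S.linHat ε ω κ u v) x =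
      (Complex.I / ε) • act (S.L ω κ) (u x) + ∑ μ, act (S.AC μ) (v μ x) := by
  rw [linHat, map_add, Pi.add_apply, invFourier_mulOp_const, map_sum, Finset.sum_apply]
  simp only [invFourier_mulOp_const, ← Wiener.coe_eq]
  rfl

theorem coeFn_linHat {ε : ℝ} (hε : ε ≠ 0) (ω : ℝ) (κ : Pos d) {u : Wiener d n}
    {v : Fin d → Wiener d n} (hv : ∀ μ, Wiener.IsPartial μ u (v μ)) :
    ∀ᵐ k, S.linHat ε ω κ u v k = S.propGen ε ω κ k (u.hat k) := by
  have hε' : (ε : ℂ) ≠ 0 := by exact_mod_cast hε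
  set A₀ : CVec n →L[ℂ] CVec n :=
    (Complex.I / ε) • Matrix.toEuclideanCLM (n := Fin n) (𝕜 := ℂ) (S.L ω κ)
  set A : Fin d → (CVec n →L[ℂ] CVec n) := fun μ =>
    Matrix.toEuclideanCLM (n := Fin n) (𝕜 := ℂ) (S.AC μ)
  have h1 : ∀ᵐ k, ∀ μ, mulOp volume (fun _ => (A μ).restrictScalars ℝ) (v μ).hat k =
      A μ ((v μ).hat k) := ae_all_iff.2 fun μ => coeFn_mulOp (isSymbol_const _) _
  have h2 : ∀ᵐ k, ∀ μ, (v μ).hat k = (Complex.I * k μ) • u.hat k :=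
    ae_all_iff.2 fun μ => (hv μ).hat_eq
  filter_upwards [h1, h2, coeFn_mulOp (isSymbol_const (A₀.restrictScalars ℝ)) u.hat,
    Lp.coeFn_add (mulOp volume (fun _ => A₀.restrictScalars ℝ) u.hat)
      (∑ μ, mulOp volume (fun _ => (A μ).restrictScalars ℝ) (v μ).hat),
    Lp.coeFn_finsetSum Finset.univ
      (fun μ => mulOp volume (fun _ => (A μ).restrictScalars ℝ) (v μ).hat)]
    with k e1 e2 e3 e4 e5
  rw [linHat, e4, Pi.add_apply, e5, Finset.sum_apply, e3, S.propGen_apply hε]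
  simp only [e1, e2, map_smul]
  -- $\mathcal L(\omega,\kappa+\varepsilon k)=\mathcal L(\omega,\kappa)+\varepsilon A(k)$: the
  -- constant term and the derivative term of the envelope equation add up to the generator in the
  -- carrier frame.
  have e6 : act (S.L ω (κ + ε • k)) (u.hat k) =
      act (S.L ω κ) (u.hat k) + (ε : ℂ) • act (S.symbol k) (u.hat k) := by
    rw [act_L, act_L, act_symbol_add, act_symbol_smul]
    abel
  rw [e6, smul_add, smul_smul, div_mul_cancel₀ _ hε', act_symbol, Finset.smul_sum]
  simp only [smul_smul]
  rfl

end FriedrichsSystem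

/-! ### Existence of classical envelopes. -/

variable {d n : ℕ}

theorem one_add_norm_sq_le_wt (k : Pos d) : (1 + ‖k‖) ^ 2 ≤ 2 * wt k := by
  unfold wt; nlinarith [sq_nonneg (‖k‖ - 1)]

theorem contDiff_one_of_hasDerivAt {E : Type*} [NormedAddCommGroup E] [NormedSpace ℝ E]
    {f f' : ℝ → E} (hf : ∀ t, HasDerivAt f (f' t) t) (hf' : Continuous f') : ContDiff ℝ 1 f := by
  rw [contDiff_one_iff_deriv]
  refine ⟨fun t => (hf t).differentiableAt, ?_⟩
  rwa [show deriv f = f' from funext fun t => (hf t).deriv]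

/-- The symbol of `∂_μ (1 - Δ)⁻¹`. -/
def dsmSymbol (n : ℕ) (μ : Fin d) (k : Pos d) : CVec n →L[ℝ] CVec n :=
  scal n (Complex.I * k μ * (wt k : ℂ)⁻¹)

/-- The symbol of `∂_ν ∂_μ (1 - Δ)⁻¹`. -/
def ddsmSymbol (n : ℕ) (μ ν : Fin d) (k : Pos d) : CVec n →L[ℝ] CVec n :=
  scal n (Complex.I * k ν * (Complex.I * k μ * (wt k : ℂ)⁻¹))

theorem norm_coord_le (k : Pos d) (μ : Fin d) : ‖(k μ : ℂ)‖ ≤ ‖k‖ := by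
  rw [Complex.norm_real]; exact PiLp.norm_apply_le k μ

theorem norm_inv_wt (k : Pos d) : ‖(wt k : ℂ)⁻¹‖ = (wt k)⁻¹ := by
  rw [norm_inv, Complex.norm_real, Real.norm_of_nonneg (wt_pos k).le]

theorem norm_dsmSymbol_le (μ : Fin d) (k : Pos d) : ‖dsmSymbol n μ k‖ ≤ ‖k‖ * (wt k)⁻¹ := by
  refine (norm_scal_le _).trans ?_
  rw [norm_mul, norm_mul, Complex.norm_I, one_mul, norm_inv_wt]
  exact mul_le_mul_of_nonneg_right (norm_coord_le k μ) (inv_nonneg.2 (wt_pos k).le)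

theorem norm_ddsmSymbol_le (μ ν : Fin d) (k : Pos d) : ‖ddsmSymbol n μ ν k‖ ≤ 1 := by
  refine (norm_scal_le _).trans ?_
  rw [norm_mul, norm_mul, norm_mul, norm_mul, Complex.norm_I, one_mul, one_mul, norm_inv_wt,
    ← mul_assoc]
  refine (mul_le_mul_of_nonneg_right (mul_le_mul (norm_coord_le k ν) (norm_coord_le k μ)
    (norm_nonneg _) (norm_nonneg _)) (inv_nonneg.2 (wt_pos k).le)).trans ?_
  rw [mul_inv_le_iff₀ (wt_pos k), one_mul, wt]
  nlinarith

theorem continuous_inv_wt : Continuous fun k : Pos d => (wt k : ℂ)⁻¹ :=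
  (Complex.continuous_ofReal.comp continuous_wt).inv₀ fun k =>
    Complex.ofReal_ne_zero.2 (wt_pos k).ne'

theorem continuous_dsmSymbol (μ : Fin d) : Continuous (dsmSymbol n μ) := by
  refine continuous_scal.comp ?_
  have := continuous_inv_wt (d := d)
  fun_prop

theorem continuous_ddsmSymbol (μ ν : Fin d) : Continuous (ddsmSymbol n μ ν) := by
  refine continuous_scal.comp ?_
  have := continuous_inv_wt (d := d)
  fun_prop

theorem isSymbol_dsmSymbol (μ : Fin d) : IsSymbol volume (dsmSymbol n μ) :=
  ⟨(continuous_dsmSymbol μ).aestronglyMeasurable, 1, fun k => (norm_dsmSymbol_le μ k).trans (by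
    rw [mul_inv_le_iff₀ (wt_pos k), one_mul]; exact norm_le_wt k)⟩

theorem isSymbol_ddsmSymbol (μ ν : Fin d) : IsSymbol volume (ddsmSymbol n μ ν) :=
  ⟨(continuous_ddsmSymbol μ ν).aestronglyMeasurable, 1, norm_ddsmSymbol_le μ ν⟩

theorem isPartial_sm (μ : Fin d) (f : FreqL1 d n) :
    Wiener.IsPartial μ (Wiener.hat.symm (sm d n f))
      (Wiener.hat.symm (mulOp volume (dsmSymbol n μ) f)) := by
  refine Wiener.isPartial_of_hat_eq ?_
  simp only [LinearEquiv.apply_symm_apply]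
  filter_upwards [coeFn_sm f, coeFn_mulOp (isSymbol_dsmSymbol μ) f] with k h1 h2
  rw [h1, h2, dsmSymbol, scal_apply, FriedrichsSystem.coe_smul_vec, smul_smul]
  push_cast
  rfl

theorem isPartial_dsm (μ ν : Fin d) (f : FreqL1 d n) :
    Wiener.IsPartial ν (Wiener.hat.symm (mulOp volume (dsmSymbol n μ) f))
      (Wiener.hat.symm (mulOp volume (ddsmSymbol n μ ν) f)) := by
  refine Wiener.isPartial_of_hat_eq ?_
  simp only [LinearEquiv.apply_symm_apply]
  filter_upwards [coeFn_mulOp (isSymbol_ddsmSymbol μ ν) f,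
    coeFn_mulOp (isSymbol_dsmSymbol μ) f] with k h1 h2
  rw [h1, h2, dsmSymbol, ddsmSymbol, scal_apply, scal_apply, smul_smul]

namespace FriedrichsSystem

variable (S : FriedrichsSystem d n)

theorem isSymbol_comp_propGen (ε α : ℝ) (β : Pos d) {m : Pos d → CVec n →L[ℝ] CVec n}
    (hm : Continuous m) {C : ℝ} (hC : ∀ k, ‖m k‖ * (1 + ‖k‖) ≤ C) :
    IsSymbol volume fun k => (m k).comp (S.propGen ε α β k) := by
  obtain ⟨c, hc0, hc⟩ := S.exists_norm_propGen_le ε α β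
  refine ⟨(hm.clm_comp (S.continuous_propGen ε α β)).aestronglyMeasurable, c * C, fun k => ?_⟩
  refine (ContinuousLinearMap.opNorm_comp_le _ _).trans
    ((mul_le_mul_of_nonneg_left (hc k) (norm_nonneg _)).trans ?_)
  rw [mul_left_comm]
  exact mul_le_mul_of_nonneg_left (hC k) hc0

theorem isSymbol_sm_gen (ε α : ℝ) (β : Pos d) :
    IsSymbol volume fun k => (smSymbol n k).comp (S.propGen ε α β k) :=
  S.isSymbol_comp_propGen ε α β continuous_smSymbol (C := 2) fun k =>
    (mul_le_mul (norm_smSymbol_le k) (one_add_norm_le_wt k) (by positivity)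
      (inv_nonneg.2 (wt_pos k).le)).trans_eq (by have := (wt_pos k).ne'; field_simp)

/-- Two generators cost $(1+|k|)^2$, which is what a weight of order two can pay for. This allows a
second time derivative of the envelope. -/
theorem isSymbol_sm_gen_gen (ε α : ℝ) (β : Pos d) :
    IsSymbol volume fun k =>
      ((smSymbol n k).comp (S.propGen ε α β k)).comp (S.propGen ε α β k) := by
  obtain ⟨c, hc0, hc⟩ := S.exists_norm_propGen_le ε α β
  refine S.isSymbol_comp_propGen ε α β (m := fun k => (smSymbol n k).comp (S.propGen ε α β k))
    (continuous_smSymbol.clm_comp (S.continuous_propGen ε α β)) (C := 2 * c) fun k => ?_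
  have h1 : ‖(smSymbol n k).comp (S.propGen ε α β k)‖ ≤ (wt k)⁻¹ * (c * (1 + ‖k‖)) :=
    (ContinuousLinearMap.opNorm_comp_le _ _).trans (mul_le_mul (norm_smSymbol_le k) (hc k)
      (norm_nonneg _) (inv_nonneg.2 (wt_pos k).le))
  refine (mul_le_mul_of_nonneg_right h1 (by positivity)).trans ?_
  rw [mul_assoc, inv_mul_le_iff₀ (wt_pos k)]
  nlinarith [mul_le_mul_of_nonneg_left (one_add_norm_sq_le_wt k) hc0]

theorem isSymbol_dsm_gen (ε α : ℝ) (β : Pos d) (μ : Fin d) :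
    IsSymbol volume fun k => (dsmSymbol n μ k).comp (S.propGen ε α β k) :=
  S.isSymbol_comp_propGen ε α β (continuous_dsmSymbol μ) (C := 2) fun k => by
    refine (mul_le_mul_of_nonneg_right (norm_dsmSymbol_le μ k) (by positivity)).trans ?_
    rw [mul_right_comm, mul_inv_le_iff₀ (wt_pos k)]
    have := one_add_norm_sq_le_wt k
    nlinarith [norm_nonneg k]

/-- The unknown of the Picard iteration is $(1-\Delta)u_1$, with nonlinearity `Tsm`. Applying
$(1-\Delta)^{-1}$ to the result gains two orders, to be spent on derivatives in time or space. -/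
theorem exists_isEnvelope {C : ℝ} (hC0 : 0 ≤ C)
    (hC : ∀ x y z, ‖S.TL x y z‖ ≤ C * (‖x‖ * ‖y‖ * ‖z‖)) {R T : ℝ} (hR : 0 ≤ R) (hT : 0 < T)
    (hTR : 27 * C * (2 * R) ^ 3 * T ≤ R) {ε : ℝ} (hε : 0 < ε) (ω : ℝ) (κ : Pos d)
    {p : Wiener d n} {P : FreqL1 d n} (hP : sm d n P = p.hat) (hPR : ‖P‖ ≤ R) :
    ∃ u₁ : ℝ → Wiener d n, S.IsEnvelope ω κ ε (T / ε) (fun x => p x) u₁ ∧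
      ∀ t ∈ Icc 0 (T / ε), ‖u₁ t‖ ≤ 2 * R := by
  have hτ : 0 < T / ε := div_pos hT hε
  set τ := T / ε with hτdef
  -- Three terms, each with the factor 3 from `wtQuot`; the sum of three cubic terms then has
  -- constant `27 * C`.
  have hB : ∀ f g h : FreqL1 d n, ‖S.Tsm f g h‖ ≤ (9 * C) * (‖f‖ * ‖g‖ * ‖h‖) := by
    intro f g h
    have h0 : ∀ f : FreqL1 d n, 0 ≤ ‖f‖ := fun _ => norm_nonneg _
    have e1 := mul_three_le hC0 (h0 _) (h0 _) (h0 _) le_rfl (norm_sm_le g) (norm_sm_le h)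
      (a := ‖f‖)
    have e2 := mul_three_le hC0 (h0 _) (h0 _) (h0 _) (norm_sm_le f) le_rfl (norm_sm_le h)
      (b := ‖g‖)
    have e3 := mul_three_le hC0 (h0 _) (h0 _) (h0 _) (norm_sm_le f) (norm_sm_le g) le_rfl
      (c := ‖h‖)
    have := S.norm_Tsm_le hC f g h
    linarith
  have hQ := isCubic_envCubic S.isTri_Tsm (by positivity) hB
  have hQ1 := isCubic_envCubic S.isTri_That hC0 (S.norm_That_le hC)
  have hUc := fun (f : ℝ → FreqL1 d n) (hf : Continuous f) => S.continuous_evol_apply ε ω κ hf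
  have hVc := fun (f : ℝ → FreqL1 d n) (hf : Continuous f) => S.continuous_evol_neg_apply ε ω κ hf
  obtain ⟨a, hac, haR, ha⟩ := exists_integral_solution (U := fun t => S.evol ε ω κ t)
    (V := fun t => S.evol ε ω κ (-t)) (S.norm_evol_le ε ω κ) hUc
    (fun t => S.norm_evol_le ε ω κ (-t)) hVc hQ.nonneg hQ.norm_le hQ.sub_le hQ.continuous hR hT.le
    (by linarith) hε hPR
  set G : ℝ → FreqL1 d n := fun s => S.evol ε ω κ (-s) (envCubic S.Tsm (S.evol ε ω κ s (a s)))
    with hG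
  have hGc : Continuous G := hVc _ (hQ.continuous.comp (hUc _ hac))
  have hFc : Continuous fun s => ε • G s := hGc.const_smul ε
  -- `V` agrees with `a` on `[0, τ]` but is differentiable on the whole line, so one-sided
  -- derivatives at the end points need no separate treatment.
  set V : ℝ → FreqL1 d n := fun t => P + ε • ∫ s in (0 : ℝ)..t, G s with hVdef
  have hV : ∀ t, HasDerivAt V (ε • G t) t := hasDerivAt_add_smul_integral hGc P ε
  have hVcont : Continuous V := continuous_iff_continuousAt.2 fun s => (hV s).continuousAt
  have haV : ∀ t ∈ Icc 0 τ, a t = V t := ha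
  set H : ℝ → FreqL1 d n := fun t => S.evol ε ω κ t (V t) with hH
  have hHc : Continuous H := hUc _ hVcont
  set D : ℝ → FreqL1 d n := fun t => mulOp volume (smSymbol n) (S.evol ε ω κ t (ε • G t)) -
    mulOp volume (fun k => (smSymbol n k).comp (S.propGen ε ω κ k)) (H t) with hD
  have hder : ∀ t, HasDerivAt (fun t => sm d n (H t)) (D t) t :=
    S.hasDerivAt_mulOp_evol ε ω κ isSymbol_smSymbol (S.isSymbol_sm_gen ε ω κ) hFc hV
  have hDc : Continuous D := ((mulOp volume (smSymbol n)).continuous.comp (hUc _ hFc)).sub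
    ((mulOp volume _).continuous.comp hHc)
  have hû1 : ContDiff ℝ 1 fun t => sm d n (H t) := contDiff_one_of_hasDerivAt hder hDc
  have hN : ∀ t ∈ Icc 0 τ, mulOp volume (smSymbol n) (S.evol ε ω κ t (ε • G t)) =
      ε • envCubic S.That (sm d n (H t)) := by
    intro t ht
    rw [map_smul, map_smul]
    simp only [hG]
    rw [evol_evol_neg, haV t ht, ← sm_envCubic]
    rfl
  have hDeq : ∀ t ∈ Icc 0 τ, D t = ε • envCubic S.That (sm d n (H t)) -
      mulOp volume (fun k => (smSymbol n k).comp (S.propGen ε ω κ k)) (H t) := fun t ht => by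
    simp only [hD]; rw [hN t ht]
  -- On `[0, τ]` the equation expresses `D` through the cubic term of a $C^1$ curve and the smoothed
  -- generator applied to `H`; both are $C^1$, so the envelope is $C^2$.
  have hDC1 : ContDiffOn ℝ 1 D (Icc 0 τ) := by
    refine ContDiffOn.congr (f := fun t => ε • envCubic S.That (sm d n (H t)) -
      mulOp volume (fun k => (smSymbol n k).comp (S.propGen ε ω κ k)) (H t)) ?_ hDeq
    have h1 := hû1.contDiffOn (s := Icc 0 τ)
    have h2 := (bar d n).contDiff.comp_contDiffOn h1
    refine ContDiffOn.sub (ContDiffOn.const_smul ε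
      (((S.isTri_That.contDiffOn h1 h1 h2).add (S.isTri_That.contDiffOn h1 h2 h1)).add
        (S.isTri_That.contDiffOn h2 h1 h1))) (ContDiff.contDiffOn ?_)
    exact contDiff_one_of_hasDerivAt (S.hasDerivAt_mulOp_evol ε ω κ (S.isSymbol_sm_gen ε ω κ)
      (S.isSymbol_sm_gen_gen ε ω κ) hFc hV)
      (((mulOp volume _).continuous.comp (hUc _ hFc)).sub ((mulOp volume _).continuous.comp hHc))
  have hû2 : ContDiffOn ℝ 2 (fun t => sm d n (H t)) (Icc 0 τ) := by
    rw [show (2 : WithTop ℕ∞) = 1 + 1 by norm_num,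
      contDiffOn_succ_iff_derivWithin (uniqueDiffOn_Icc hτ)]
    refine ⟨fun t _ => (hder t).differentiableAt.differentiableWithinAt, by simp, ?_⟩
    exact hDC1.congr fun t ht =>
      (hder t).hasDerivWithinAt.derivWithin (uniqueDiffOn_Icc hτ t ht)
  have hdC1 : ∀ μ, ContDiff ℝ 1 fun t => mulOp volume (dsmSymbol n μ) (H t) := fun μ =>
    contDiff_one_of_hasDerivAt (S.hasDerivAt_mulOp_evol ε ω κ (isSymbol_dsmSymbol μ)
      (S.isSymbol_dsm_gen ε ω κ μ) hFc hV)
      (((mulOp volume _).continuous.comp (hUc _ hFc)).sub ((mulOp volume _).continuous.comp hHc))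
  have hsymm : ∀ {m : WithTop ℕ∞} {f : ℝ → FreqL1 d n}, ContDiffOn ℝ m f (Icc 0 τ) →
      ContDiffOn ℝ m (fun t => (Wiener.hat.symm (f t) : Wiener d n)) (Icc 0 τ) := fun hf =>
    (Wiener.hatₗᵢ d n).symm.contDiff.comp_contDiffOn hf
  refine ⟨fun t => Wiener.hat.symm (sm d n (H t)), ⟨?_, ?_, ?_⟩, ?_⟩
  · intro ℓ hℓ
    interval_cases ℓ
    · exact hsymm (by simpa using hû2)
    · exact ⟨hsymm (by simpa using hû1.contDiffOn), fun μ => ⟨_, fun t _ => isPartial_sm μ (H t),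
        hsymm (by simpa using (hdC1 μ).contDiffOn)⟩⟩
    · have h0 : ∀ A : FreqL1 d n →L[ℝ] FreqL1 d n, ContDiffOn ℝ ((2 - 2 : ℕ) : WithTop ℕ∞)
          (fun t => A (H t)) (Icc 0 τ) := fun A => by
        simpa [Function.comp_def] using (A.continuous.comp hHc).continuousOn (s := Icc 0 τ)
      exact ⟨hsymm (h0 _), fun μ => ⟨_, fun t _ => isPartial_sm μ (H t), hsymm (h0 _),
        fun ν => ⟨_, fun t _ => isPartial_dsm μ ν (H t), hsymm (h0 _)⟩⟩⟩
  · intro x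
    have hV0 : H 0 = P := by simp [hH, hVdef, evol_zero]
    simp only [hV0, hP, LinearEquiv.symm_apply_apply]
  · intro t ht x
    have ht' : t ∈ Icc 0 τ := Ioc_subset_Icc_self ht
    have hdw : derivWithin (fun t => (Wiener.hat.symm (sm d n (H t)) : Wiener d n)) (Icc 0 τ) t =
        Wiener.hat.symm (D t) :=
      ((Wiener.hatₗᵢ d n).symm.toContinuousLinearEquiv.hasFDerivAt.comp_hasDerivWithinAt t
        (hder t).hasDerivWithinAt).derivWithin (uniqueDiffOn_Icc hτ t ht')
    have hpart := fun μ => isPartial_sm μ (H t)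
    have hlin := S.invFourier_linHat ε ω κ (Wiener.hat.symm (sm d n (H t)))
      (fun μ => Wiener.hat.symm (mulOp volume (dsmSymbol n μ) (H t))) x
    have hlin' : S.linHat ε ω κ (Wiener.hat.symm (sm d n (H t)))
        (fun μ => Wiener.hat.symm (mulOp volume (dsmSymbol n μ) (H t))) =
          mulOp volume (fun k => (smSymbol n k).comp (S.propGen ε ω κ k)) (H t) := by
      refine (mulOp_eq_of_ae (S.isSymbol_sm_gen ε ω κ) ?_).symm
      filter_upwards [S.coeFn_linHat hε.ne' ω κ hpart, coeFn_sm (H t)] with k h1 h2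
      rw [h1, LinearEquiv.apply_symm_apply, h2, map_smul]; rfl
    rw [hlin'] at hlin
    have hld : ∀ μ, lineDeriv ℝ (Wiener.hat.symm (sm d n (H t)) : Wiener d n) x
        (EuclideanSpace.single μ 1) = (Wiener.hat.symm (mulOp volume (dsmSymbol n μ) (H t)) :
          Wiener d n) x := fun μ => (hpart μ x).lineDeriv
    simp only [hld]
    rw [hdw, add_assoc, ← hlin, Wiener.coe_hat_symm, Wiener.coe_hat_symm, hDeq t ht', map_sub,
      Pi.sub_apply, sub_add_cancel, invFourier_real_smul, envCubic, map_add, map_add, Pi.add_apply,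
      Pi.add_apply]
    simp only [invFourier_That, invFourier_bar]
  · intro t ht
    change ‖Wiener.hat (Wiener.hat.symm (sm d n (H t)))‖ ≤ _
    rw [LinearEquiv.apply_symm_apply]
    refine (norm_sm_le _).trans ?_
    rw [hH, norm_evol_apply, ← haV t ht]
    exact haR t

/-- The numerical constraints of the contraction arguments can be met. -/
theorem exists_existence_time {C R : ℝ} (hC : 0 ≤ C) (hR : 0 < R) :
    ∃ T : ℝ, 0 < T ∧ 27 * C * (2 * R) ^ 3 * T ≤ R ∧ C * (2 * R) ^ 3 * T ≤ R := by
  have hX : 0 < 27 * C * (2 * R) ^ 3 + 1 := by positivity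
  refine ⟨R / (27 * C * (2 * R) ^ 3 + 1), by positivity, ?_, ?_⟩
  · rw [mul_div_assoc', div_le_iff₀ hX]; nlinarith
  · rw [mul_div_assoc', div_le_iff₀ hX]
    nlinarith [mul_nonneg (mul_nonneg hC (pow_nonneg (by positivity : 0 ≤ 2 * R) 3)) hR.le]

theorem exists_bounded_solutions (κ : Pos d) (ω : ℝ) {p₀ p₁ : Wiener d n}
    (hp₀ : Wiener.MemW 2 p₀) (hp₁ : Wiener.MemW 2 p₁) :
    ∃ tEnd : ℝ, 0 < tEnd ∧ ∃ M : ℝ, ∀ ε ∈ Set.Ioc (0 : ℝ) 1, ∃ u u₁ : ℝ → Wiener d n,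
      S.IsMildSolution κ ε (tEnd / ε) (fun x => p₀ x + ε • p₁ x) u ∧
      S.IsEnvelope ω κ ε (tEnd / ε) (fun x => p₀ x + ε • p₁ x) u₁ ∧
      ∀ t ∈ Set.Icc 0 (tEnd / ε), ‖u t‖ ≤ M ∧ ‖u₁ t‖ ≤ M := by
  obtain ⟨P₀, hP₀⟩ := hp₀.exists_sm_eq
  obtain ⟨P₁, hP₁⟩ := hp₁.exists_sm_eq
  obtain ⟨C, hC0, hC⟩ := IsTri.bound (B := fun a b c => S.TL a b c) ⟨S.TL, fun _ _ _ => rfl⟩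
  -- The factor 2 accounts for the conjugate in the initial datum of `u`; the summand 1 makes `R`
  -- positive.
  set R := 2 * (‖P₀‖ + ‖P₁‖) + 1 with hRdef
  have hR : 0 < R := by positivity
  obtain ⟨T, hT, hT1, hT2⟩ := exists_existence_time hC0 hR
  refine ⟨T, hT, 2 * R, fun ε hε => ?_⟩
  have hP : sm d n (P₀ + ε • P₁) = (p₀ + ε • p₁).hat := by
    rw [map_add, map_smul, hP₀, hP₁]
    exact ((map_add (Wiener.hatₗᵢ d n) _ _).trans (congrArg _ (map_smul (Wiener.hatₗᵢ d n) _ _))).symm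
  have hPn : ‖P₀ + ε • P₁‖ ≤ ‖P₀‖ + ‖P₁‖ := by
    refine (norm_add_le _ _).trans (add_le_add_right ?_ _)
    rw [norm_smul, Real.norm_of_nonneg hε.1.le]
    exact mul_le_of_le_one_left (norm_nonneg _) hε.2
  have hp : ‖p₀ + ε • p₁‖ ≤ ‖P₀‖ + ‖P₁‖ := by
    rw [← Wiener.norm_hat, ← hP]
    exact (norm_sm_le _).trans hPn
  have hcoe : (fun x => p₀ x + ε • p₁ x) = fun x => (p₀ + ε • p₁ : Wiener d n) x := by
    funext x
    rw [Wiener.coe_add, Wiener.coe_real_smul]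
  obtain ⟨u, hu, huM⟩ := S.exists_isMildSolution hC0 (S.norm_That_le hC) hR.le hT.le hT2 hε.1 κ
    (p₀ + ε • p₁) (by linarith)
  obtain ⟨u₁, hu₁, hu₁M⟩ := S.exists_isEnvelope hC0 hC hR.le hT hT1 hε.1 ω κ hP
    (hPn.trans (by linarith [norm_nonneg P₀, norm_nonneg P₁]))
  rw [hcoe]
  exact ⟨u, u₁, hu, hu₁, fun t ht => ⟨huM t ht, hu₁M t ht⟩⟩

end FriedrichsSystem
namespace FriedrichsSystem

variable {d n : ℕ} (S : FriedrichsSystem d n)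

/-! ### Duhamel's formula for the envelope -/

/-- Mild solutions of the envelope equation on `[0,τ]`, on the Fourier side. -/
structure IsMildEnvelope (ε ω : ℝ) (κ : Pos d) (τ : ℝ) (p : FreqL1 d n) (w : ℝ → FreqL1 d n) :
    Prop where
  continuous : Continuous w
  duhamel : ∀ t ∈ Icc 0 τ, w t = S.evol ε ω κ t
    (p + ε • ∫ s in (0 : ℝ)..t, S.evol ε ω κ (-s) (envCubic S.That (w s)))

theorem continuous_envCubic {B : FreqL1 d n → FreqL1 d n → FreqL1 d n → FreqL1 d n}
    (hB : IsTri B) : Continuous (envCubic B) :=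
  ((hB.continuous continuous_id continuous_id (bar d n).continuous).add
    (hB.continuous continuous_id (bar d n).continuous continuous_id)).add
    (hB.continuous (bar d n).continuous continuous_id continuous_id)

/-- Injectivity of the inverse Fourier transform turns the pointwise equation into one in $L^1$,
where it has the form required by `evol_neg_eq_of_hasDerivAt`. -/
theorem IsEnvelope.isMildEnvelope {S : FriedrichsSystem d n} {ω : ℝ} {κ : Pos d} {ε τ : ℝ}
    (hε : 0 < ε) (hτ : 0 < τ) {p : Wiener d n} {u₁ : ℝ → Wiener d n}
    (h : S.IsEnvelope ω κ ε τ (fun x => p x) u₁) :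
    S.IsMildEnvelope ε ω κ τ p.hat fun t => (u₁ (clamp τ t)).hat := by
  have hreg := h.regularity 1 one_le_two
  obtain ⟨hC1, hv⟩ := hreg
  choose v hv using hv
  have hC1' : ContDiffOn ℝ 1 u₁ (Icc 0 τ) := by simpa using hC1
  have hcont : ContinuousOn (fun t => (u₁ t).hat) (Icc 0 τ) :=
    (Wiener.hatₗᵢ d n).continuous.comp_continuousOn hC1'.continuousOn
  have hw : Continuous fun t => (u₁ (clamp τ t)).hat := continuous_comp_clamp hτ.le hcont
  have hN : Continuous fun t => ε • envCubic S.That (u₁ (clamp τ t)).hat :=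
    ((continuous_envCubic S.isTri_That).comp hw).const_smul ε
  have hp : u₁ 0 = p := Wiener.ext' h.initial
  refine ⟨hw, fun t ht => ?_⟩
  have hd : ∀ t ∈ Ioo 0 τ, HasDerivAt (fun t => (u₁ t).hat)
      (derivWithin u₁ (Icc 0 τ) t).hat t := by
    intro t ht
    have h1 := (hC1'.differentiableOn one_ne_zero t (Ioo_subset_Icc_self ht)).hasDerivWithinAt
    have h2 := h1.hasDerivAt (Icc_mem_nhds ht.1 ht.2)
    exact (Wiener.hatₗᵢ d n).toContinuousLinearEquiv.hasFDerivAt.comp_hasDerivAt t h2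
  have key := S.evol_neg_eq_of_hasDerivAt ε ω κ hcont hN hd (fun t ht => by
    have ht' := Ioo_subset_Icc_self ht
    have hpart := fun μ => (hv μ).1 t ht'
    have hpde : (derivWithin u₁ (Icc 0 τ) t).hat =
        ε • envCubic S.That (u₁ (clamp τ t)).hat - S.linHat ε ω κ (u₁ t) (fun μ => v μ t) := by
      refine invFourier_ext fun x => ?_
      have h1 := h.pde t (Ioo_subset_Ioc_self ht) x
      have hld : ∀ μ, lineDeriv ℝ (u₁ t) x (EuclideanSpace.single μ 1) = v μ t x := fun μ =>
        (hpart μ x).lineDeriv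
      simp only [hld] at h1
      rw [add_assoc, ← invFourier_linHat] at h1
      rw [map_sub, Pi.sub_apply, invFourier_real_smul, clamp_of_mem ht', envCubic, map_add, map_add,
        Pi.add_apply, Pi.add_apply]
      simp only [invFourier_That, invFourier_bar, ← Wiener.coe_eq]
      rw [← h1]
      abel
    rw [hpde]
    filter_upwards [S.coeFn_linHat hε.ne' ω κ hpart,
      Lp.coeFn_sub (ε • envCubic S.That (u₁ (clamp τ t)).hat)
        (S.linHat ε ω κ (u₁ t) (fun μ => v μ t))] with k h1 h2
    rw [h2, Pi.sub_apply, h1]) t ht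
  rw [clamp_of_mem ht]
  have h3 := congrArg (S.evol ε ω κ t) key
  rw [evol_evol_neg] at h3
  rw [h3, hp]
  simp only [map_smul, intervalIntegral.integral_smul]

/-- The envelope has two derivatives, uniformly in `ε`. -/
theorem IsEnvelope.exists_sm_eq {S : FriedrichsSystem d n} {ω : ℝ} {κ : Pos d} {ε τ : ℝ}
    {p : Pos d → CVec n} {u₁ : ℝ → Wiener d n} (h : S.IsEnvelope ω κ ε τ p u₁) :
    ∃ H : ℝ → FreqL1 d n, ContinuousOn H (Icc 0 τ) ∧ ∀ t ∈ Icc 0 τ, sm d n (H t) = (u₁ t).hat := by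
  obtain ⟨hC0, hv⟩ := h.regularity 2 le_rfl
  choose v hv using hv
  choose hvp hv' using hv
  choose hv0 hvv using hv'
  choose w hw using fun μ => hvv μ μ
  have hcont : ∀ {f : ℝ → Wiener d n}, ContDiffOn ℝ ((2 - 2 : ℕ) : WithTop ℕ∞) f (Icc 0 τ) →
      ContinuousOn (fun t => (f t).hat) (Icc 0 τ) := fun hf =>
    (Wiener.hatₗᵢ d n).continuous.comp_continuousOn hf.continuousOn
  refine ⟨fun t => (u₁ t).hat - ∑ μ, (w μ t).hat, ?_, fun t ht => ?_⟩
  · exact (hcont hC0).sub (continuousOn_finsetSum _ fun μ _ => hcont (hw μ).2)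
  · exact sm_sub_sum fun μ => (hvp μ t ht).hat_eq_sq ((hw μ).1 t ht)

/-- The weighted function `H` satisfies an equation whose forcing is at most `27 * C * M ^ 2 * ‖H‖`.
Grönwall at rate proportional to `ε` bounds two derivatives on $[0,T/\varepsilon]$ independently of
`ε`. -/
theorem IsMildEnvelope.norm_weighted_le {S : FriedrichsSystem d n} {ω : ℝ} {κ : Pos d} {ε τ : ℝ}
    (hε : 0 ≤ ε) {p P : FreqL1 d n} {w H : ℝ → FreqL1 d n} (h : S.IsMildEnvelope ε ω κ τ p w)
    (hP : sm d n P = p) (hH : ContinuousOn H (Icc 0 τ)) (hHw : ∀ t ∈ Icc 0 τ, sm d n (H t) = w t)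
    {C M : ℝ} (hC0 : 0 ≤ C) (hC : ∀ x y z, ‖S.TL x y z‖ ≤ C * (‖x‖ * ‖y‖ * ‖z‖))
    (hM : ∀ t ∈ Icc 0 τ, ‖w t‖ ≤ M) :
    ∀ t ∈ Icc 0 τ, ‖H t‖ ≤ ‖P‖ * Real.exp (ε * (27 * C * M ^ 2) * t) := by
  rcases lt_or_ge τ 0 with hτ | hτ
  · intro t ht; exact absurd (ht.1.trans ht.2) hτ.not_ge
  have hHc : Continuous fun t => H (clamp τ t) := continuous_comp_clamp hτ hH
  have hGc : Continuous fun s => S.evol ε ω κ (-s) (envCubic S.Tsm (H (clamp τ s))) :=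
    S.continuous_evol_neg_apply ε ω κ ((continuous_envCubic S.isTri_Tsm).comp hHc)
  have hHd : ∀ t ∈ Icc 0 τ, H t = S.evol ε ω κ t
      (P + ε • ∫ s in (0 : ℝ)..t, S.evol ε ω κ (-s) (envCubic S.Tsm (H (clamp τ s)))) := by
    intro t ht
    -- The Duhamel formula for `H` holds because its image under the injective smoothing is the one
    -- for `w`.
    refine sm_injective ?_
    rw [hHw t ht, h.duhamel t ht, sm_evol, (sm d n).map_add, (sm d n).map_smul, hP,
      ← ContinuousLinearMap.intervalIntegral_comp_comm _ (hGc.intervalIntegrable 0 t)]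
    congr 3
    refine intervalIntegral.integral_congr fun s hs => ?_
    rw [uIcc_of_le ht.1] at hs
    have hs' : s ∈ Icc 0 τ := ⟨hs.1, hs.2.trans ht.2⟩
    simp only [sm_evol, sm_envCubic, clamp_of_mem hs', hHw s hs']
  have key := le_mul_exp_of_le_integral (φ := fun t => ‖H (clamp τ t)‖) (A := ‖P‖)
    (B := ε * (27 * C * M ^ 2)) (τ := τ) (by positivity) hHc.norm fun t ht => by
      simp only [clamp_of_mem ht]
      rw [hHd t ht, norm_evol_apply]
      refine (norm_add_le _ _).trans (add_le_add_right ?_ _)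
      rw [norm_smul, Real.norm_of_nonneg hε, mul_assoc, ← intervalIntegral.integral_const_mul]
      refine mul_le_mul_of_nonneg_left (norm_integral_le_integral_of_le ht.1 (fun s hs => ?_)
        (hHc.norm.const_mul _)) hε
      have hs' : s ∈ Icc 0 τ := ⟨hs.1, hs.2.trans ht.2⟩
      rw [norm_evol_apply]
      refine (S.norm_envCubic_Tsm_le hC _).trans ?_
      rw [clamp_of_mem hs', hHw s hs']
      have := hM s hs'
      gcongr
  intro t ht
  have := key t ht
  rwa [clamp_of_mem ht] at this

end FriedrichsSystem

/-! ### Oscillatory integrals -/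

section Phase

variable {X : Type*} {n : ℕ}

/-- The symbol `e^{i Φ s}`. -/
def phaseSymbol (n : ℕ) (Φ : X → ℝ) (s : ℝ) (x : X) : CVec n →L[ℝ] CVec n :=
  scal n (Complex.exp (Complex.I * (Φ x * s : ℝ)))

theorem norm_exp_I_mul (y : ℝ) : ‖Complex.exp (Complex.I * (y : ℝ))‖ = 1 := by
  rw [mul_comm, Complex.norm_exp_ofReal_mul_I]

theorem norm_exp_sub_exp_le (x y : ℝ) :
    ‖Complex.exp (Complex.I * (x : ℝ)) - Complex.exp (Complex.I * (y : ℝ))‖ ≤ |x - y| := by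
  have h : Complex.exp (Complex.I * (x : ℝ)) - Complex.exp (Complex.I * (y : ℝ)) =
      Complex.exp (Complex.I * (y : ℝ)) * (Complex.exp (Complex.I * ((x - y : ℝ) : ℂ)) - 1) := by
    rw [mul_sub, ← Complex.exp_add, mul_one]
    congr 2
    push_cast
    ring
  rw [h, norm_mul, norm_exp_I_mul, one_mul]
  exact Real.norm_exp_I_mul_ofReal_sub_one_le

theorem norm_phaseSymbol_le (Φ : X → ℝ) (s : ℝ) (x : X) : ‖phaseSymbol n Φ s x‖ ≤ 1 :=
  (norm_scal_le _).trans (norm_exp_I_mul _).le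

theorem hasDerivAt_exp_phase (y s : ℝ) :
    HasDerivAt (fun s : ℝ => Complex.exp (Complex.I * ((y * s : ℝ) : ℂ)))
      (Complex.exp (Complex.I * ((y * s : ℝ) : ℂ)) * (Complex.I * y)) s := by
  have h := (((hasDerivAt_id s).ofReal_comp.const_mul (y : ℂ)).const_mul Complex.I).cexp
  simpa using h

theorem continuous_phaseSymbol (Φ : X → ℝ) (x : X) : Continuous fun s => phaseSymbol n Φ s x :=
  continuous_scal.comp (continuous_iff_continuousAt.2 fun s =>
    (hasDerivAt_exp_phase (Φ x) s).continuousAt)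

variable [MeasurableSpace X] {μ : Measure X}

theorem isSymbol_phaseSymbol {Φ : X → ℝ} (hΦ : Measurable Φ) (s : ℝ) :
    IsSymbol μ (phaseSymbol n Φ s) :=
  isSymbol_scal (by
    have : Measurable fun x => Complex.exp (Complex.I * ((Φ x * s : ℝ) : ℂ)) := by fun_prop
    exact this.aestronglyMeasurable) fun x => (norm_exp_I_mul _).le

/-- On `G` the symbol $\mathrm e^{\mathrm i\Phi s}/(\mathrm i\Phi)$ is a primitive of the phase, of
size at most $1/c$; one integrates by parts in time. The upper bound `c'` only ensures norm
differentiability and does not enter the estimate. -/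
theorem norm_integral_phase_le {Φ : X → ℝ} (hΦ : Measurable Φ) {G : Set X} (hG : MeasurableSet G)
    {c c' : ℝ} (hc : 0 < c) (hcΦ : ∀ x ∈ G, c ≤ |Φ x|) (hc'Φ : ∀ x ∈ G, |Φ x| ≤ c')
    {Z Z' : ℝ → Lp (CVec n) 1 μ} (hZ : ∀ s, HasDerivAt Z (Z' s) s) (hZ' : Continuous Z')
    (hZG : ∀ s, ∀ᵐ x ∂μ, x ∉ G → Z s x = 0) {z z' τ : ℝ} (hz : ∀ s ∈ Icc 0 τ, ‖Z s‖ ≤ z)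
    (hz' : ∀ s ∈ Icc 0 τ, ‖Z' s‖ ≤ z') {t : ℝ} (ht : t ∈ Icc 0 τ) :
    ‖∫ s in (0 : ℝ)..t, mulOp μ (phaseSymbol n Φ s) (Z s)‖ ≤ c⁻¹ * (2 * z + z' * τ) := by
  set φ : ℝ → X → CVec n →L[ℝ] CVec n := fun s => G.indicator fun x =>
    scal n (Complex.exp (Complex.I * (Φ x * s : ℝ)) * (Complex.I * Φ x)⁻¹) with hφ
  set φ' : ℝ → X → CVec n →L[ℝ] CVec n := fun s => G.indicator (phaseSymbol n Φ s) with hφ'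
  have hφn : ∀ s x, ‖φ s x‖ ≤ c⁻¹ := by
    intro s x
    by_cases hx : x ∈ G
    · simp only [hφ, indicator_of_mem hx]
      refine (norm_scal_le _).trans ?_
      rw [norm_mul, norm_exp_I_mul, one_mul, norm_inv, norm_mul, Complex.norm_I, one_mul,
        Complex.norm_real, Real.norm_eq_abs]
      exact inv_anti₀ hc (hcΦ x hx)
    · simp only [hφ, indicator_of_notMem hx, norm_zero]
      positivity
  have hφ'n : ∀ s x, ‖φ' s x‖ ≤ 1 := by
    intro s x
    by_cases hx : x ∈ G
    · simp only [hφ', indicator_of_mem hx]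
      exact norm_phaseSymbol_le Φ s x
    · simp only [hφ', indicator_of_notMem hx, norm_zero]
      exact zero_le_one
  have hφs : ∀ s, IsSymbol μ (φ s) := fun s => by
    have h1 : Measurable fun x =>
        Complex.exp (Complex.I * ((Φ x * s : ℝ) : ℂ)) * (Complex.I * (Φ x : ℂ))⁻¹ := by fun_prop
    exact ⟨(continuous_scal.comp_aestronglyMeasurable h1.aestronglyMeasurable).indicator hG, c⁻¹,
      hφn s⟩
  have hφ's : ∀ s, IsSymbol μ (φ' s) := fun s =>
    ⟨(isSymbol_phaseSymbol hΦ s).meas.indicator hG, 1, hφ'n s⟩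
  have hd : ∀ s x, HasDerivAt (fun s => φ s x) (φ' s x) s := by
    intro s x
    by_cases hx : x ∈ G
    · simp only [hφ, hφ', indicator_of_mem hx]
      have h0 : (Complex.I * (Φ x : ℂ)) ≠ 0 := mul_ne_zero Complex.I_ne_zero (by
        have := hc.trans_le (hcΦ x hx)
        exact_mod_cast abs_pos.1 this)
      have h1 := ((hasDerivAt_exp_phase (Φ x) s).mul_const (Complex.I * (Φ x : ℂ))⁻¹)
      rw [mul_assoc, mul_inv_cancel₀ h0, mul_one] at h1
      exact h1.smul_const (ContinuousLinearMap.id ℝ (CVec n))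
    · simp only [hφ, hφ', indicator_of_notMem hx]
      exact hasDerivAt_const _ _
  have hL : ∀ s r x, ‖φ' s x - φ' r x‖ ≤ max c' 0 * |s - r| := by
    intro s r x
    by_cases hx : x ∈ G
    · simp only [hφ', indicator_of_mem hx, phaseSymbol]
      have : ∀ a b : ℂ, scal n a - scal n b = scal n (a - b) := fun a b => (sub_smul _ _ _).symm
      rw [this]
      refine (norm_scal_le _).trans ((norm_exp_sub_exp_le _ _).trans ?_)
      rw [← mul_sub, abs_mul]
      exact mul_le_mul_of_nonneg_right ((hc'Φ x hx).trans (le_max_left _ _)) (abs_nonneg _)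
    · simp only [hφ', indicator_of_notMem hx, sub_zero, norm_zero]
      exact mul_nonneg (le_max_right _ _) (abs_nonneg _)
  have hZc : Continuous Z := continuous_iff_continuousAt.2 fun s => (hZ s).continuousAt
  have heq : ∀ s, mulOp μ (phaseSymbol n Φ s) (Z s) = mulOp μ (φ' s) (Z s) := fun s => by
    refine mulOp_congr_ae (isSymbol_phaseSymbol hΦ s) (hφ's s) ?_
    filter_upwards [hZG s] with x hx
    by_cases hxG : x ∈ G
    · simp only [hφ', indicator_of_mem hxG]
    · rw [hx hxG, map_zero, map_zero]
  simp only [heq]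
  refine norm_integral_clm_apply_le (fun s => hasDerivAt_mulOp hφs hφ's hd hL s) hZ ?_ hZ'
    (fun s => opNorm_mulOp_le (inv_nonneg.2 hc.le) (hφn s)) hz hz' ht
  refine continuous_clm_apply_of_strong (fun s => opNorm_mulOp_le zero_le_one (hφ'n s))
    (fun f => ?_) hZc
  refine continuous_mulOp_apply hφ's hφ'n (fun x => ?_) f
  by_cases hx : x ∈ G
  · simp only [hφ', indicator_of_mem hx]
    exact continuous_phaseSymbol Φ x
  · simp only [hφ', indicator_of_notMem hx]
    exact continuous_const

end Phase

/-! ### Phases of cubic interactions. -/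

section PhaseOp

variable {d n : ℕ}

/-- Multiplication by `e^{i θ(k) s}` on the Fourier side. -/
def phaseOp (n : ℕ) (θ : Pos d → ℝ) (s : ℝ) : FreqL1 d n →L[ℝ] FreqL1 d n :=
  mulOp volume (phaseSymbol n θ s)

theorem norm_phaseOp {θ : Pos d → ℝ} (hθ : Measurable θ) (s : ℝ) (f : FreqL1 d n) :
    ‖phaseOp n θ s f‖ = ‖f‖ :=
  norm_mulOp_of_isometry (isSymbol_phaseSymbol hθ s) (fun x v => by
    rw [phaseSymbol, scal_apply, norm_smul, norm_exp_I_mul, one_mul]) f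

theorem norm_phaseOp_le (θ : Pos d → ℝ) (s : ℝ) : ‖phaseOp n θ s‖ ≤ 1 :=
  opNorm_mulOp_le zero_le_one (norm_phaseSymbol_le θ s)

theorem continuous_phaseOp_apply {θ : Pos d → ℝ} (hθ : Measurable θ) {f : ℝ → FreqL1 d n}
    (hf : Continuous f) : Continuous fun s => phaseOp n θ s (f s) :=
  continuous_clm_apply_of_strong (norm_phaseOp_le θ) (fun f =>
    continuous_mulOp_apply (fun s => isSymbol_phaseSymbol hθ s)
      (fun s k => norm_phaseSymbol_le θ s k) (continuous_phaseSymbol θ) f) hf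

theorem bar_phaseOp {θ : Pos d → ℝ} (hθ : Measurable θ) (s : ℝ) (f : FreqL1 d n) :
    bar d n (phaseOp n θ s f) = phaseOp n (fun k => -θ (-k)) s (bar d n f) := by
  have hθ' : Measurable fun k => -θ (-k) := (hθ.comp measurable_neg).neg
  refine (mulOp_eq_of_ae (isSymbol_phaseSymbol hθ' s) ?_).symm
  filter_upwards [coeFn_bar (phaseOp n θ s f), coeFn_bar f,
    ae_neg (coeFn_mulOp (isSymbol_phaseSymbol hθ s) f)] with k h1 h2 h3
  rw [h1, h2, phaseOp, h3]
  simp only [phaseSymbol, scal_apply, conjVec_smul]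
  rw [← Complex.exp_conj]
  simp

namespace FriedrichsSystem

variable (S : FriedrichsSystem d n)

/-- The phase of a cubic interaction. -/
def phase4 (μ θ₁ θ₂ θ₃ : Pos d → ℝ) (z : Pos3 d) : ℝ :=
  μ (sum3 z) + θ₁ z.1 + θ₂ z.2.1 + θ₃ z.2.2

theorem measurable_sum3 : Measurable (sum3 (d := d)) := by unfold sum3; fun_prop

theorem measurable_phase4 {μ θ₁ θ₂ θ₃ : Pos d → ℝ} (hμ : Measurable μ) (h₁ : Measurable θ₁)
    (h₂ : Measurable θ₂) (h₃ : Measurable θ₃) : Measurable (phase4 μ θ₁ θ₂ θ₃) :=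
  (((hμ.comp measurable_sum3).add (h₁.comp measurable_fst)).add
    (h₂.comp (measurable_fst.comp measurable_snd))).add
    (h₃.comp (measurable_snd.comp measurable_snd))

/-- The phases of the three factors and of the output merge into one phase on frequency triples,
before the frequencies are summed. This makes the interaction an oscillatory integral. -/
theorem phaseOp_That {μ θ₁ θ₂ θ₃ : Pos d → ℝ} (hμ : Measurable μ) (h₁ : Measurable θ₁)
    (h₂ : Measurable θ₂) (h₃ : Measurable θ₃) (s : ℝ) (f g h : FreqL1 d n) :
    phaseOp n μ s (S.That (phaseOp n θ₁ s f) (phaseOp n θ₂ s g) (phaseOp n θ₃ s h)) =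
      fourierConst d ^ 2 • push (CVec n) d
        (mulOp volume (phaseSymbol n (phase4 μ θ₁ θ₂ θ₃) s) (tri3 S.TL f g h)) := by
  rw [That_apply, map_smul, phaseOp, mulOp_push (isSymbol_phaseSymbol hμ s)]
  congr 2
  refine mulOp_eq_of_ae (isSymbol_phaseSymbol hμ s).comp_sum3 ?_
  filter_upwards [coeFn_mulOp (isSymbol_phaseSymbol (measurable_phase4 hμ h₁ h₂ h₃) s)
      (tri3 S.TL f g h), coeFn_tri3 S.TL f g h,
    coeFn_tri3 S.TL (phaseOp n θ₁ s f) (phaseOp n θ₂ s g) (phaseOp n θ₃ s h),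
    ae_fst3 (coeFn_mulOp (isSymbol_phaseSymbol h₁ s) f),
    ae_snd3 (coeFn_mulOp (isSymbol_phaseSymbol h₂ s) g),
    ae_trd3 (coeFn_mulOp (isSymbol_phaseSymbol h₃ s) h)] with z e1 e2 e3 e4 e5 e6
  rw [e1, e2, e3, phaseOp, phaseOp, phaseOp, e4, e5, e6]
  simp only [phaseSymbol, scal_apply, TL_apply, TC_smul, smul_smul, ← Complex.exp_add, phase4]
  congr 2
  push_cast
  ring

/-- A differentiable family with frequencies in the ball of radius `r`. -/
structure IsSlow (r M M' τ : ℝ) (a a' : ℝ → FreqL1 d n) : Prop where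
  hasDerivAt : ∀ s, HasDerivAt a (a' s) s
  continuous_deriv : Continuous a'
  cut_eq : ∀ s, cut (CVec n) r (a s) = a s
  norm_le : ∀ s ∈ Icc 0 τ, ‖a s‖ ≤ M
  norm_deriv_le : ∀ s ∈ Icc 0 τ, ‖a' s‖ ≤ M'

theorem IsSlow.continuous {r M M' τ : ℝ} {a a' : ℝ → FreqL1 d n} (h : IsSlow r M M' τ a a') :
    Continuous a := continuous_iff_continuousAt.2 fun s => (h.hasDerivAt s).continuousAt

theorem IsSlow.ae_eq_zero {r M M' τ : ℝ} {a a' : ℝ → FreqL1 d n} (h : IsSlow r M M' τ a a') (s : ℝ) :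
    ∀ᵐ k, r < ‖k‖ → a s k = 0 := by
  filter_upwards [coeFn_cut r (a s)] with k hk hr
  rw [← h.cut_eq s, hk, ballInd_of_lt hr, zero_smul]

theorem IsSlow.bar {r M M' τ : ℝ} {a a' : ℝ → FreqL1 d n} (h : IsSlow r M M' τ a a') :
    IsSlow r M M' τ (fun s => bar d n (a s)) (fun s => bar d n (a' s)) where
  hasDerivAt s := (SVEA.bar d n).hasFDerivAt.comp_hasDerivAt s (h.hasDerivAt s)
  continuous_deriv := (SVEA.bar d n).continuous.comp h.continuous_deriv
  cut_eq s := by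
    refine Lp.ext ?_
    filter_upwards [coeFn_cut r (SVEA.bar d n (a s)), coeFn_bar (a s), ae_neg (h.ae_eq_zero s)]
      with k h1 h2 h3
    rw [h1]
    rcases le_or_gt ‖k‖ r with hk | hk
    · rw [ballInd_of_le hk, one_smul]
    · rw [ballInd_of_lt hk, zero_smul, h2, h3 (by rwa [norm_neg]), ← conjL_apply, map_zero]
  norm_le s hs := by rw [norm_bar]; exact h.norm_le s hs
  norm_deriv_le s hs := by rw [norm_bar]; exact h.norm_deriv_le s hs

/-- A nonresonant cubic interaction of slowly varying amplitudes gains the inverse of the phase. -/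
theorem norm_integral_nonresonant_le {C : ℝ} (hC0 : 0 ≤ C)
    (hC : ∀ x y z, ‖S.TL x y z‖ ≤ C * (‖x‖ * ‖y‖ * ‖z‖)) {μ θ₁ θ₂ θ₃ : Pos d → ℝ}
    (hμ : Measurable μ) (h₁ : Measurable θ₁) (h₂ : Measurable θ₂) (h₃ : Measurable θ₃)
    {r M M' τ c c' : ℝ} (hc : 0 < c)
    (hcΦ : ∀ z : Pos3 d, ‖z.1‖ ≤ r → ‖z.2.1‖ ≤ r → ‖z.2.2‖ ≤ r →
      c ≤ |phase4 μ θ₁ θ₂ θ₃ z| ∧ |phase4 μ θ₁ θ₂ θ₃ z| ≤ c')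
    {a₁ a₁' a₂ a₂' a₃ a₃' : ℝ → FreqL1 d n} (ha₁ : IsSlow r M M' τ a₁ a₁')
    (ha₂ : IsSlow r M M' τ a₂ a₂') (ha₃ : IsSlow r M M' τ a₃ a₃') {t : ℝ} (ht : t ∈ Icc 0 τ) :
    ‖∫ s in (0 : ℝ)..t, phaseOp n μ s (S.That (phaseOp n θ₁ s (a₁ s)) (phaseOp n θ₂ s (a₂ s))
      (phaseOp n θ₃ s (a₃ s)))‖ ≤ c⁻¹ * (2 * (C * M ^ 3) + 3 * C * M ^ 2 * M' * τ) := by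
  -- The slow amplitudes live in the ball of radius `r`, so the product vanishes outside `G` and the
  -- phase has to be controlled on `G` only.
  set G : Set (Pos3 d) := {z | ‖z.1‖ ≤ r ∧ ‖z.2.1‖ ≤ r ∧ ‖z.2.2‖ ≤ r} with hGdef
  have hG : MeasurableSet G := by
    have h1 : Measurable fun z : Pos3 d => ‖z.1‖ := by fun_prop
    have h2 : Measurable fun z : Pos3 d => ‖z.2.1‖ := by fun_prop
    have h3 : Measurable fun z : Pos3 d => ‖z.2.2‖ := by fun_prop
    exact (measurableSet_le h1 measurable_const).inter
      ((measurableSet_le h2 measurable_const).inter (measurableSet_le h3 measurable_const))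
  have hΦ := measurable_phase4 hμ h₁ h₂ h₃
  have htri := isTri_tri3 (d := d) S.TL
  set Z : ℝ → Lp (CVec n) 1 (volume : Measure (Pos3 d)) := fun s =>
    tri3 S.TL (a₁ s) (a₂ s) (a₃ s) with hZdef
  have hZ : ∀ s, HasDerivAt Z _ s := fun s =>
    htri.hasDerivAt (ha₁.hasDerivAt s) (ha₂.hasDerivAt s) (ha₃.hasDerivAt s)
  have hZ'c := ((htri.continuous ha₁.continuous_deriv ha₂.continuous ha₃.continuous).add
    (htri.continuous ha₁.continuous ha₂.continuous_deriv ha₃.continuous)).add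
    (htri.continuous ha₁.continuous ha₂.continuous ha₃.continuous_deriv)
  have hZG : ∀ s, ∀ᵐ z, z ∉ G → Z s z = 0 := by
    intro s
    filter_upwards [coeFn_tri3 S.TL (a₁ s) (a₂ s) (a₃ s), ae_fst3 (ha₁.ae_eq_zero s),
      ae_snd3 (ha₂.ae_eq_zero s), ae_trd3 (ha₃.ae_eq_zero s)] with z e1 e2 e3 e4 hz
    rw [hZdef]
    simp only
    rw [e1]
    by_cases z1 : ‖z.1‖ ≤ r
    · by_cases z2 : ‖z.2.1‖ ≤ r
      · have z3 : r < ‖z.2.2‖ := by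
          by_contra hcon
          exact hz ⟨z1, z2, not_lt.1 hcon⟩
        rw [e4 z3, map_zero]
      · rw [e3 (not_le.1 z2), map_zero, zero_apply]
    · rw [e2 (not_le.1 z1), map_zero, zero_apply, zero_apply]
  have key := norm_integral_phase_le (n := n) hΦ hG hc (fun z hz => (hcΦ z hz.1 hz.2.1 hz.2.2).1)
    (fun z hz => (hcΦ z hz.1 hz.2.1 hz.2.2).2) hZ hZ'c hZG (z := C * M ^ 3)
    (z' := 3 * C * M ^ 2 * M') (τ := τ) (fun s hs => ?_) (fun s hs => ?_) ht
  · simp only [phaseOp_That S hμ h₁ h₂ h₃]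
    have hcont : Continuous fun s => mulOp volume (phaseSymbol n (phase4 μ θ₁ θ₂ θ₃) s) (Z s) := by
      have hZc : Continuous Z := continuous_iff_continuousAt.2 fun s => (hZ s).continuousAt
      exact continuous_clm_apply_of_strong
        (fun s => opNorm_mulOp_le zero_le_one (norm_phaseSymbol_le _ s)) (fun f =>
        continuous_mulOp_apply (fun s => isSymbol_phaseSymbol hΦ s)
          (fun s k => norm_phaseSymbol_le _ s k) (continuous_phaseSymbol _) f) hZc
    have hcomm := ContinuousLinearMap.intervalIntegral_comp_comm
      (fourierConst d ^ 2 • push (CVec n) d) (hcont.intervalIntegrable (μ := volume) 0 t)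
    simp only [smul_apply] at hcomm
    rw [hcomm, norm_smul]
    have hfc : ‖fourierConst d ^ 2‖ ≤ 1 := by
      rw [norm_pow, Real.norm_of_nonneg (fourierConst_pos d).le]
      exact pow_le_one₀ (fourierConst_pos d).le (fourierConst_le_one d)
    exact (mul_le_of_le_one_left (norm_nonneg _) hfc).trans ((norm_push_le _).trans key)
  · refine (norm_tri3_le hC _ _ _).trans ((mul_three_le hC0 (norm_nonneg _) (norm_nonneg _)
      (norm_nonneg _) (ha₁.norm_le s hs) (ha₂.norm_le s hs) (ha₃.norm_le s hs)).trans_eq (by ring))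
  · have e1 := (norm_tri3_le hC (a₁' s) (a₂ s) (a₃ s)).trans (mul_three_le hC0 (norm_nonneg _)
      (norm_nonneg _) (norm_nonneg _) (ha₁.norm_deriv_le s hs) (ha₂.norm_le s hs)
      (ha₃.norm_le s hs))
    have e2 := (norm_tri3_le hC (a₁ s) (a₂' s) (a₃ s)).trans (mul_three_le hC0 (norm_nonneg _)
      (norm_nonneg _) (norm_nonneg _) (ha₁.norm_le s hs) (ha₂.norm_deriv_le s hs)
      (ha₃.norm_le s hs))
    have e3 := (norm_tri3_le hC (a₁ s) (a₂ s) (a₃' s)).trans (mul_three_le hC0 (norm_nonneg _)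
      (norm_nonneg _) (norm_nonneg _) (ha₁.norm_le s hs) (ha₂.norm_le s hs)
      (ha₃.norm_deriv_le s hs))
    exact norm_add₃_le.trans ((add_le_add_three e1 e2 e3).trans_eq (by ring))

end FriedrichsSystem
end PhaseOp

/-! ### Spectral projections -/

section Proj

variable {n : ℕ}

/-- The orthogonal projection `v ↦ ⟨ψ, v⟩ ψ` for a unit vector `ψ`. -/
def proj (ψ : CVec n) : CVec n →L[ℝ] CVec n :=
  ((innerSL ℂ ψ).smulRight ψ).restrictScalars ℝ

theorem proj_apply (ψ v : CVec n) : proj ψ v = (inner ℂ ψ v : ℂ) • ψ := rfl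

theorem proj_smul (ψ v : CVec n) (c : ℂ) : proj ψ (c • v) = c • proj ψ v := by
  rw [proj_apply, proj_apply, inner_smul_right, smul_smul]

theorem continuous_proj : Continuous (proj (n := n)) := by
  have h : Continuous fun ψ : CVec n => (innerSL ℂ ψ).smulRight ψ := by fun_prop
  exact (ContinuousLinearMap.restrictScalarsL ℂ (CVec n) (CVec n) ℝ ℝ).continuous.comp h

theorem norm_proj_apply_eq {ψ : CVec n} (hψ : ‖ψ‖ = 1) (v : CVec n) :
    ‖proj ψ v‖ = ‖(inner ℂ ψ v : ℂ)‖ := by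
  rw [proj_apply, norm_smul, hψ, mul_one]

theorem norm_proj_le {ψ : CVec n} (hψ : ‖ψ‖ = 1) : ‖proj ψ‖ ≤ 1 :=
  ContinuousLinearMap.opNorm_le_bound _ zero_le_one fun v => by
    rw [norm_proj_apply_eq hψ]
    exact (norm_inner_le_norm ψ v).trans_eq (by rw [hψ])

theorem sum_proj {ψ : Fin n → CVec n} (h : Orthonormal ℂ ψ) (v : CVec n) :
    ∑ m, proj (ψ m) v = v := by
  have hc : Fintype.card (Fin n) = Module.finrank ℂ (CVec n) := by simp
  rcases isEmpty_or_nonempty (Fin n) with hn | hn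
  · exact Subsingleton.elim _ _
  · set b := OrthonormalBasis.mk h (by
      rw [h.linearIndependent.span_eq_top_of_card_eq_finrank hc]) with hb
    have := b.sum_repr' v
    simpa [hb, proj_apply] using this

theorem proj_proj_self {ψ : CVec n} (hψ : ‖ψ‖ = 1) (v : CVec n) :
    proj ψ (proj ψ v) = proj ψ v := by
  rw [proj_apply, proj_apply, inner_smul_right, inner_self_eq_norm_sq_to_K, hψ]
  simp

theorem proj_proj_of_ne {ψ : Fin n → CVec n} (h : Orthonormal ℂ ψ) {i j : Fin n} (hij : i ≠ j)
    (v : CVec n) : proj (ψ i) (proj (ψ j) v) = 0 := by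
  rw [proj_apply, proj_apply, inner_smul_right, h.2 hij, mul_zero, zero_smul]

end Proj

namespace FriedrichsSystem

variable {d n : ℕ} {S : FriedrichsSystem d n} {eig : Fin n → Pos d → ℝ}
  {vec : Fin n → Pos d → CVec n}

namespace IsSmoothEigendecomposition

/-- Continuity away from a single point is enough for measurability. -/
theorem measurable_eig (h : S.IsSmoothEigendecomposition eig vec) (m : Fin n) :
    Measurable (eig m) :=
  measurable_of_continuousOn_compl_singleton 0 (h.smooth_eig m).continuousOn

theorem measurable_vec (h : S.IsSmoothEigendecomposition eig vec) (m : Fin n) :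
    Measurable (vec m) :=
  measurable_of_continuousOn_compl_singleton 0 (h.smooth_vec m).continuousOn

theorem norm_vec (h : S.IsSmoothEigendecomposition eig vec) (m : Fin n) (β : Pos d) :
    ‖vec m β‖ = 1 := (h.orthonormal β).1 m

theorem act_L_proj (h : S.IsSmoothEigendecomposition eig vec) (α : ℝ) (β : Pos d) (m : Fin n)
    (v : CVec n) : act (S.L α β) (proj (vec m β) v) =
      ((eig m β - α : ℝ) : ℂ) • proj (vec m β) v := by
  have h1 := h.eigen m β
  rw [act_L] at h1
  have h2 : act (S.L α β) (vec m β) = ((eig m β - α : ℝ) : ℂ) • vec m β := by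
    rw [act_L, Complex.ofReal_sub, sub_smul, ← h1, Complex.ofReal_zero, zero_smul]
    abel
  rw [proj_apply, act, map_smul]
  change _ • act (S.L α β) (vec m β) = _
  rw [h2, smul_comm]

/-- Expand `v` in the eigenbasis; the orthogonality of the projections leaves the `m`-th term. -/
theorem proj_act_L (h : S.IsSmoothEigendecomposition eig vec) (α : ℝ) (β : Pos d) (m : Fin n)
    (v : CVec n) : proj (vec m β) (act (S.L α β) v) =
      ((eig m β - α : ℝ) : ℂ) • proj (vec m β) v := by
  have h1 : act (S.L α β) v = ∑ j, ((eig j β - α : ℝ) : ℂ) • proj (vec j β) v := by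
    nth_rewrite 1 [← sum_proj (h.orthonormal β) v]
    rw [act, map_sum]
    exact Finset.sum_congr rfl fun j _ => h.act_L_proj α β j v
  rw [h1, map_sum, Finset.sum_eq_single m]
  · rw [proj_smul, proj_proj_self (h.norm_vec m β)]
  · intro j _ hj
    rw [proj_smul, proj_proj_of_ne (h.orthonormal β) hj.symm, smul_zero]
  · simp

/-- On an eigenvector the linear equation is scalar, and uniqueness for the ordinary differential
equation identifies the evolution with an oscillating factor. -/
theorem prop_proj (h : S.IsSmoothEigendecomposition eig vec) {ε : ℝ} (hε : ε ≠ 0) (α : ℝ)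
    (β : Pos d) (t : ℝ) (m : Fin n) (k : Pos d) (v : CVec n) :
    S.prop ε α β t k (proj (vec m (β + ε • k)) v) =
      Complex.exp (Complex.I * ((-((eig m (β + ε • k) - α) / ε) * t : ℝ) : ℂ)) •
        proj (vec m (β + ε • k)) v := by
  set ψ := proj (vec m (β + ε • k)) v with hψ
  set l := eig m (β + ε • k) with hl
  have hg : S.generator ε (k + ε⁻¹ • β) ψ = (Complex.I * l / ε) • ψ := by
    have h1 := S.generator_eq_act_L hε α β k ψ
    rw [hψ, h.act_L_proj α, ← hψ, smul_smul, sub_eq_iff_eq_add, ← add_smul] at h1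
    rw [h1]
    congr 1
    push_cast
    ring
  have hw := S.eq_propagator (ε := ε) (k := k + ε⁻¹ • β)
    (w := fun s : ℝ => Complex.exp (Complex.I * ((-(l / ε) * s : ℝ) : ℂ)) • ψ) (fun s => by
      refine ((hasDerivAt_exp_phase (-(l / ε)) s).smul_const ψ).congr_deriv ?_
      rw [map_smul, hg, smul_smul, ← neg_smul]
      congr 1
      push_cast
      ring) t
  rw [prop_apply]
  simp only [mul_zero, Complex.ofReal_zero, Complex.exp_zero, one_smul] at hw
  rw [← hw, smul_smul, ← Complex.exp_add]
  congr 2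
  push_cast
  ring

theorem proj_prop (h : S.IsSmoothEigendecomposition eig vec) {ε : ℝ} (hε : ε ≠ 0) (α : ℝ)
    (β : Pos d) (t : ℝ) (m : Fin n) (k : Pos d) (v : CVec n) :
    proj (vec m (β + ε • k)) (S.prop ε α β t k v) =
      Complex.exp (Complex.I * ((-((eig m (β + ε • k) - α) / ε) * t : ℝ) : ℂ)) •
        proj (vec m (β + ε • k)) v := by
  nth_rewrite 1 [← sum_proj (h.orthonormal (β + ε • k)) v]
  rw [map_sum, map_sum, Finset.sum_eq_single m]
  · rw [h.prop_proj hε, proj_smul, proj_proj_self (h.norm_vec m _)]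
  · intro j _ hj
    rw [h.prop_proj hε, proj_smul, proj_proj_of_ne (h.orthonormal _) hj.symm, smul_zero]
  · simp

end IsSmoothEigendecomposition

theorem phaseOp_neg_time (θ : Pos d → ℝ) (t : ℝ) :
    phaseOp n θ (-t) = phaseOp n (fun k => -θ k) t := by
  simp only [phaseOp]
  congr 1
  funext k
  simp [phaseSymbol]

/-- The phase velocity of the `m`-th mode in the frame of the carrier wave `(α, β)`. -/
def modePhase (eig : Fin n → Pos d → ℝ) (ε α : ℝ) (β : Pos d) (m : Fin n) (k : Pos d) : ℝ :=
  -((eig m (β + ε • k) - α) / ε)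

/-- The projection to the `m`-th mode in the frame of the carrier wave `(α, β)`. -/
def modeProj (vec : Fin n → Pos d → CVec n) (ε : ℝ) (β : Pos d) (m : Fin n) :
    FreqL1 d n →L[ℝ] FreqL1 d n :=
  mulOp volume fun k => proj (vec m (β + ε • k))

namespace IsSmoothEigendecomposition

theorem measurable_modePhase (h : S.IsSmoothEigendecomposition eig vec) (ε α : ℝ) (β : Pos d)
    (m : Fin n) : Measurable (modePhase eig ε α β m) := by
  have : Measurable fun k : Pos d => eig m (β + ε • k) := (h.measurable_eig m).comp (by fun_prop)
  exact ((this.sub_const α).div_const ε).neg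

theorem isSymbol_modeProj (h : S.IsSmoothEigendecomposition eig vec) (ε : ℝ) (β : Pos d)
    (m : Fin n) : IsSymbol volume fun k => proj (vec m (β + ε • k)) := by
  have : Measurable fun k : Pos d => vec m (β + ε • k) := (h.measurable_vec m).comp (by fun_prop)
  exact ⟨continuous_proj.comp_aestronglyMeasurable this.aestronglyMeasurable, 1,
    fun k => norm_proj_le (h.norm_vec m _)⟩

theorem norm_modeProj_le (h : S.IsSmoothEigendecomposition eig vec) (ε : ℝ) (β : Pos d)
    (m : Fin n) (f : FreqL1 d n) : ‖modeProj vec ε β m f‖ ≤ ‖f‖ :=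
  (norm_mulOp_apply_le zero_le_one (fun _ => norm_proj_le (h.norm_vec m _)) f).trans_eq (one_mul _)

theorem sum_modeProj (h : S.IsSmoothEigendecomposition eig vec) (ε : ℝ) (β : Pos d)
    (f : FreqL1 d n) : ∑ m, modeProj vec ε β m f = f := by
  refine Lp.ext ?_
  have h1 : ∀ᵐ k, ∀ m, modeProj vec ε β m f k = proj (vec m (β + ε • k)) (f k) :=
    ae_all_iff.2 fun m => coeFn_mulOp (h.isSymbol_modeProj ε β m) f
  filter_upwards [h1, Lp.coeFn_finsetSum Finset.univ fun m => modeProj vec ε β m f] with k e1 e2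
  rw [e2, Finset.sum_apply]
  simp only [e1]
  exact sum_proj (h.orthonormal _) _

theorem modeProj_phaseOp (h : S.IsSmoothEigendecomposition eig vec) (ε : ℝ) (β : Pos d)
    (m : Fin n) {θ : Pos d → ℝ} (hθ : Measurable θ) (s : ℝ) (f : FreqL1 d n) :
    modeProj vec ε β m (phaseOp n θ s f) = phaseOp n θ s (modeProj vec ε β m f) := by
  refine mulOp_eq_of_ae (h.isSymbol_modeProj ε β m) ?_
  filter_upwards [coeFn_mulOp (isSymbol_phaseSymbol hθ s) (modeProj vec ε β m f),
    coeFn_mulOp (h.isSymbol_modeProj ε β m) f, coeFn_mulOp (isSymbol_phaseSymbol hθ s) f]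
    with k h1 h2 h3
  rw [phaseOp, h1, modeProj, h2, h3, phaseSymbol, scal_apply, scal_apply, proj_smul]

theorem modeProj_evol (h : S.IsSmoothEigendecomposition eig vec) {ε : ℝ} (hε : ε ≠ 0) (α : ℝ)
    (β : Pos d) (m : Fin n) (t : ℝ) (f : FreqL1 d n) :
    modeProj vec ε β m (S.evol ε α β t f) =
      phaseOp n (modePhase eig ε α β m) t (modeProj vec ε β m f) := by
  refine mulOp_eq_of_ae (h.isSymbol_modeProj ε β m) ?_
  filter_upwards [coeFn_mulOp (isSymbol_phaseSymbol (h.measurable_modePhase ε α β m) t)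
    (modeProj vec ε β m f), coeFn_mulOp (h.isSymbol_modeProj ε β m) f,
    coeFn_mulOp (S.isSymbol_prop ε α β t) f] with k h1 h2 h3
  rw [phaseOp, h1, modeProj, h2, evol, h3, h.proj_prop hε]
  rfl

theorem evol_eq_sum (h : S.IsSmoothEigendecomposition eig vec) {ε : ℝ} (hε : ε ≠ 0) (α : ℝ)
    (β : Pos d) (t : ℝ) (f : FreqL1 d n) :
    S.evol ε α β t f = ∑ m, phaseOp n (modePhase eig ε α β m) t (modeProj vec ε β m f) := by
  rw [← h.sum_modeProj ε β (S.evol ε α β t f)]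
  simp only [h.modeProj_evol hε]

/-- The projections stand outside the phases, so that after integration they can be removed as
contractions and the bare oscillatory integrals remain. -/
theorem evol_neg_eq_sum (h : S.IsSmoothEigendecomposition eig vec) {ε : ℝ} (hε : ε ≠ 0) (α : ℝ)
    (β : Pos d) (t : ℝ) (f : FreqL1 d n) : S.evol ε α β (-t) f =
      ∑ m, modeProj vec ε β m (phaseOp n (fun k => -modePhase eig ε α β m k) t f) := by
  rw [h.evol_eq_sum hε]
  refine Finset.sum_congr rfl fun m _ => ?_
  have hneg : Measurable fun k => -modePhase eig ε α β m k := (h.measurable_modePhase ε α β m).neg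
  rw [h.modeProj_phaseOp ε β m hneg, phaseOp_neg_time]

end IsSmoothEigendecomposition

/-! ### Phases close to a constant -/

/-- `θ` differs from the constant `t` by at most `Λ |k|`. -/
structure IsLipPhase (Λ : ℝ) (θ : Pos d → ℝ) (t : ℝ) : Prop where
  measurable : Measurable θ
  abs_sub_le : ∀ k, |θ k - t| ≤ Λ * ‖k‖

theorem IsLipPhase.neg {Λ t : ℝ} {θ : Pos d → ℝ} (h : IsLipPhase Λ θ t) :
    IsLipPhase Λ (fun k => -θ k) (-t) where
  measurable := h.measurable.neg
  abs_sub_le k := by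
    rw [← neg_sub', abs_neg]; exact h.abs_sub_le k

theorem IsLipPhase.neg_neg {Λ t : ℝ} {θ : Pos d → ℝ} (h : IsLipPhase Λ θ t) :
    IsLipPhase Λ (fun k => -θ (-k)) (-t) where
  measurable := (h.measurable.comp measurable_neg).neg
  abs_sub_le k := by
    rw [← neg_sub', abs_neg, ← norm_neg k]; exact h.abs_sub_le (-k)

theorem IsSmoothEigendecomposition.isLipPhase (h : S.IsSmoothEigendecomposition eig vec) {Λ : ℝ}
    (hΛ : ∀ m β β', |eig m β' - eig m β| ≤ Λ * ‖β' - β‖) {ε : ℝ} (hε : 0 < ε) (α : ℝ) (β : Pos d)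
    (m : Fin n) : IsLipPhase Λ (modePhase eig ε α β m) (-((eig m β - α) / ε)) where
  measurable := h.measurable_modePhase ε α β m
  abs_sub_le k := by
    have h1 : modePhase eig ε α β m k - -((eig m β - α) / ε) =
        -((eig m (β + ε • k) - eig m β) / ε) := by rw [modePhase]; ring
    rw [h1, abs_neg, abs_div, abs_of_pos hε, div_le_iff₀ hε]
    refine (hΛ m β (β + ε • k)).trans_eq ?_
    rw [add_sub_cancel_left, norm_smul, Real.norm_of_nonneg hε.le]
    ring

/-- The output frequency is at most `3 * r` and each of the three inputs at most `r`, whence the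
factor 6. -/
theorem IsLipPhase.phase4_sub_le {Λ : ℝ} (hΛ : 0 ≤ Λ) {μ θ₁ θ₂ θ₃ : Pos d → ℝ} {m t₁ t₂ t₃ : ℝ}
    (hμ : IsLipPhase Λ μ m) (h₁ : IsLipPhase Λ θ₁ t₁) (h₂ : IsLipPhase Λ θ₂ t₂)
    (h₃ : IsLipPhase Λ θ₃ t₃) {r : ℝ} {z : Pos3 d} (z₁ : ‖z.1‖ ≤ r) (z₂ : ‖z.2.1‖ ≤ r)
    (z₃ : ‖z.2.2‖ ≤ r) : |phase4 μ θ₁ θ₂ θ₃ z - (m + t₁ + t₂ + t₃)| ≤ 6 * Λ * r := by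
  have hs : ‖sum3 z‖ ≤ 3 * r := by
    rw [sum3, ← add_assoc]; exact norm_add₃_le.trans (by linarith)
  have e0 := (hμ.abs_sub_le (sum3 z)).trans (mul_le_mul_of_nonneg_left hs hΛ)
  have e1 := (h₁.abs_sub_le z.1).trans (mul_le_mul_of_nonneg_left z₁ hΛ)
  have e2 := (h₂.abs_sub_le z.2.1).trans (mul_le_mul_of_nonneg_left z₂ hΛ)
  have e3 := (h₃.abs_sub_le z.2.2).trans (mul_le_mul_of_nonneg_left z₃ hΛ)
  rw [abs_le] at *
  unfold phase4
  constructor <;> linarith [e0.1, e0.2, e1.1, e1.2, e2.1, e2.2, e3.1, e3.2]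

variable (S)

/-- Nonresonant interactions of modes near the carrier wave vectors. -/
theorem norm_integral_lipPhase_le {C : ℝ} (hC0 : 0 ≤ C)
    (hC : ∀ x y z, ‖S.TL x y z‖ ≤ C * (‖x‖ * ‖y‖ * ‖z‖)) {Λ : ℝ} (hΛ : 0 ≤ Λ)
    {μ θ₁ θ₂ θ₃ : Pos d → ℝ} {m t₁ t₂ t₃ : ℝ}
    (hμ : IsLipPhase Λ μ m) (h₁ : IsLipPhase Λ θ₁ t₁) (h₂ : IsLipPhase Λ θ₂ t₂)
    (h₃ : IsLipPhase Λ θ₃ t₃) {b r M M' τ : ℝ} (hb : 0 < b) (hbt : b ≤ |m + t₁ + t₂ + t₃|)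
    (hr : 6 * Λ * r ≤ b / 2) {a₁ a₁' a₂ a₂' a₃ a₃' : ℝ → FreqL1 d n}
    (ha₁ : IsSlow r M M' τ a₁ a₁') (ha₂ : IsSlow r M M' τ a₂ a₂') (ha₃ : IsSlow r M M' τ a₃ a₃')
    {t : ℝ} (ht : t ∈ Icc 0 τ) :
    ‖∫ s in (0 : ℝ)..t, phaseOp n μ s (S.That (phaseOp n θ₁ s (a₁ s)) (phaseOp n θ₂ s (a₂ s))
      (phaseOp n θ₃ s (a₃ s)))‖ ≤ 2 / b * (2 * (C * M ^ 3) + 3 * C * M ^ 2 * M' * τ) := by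
  -- Half of the gap `b` is given up to the variation of the phase over the frequency ball.
  have h := S.norm_integral_nonresonant_le hC0 hC hμ.measurable h₁.measurable h₂.measurable
    h₃.measurable (c := b / 2) (c' := |m + t₁ + t₂ + t₃| + b / 2) (half_pos hb)
    (fun z z₁ z₂ z₃ => by
      have h4 := (IsLipPhase.phase4_sub_le hΛ hμ h₁ h₂ h₃ z₁ z₂ z₃).trans hr
      have h5 := abs_sub_abs_le_abs_sub (phase4 μ θ₁ θ₂ θ₃ z) (m + t₁ + t₂ + t₃)
      have h6 := abs_sub_abs_le_abs_sub (m + t₁ + t₂ + t₃) (phase4 μ θ₁ θ₂ θ₃ z)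
      rw [abs_sub_comm] at h6
      constructor <;> linarith) ha₁ ha₂ ha₃ ht
  rwa [inv_div] at h

end FriedrichsSystem

/-! ### High-frequency tails. -/

section

variable {d : ℕ} {E F : Type*} [NormedAddCommGroup E] [NormedSpace ℝ E] [NormedAddCommGroup F]
  [NormedSpace ℝ F]

theorem norm_cut_le (r : ℝ) (f : FL d E) : ‖cut E r f‖ ≤ ‖f‖ := by
  refine (norm_mulOp_apply_le zero_le_one (fun k => (norm_smul_le _ _).trans ?_) f).trans_eq
    (one_mul _)
  exact mul_le_one₀ (abs_ballInd_le r k) (norm_nonneg _) ContinuousLinearMap.norm_id_le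

theorem cut_mulOp_comm {φ : Pos d → E →L[ℝ] F} (hφ : IsSymbol volume φ) (r : ℝ) (f : FL d E) :
    cut F r (mulOp volume φ f) = mulOp volume φ (cut E r f) := by
  rw [cut_mulOp hφ, mulOp_cut hφ]

theorem cut_cut (r : ℝ) (f : FL d E) : cut E r (cut E r f) = cut E r f := by
  refine Lp.ext ?_
  filter_upwards [coeFn_cut r (cut E r f), coeFn_cut r f] with k h1 h2
  rw [h1, h2]
  rcases le_or_gt ‖k‖ r with h | h
  · rw [ballInd_of_le h, one_smul, one_smul]
  · rw [ballInd_of_lt h, zero_smul, zero_smul]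

/-- Beyond radius `r` the weight exceeds $r^2$. For `r = ρ / ε` two derivatives make the tail
$O(\varepsilon^2)$. -/
theorem norm_sub_cut_sm_le {n : ℕ} {r : ℝ} (hr : 0 < r) (H : FreqL1 d n) :
    ‖sm d n H - cut (CVec n) r (sm d n H)‖ ≤ (r ^ 2)⁻¹ * ‖H‖ := by
  refine Lp.norm_le_mul_norm_of_ae_le_mul ?_
  filter_upwards [Lp.coeFn_sub (sm d n H) (cut (CVec n) r (sm d n H)),
    coeFn_cut r (sm d n H), coeFn_sm H] with k h1 h2 h3
  rw [h1, Pi.sub_apply, h2, h3]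
  rcases le_or_gt ‖k‖ r with h | h
  · rw [ballInd_of_le h, one_smul, sub_self, norm_zero]
    positivity
  · rw [ballInd_of_lt h, zero_smul, sub_zero, norm_smul,
      Real.norm_of_nonneg (inv_nonneg.2 (wt_pos k).le)]
    refine mul_le_mul_of_nonneg_right (inv_anti₀ (by positivity) ?_) (norm_nonneg _)
    unfold wt
    nlinarith

end

namespace FriedrichsSystem

variable {d n : ℕ}

/-! ### Mode amplitudes of the envelope -/

/-- The spectral hypotheses with explicit constants. -/
structure IsNonresonant (S : FriedrichsSystem d n) (eig : Fin n → Pos d → ℝ)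
    (vec : Fin n → Pos d → CVec n) (ω : ℝ) (κ : Pos d) (ℓ₁ : Fin n) (Λ b ρ C : ℝ) : Prop where
  eigen : S.IsSmoothEigendecomposition eig vec
  lip : ∀ m β β', |eig m β' - eig m β| ≤ Λ * ‖β' - β‖
  lip_nonneg : 0 ≤ Λ
  gap_pos : 0 < b
  radius_pos : 0 < ρ
  radius_small : 6 * Λ * ρ ≤ b / 2
  carrier : eig ℓ₁ κ = ω
  gap : ∀ m, m ≠ ℓ₁ → b ≤ |eig m κ - ω|
  nonres : ∀ j m, b ≤ |(eig j ((3 : ℝ) • κ) - 3 * ω) - (eig m κ - ω)|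
  tri_nonneg : 0 ≤ C
  tri_le : ∀ x y z, ‖S.TL x y z‖ ≤ C * (‖x‖ * ‖y‖ * ‖z‖)

/-- A mild solution of the envelope equation with two derivatives, with explicit bounds. -/
structure IsControlled (S : FriedrichsSystem d n) (ε ω : ℝ) (κ : Pos d) (T M K : ℝ)
    (p : FreqL1 d n) (w : ℝ → FreqL1 d n) : Prop where
  pos : 0 < ε
  le_one : ε ≤ 1
  time_pos : 0 < T
  mild : S.IsMildEnvelope ε ω κ (T / ε) p w
  norm_le : ∀ t ∈ Icc 0 (T / ε), ‖w t‖ ≤ M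
  weighted : ∀ t ∈ Icc 0 (T / ε), ∃ H, ‖H‖ ≤ K ∧ sm d n H = w t

/-- The envelope in the interaction picture. -/
def slowV (S : FriedrichsSystem d n) (ε ω : ℝ) (κ : Pos d) (p : FreqL1 d n) (w : ℝ → FreqL1 d n)
    (t : ℝ) : FreqL1 d n :=
  p + ε • ∫ s in (0 : ℝ)..t, S.evol ε ω κ (-s) (envCubic S.That (w s))

/-- The low-frequency part of the amplitude of the `m`-th mode. -/
def modeAmp (S : FriedrichsSystem d n) (vec : Fin n → Pos d → CVec n) (ε ω : ℝ) (κ : Pos d) (ρ : ℝ)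
    (p : FreqL1 d n) (w : ℝ → FreqL1 d n) (m : Fin n) (t : ℝ) : FreqL1 d n :=
  modeProj vec ε κ m (cut (CVec n) (ρ / ε) (S.slowV ε ω κ p w t))

/-- The derivative of `modeAmp`. -/
def modeAmpDeriv (S : FriedrichsSystem d n) (vec : Fin n → Pos d → CVec n) (ε ω : ℝ) (κ : Pos d)
    (ρ : ℝ) (w : ℝ → FreqL1 d n) (m : Fin n) (t : ℝ) : FreqL1 d n :=
  modeProj vec ε κ m (cut (CVec n) (ρ / ε)
    (ε • S.evol ε ω κ (-t) (envCubic S.That (w t))))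

/-- The contribution of the `m`-th mode to the low-frequency part of the envelope. -/
def modePart (S : FriedrichsSystem d n) (eig : Fin n → Pos d → ℝ) (vec : Fin n → Pos d → CVec n)
    (ε ω : ℝ) (κ : Pos d) (ρ : ℝ) (p : FreqL1 d n) (w : ℝ → FreqL1 d n) (m : Fin n) (t : ℝ) :
    FreqL1 d n :=
  phaseOp n (modePhase eig ε ω κ m) t (S.modeAmp vec ε ω κ ρ p w m t)

/-- The gain of a nonresonant interaction. -/
def oscConst (b C M T : ℝ) : ℝ := 2 / b * (2 * (C * M ^ 3) + 9 * C ^ 2 * M ^ 5 * T)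

theorem cut_evol (S : FriedrichsSystem d n) (ε α : ℝ) (β : Pos d) (r t : ℝ) (f : FreqL1 d n) :
    cut (CVec n) r (S.evol ε α β t f) = S.evol ε α β t (cut (CVec n) r f) :=
  cut_mulOp_comm (S.isSymbol_prop ε α β t) r f

section Estimates

variable {S : FriedrichsSystem d n} {eig : Fin n → Pos d → ℝ} {vec : Fin n → Pos d → CVec n}
  {ω : ℝ} {κ : Pos d} {ℓ₁ : Fin n} {Λ b ρ C : ℝ} {ε T M K : ℝ} {p : FreqL1 d n}
  {w : ℝ → FreqL1 d n}

theorem IsControlled.time_nonneg (h : S.IsControlled ε ω κ T M K p w) : 0 ≤ T / ε :=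
  div_nonneg h.time_pos.le h.pos.le

theorem IsControlled.bound_nonneg (h : S.IsControlled ε ω κ T M K p w) : 0 ≤ M :=
  (norm_nonneg _).trans (h.norm_le 0 ⟨le_rfl, h.time_nonneg⟩)

theorem IsControlled.weight_nonneg (h : S.IsControlled ε ω κ T M K p w) : 0 ≤ K := by
  obtain ⟨H, hH, _⟩ := h.weighted 0 ⟨le_rfl, h.time_nonneg⟩
  exact (norm_nonneg _).trans hH

theorem IsControlled.continuous_forcing (h : S.IsControlled ε ω κ T M K p w) :
    Continuous fun s => S.evol ε ω κ (-s) (envCubic S.That (w s)) :=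
  S.continuous_evol_neg_apply ε ω κ ((continuous_envCubic S.isTri_That).comp h.mild.continuous)

theorem IsControlled.norm_slowV_le (h : S.IsControlled ε ω κ T M K p w) {t : ℝ}
    (ht : t ∈ Icc 0 (T / ε)) : ‖S.slowV ε ω κ p w t‖ ≤ M := by
  rw [← S.norm_evol_apply ε ω κ t]
  refine le_trans (le_of_eq ?_) (h.norm_le t ht)
  rw [h.mild.duhamel t ht]
  rfl

theorem IsNonresonant.norm_envCubic_le (hS : S.IsNonresonant eig vec ω κ ℓ₁ Λ b ρ C)
    {f : FreqL1 d n} (hf : ‖f‖ ≤ M) : ‖envCubic S.That f‖ ≤ 3 * C * M ^ 3 := by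
  have hC := hS.tri_nonneg
  refine ((isCubic_envCubic S.isTri_That hC (S.norm_That_le hS.tri_le)).norm_le f).trans ?_
  have : ‖f‖ ^ 3 ≤ M ^ 3 := by gcongr
  nlinarith

/-- In the interaction picture only the nonlinearity moves the amplitudes, so their derivatives
carry a factor `ε`. -/
theorem IsNonresonant.isSlow (hS : S.IsNonresonant eig vec ω κ ℓ₁ Λ b ρ C)
    (h : S.IsControlled ε ω κ T M K p w) (m : Fin n) :
    IsSlow (ρ / ε) M (3 * C * M ^ 3 * ε) (T / ε) (S.modeAmp vec ε ω κ ρ p w m)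
      (S.modeAmpDeriv vec ε ω κ ρ w m) where
  hasDerivAt s := ((modeProj vec ε κ m).comp (cut (CVec n) (ρ / ε))).hasFDerivAt.comp_hasDerivAt s
    (hasDerivAt_add_smul_integral h.continuous_forcing p ε s)
  continuous_deriv := ((modeProj vec ε κ m).comp (cut (CVec n) (ρ / ε))).continuous.comp
    (h.continuous_forcing.const_smul ε)
  cut_eq s := by
    rw [modeAmp, modeProj, cut_mulOp_comm (hS.eigen.isSymbol_modeProj ε κ m), cut_cut]
  norm_le s hs := (hS.eigen.norm_modeProj_le ε κ m _).trans ((norm_cut_le _ _).trans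
    (h.norm_slowV_le hs))
  norm_deriv_le s hs := by
    refine (hS.eigen.norm_modeProj_le ε κ m _).trans ((norm_cut_le _ _).trans ?_)
    rw [norm_smul, Real.norm_of_nonneg h.pos.le, norm_evol_apply, mul_comm]
    exact mul_le_mul_of_nonneg_right (hS.norm_envCubic_le (h.norm_le s hs)) h.pos.le

theorem IsNonresonant.norm_modePart (hS : S.IsNonresonant eig vec ω κ ℓ₁ Λ b ρ C) (m : Fin n)
    (t : ℝ) : ‖S.modePart eig vec ε ω κ ρ p w m t‖ = ‖S.modeAmp vec ε ω κ ρ p w m t‖ :=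
  norm_phaseOp (hS.eigen.measurable_modePhase ε ω κ m) t _

theorem IsNonresonant.continuous_modePart (hS : S.IsNonresonant eig vec ω κ ℓ₁ Λ b ρ C)
    (h : S.IsControlled ε ω κ T M K p w) (m : Fin n) :
    Continuous (S.modePart eig vec ε ω κ ρ p w m) :=
  continuous_phaseOp_apply (hS.eigen.measurable_modePhase ε ω κ m) (hS.isSlow h m).continuous

theorem IsNonresonant.sum_modePart (hS : S.IsNonresonant eig vec ω κ ℓ₁ Λ b ρ C)
    (h : S.IsControlled ε ω κ T M K p w) {t : ℝ} (ht : t ∈ Icc 0 (T / ε)) :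
    ∑ m, S.modePart eig vec ε ω κ ρ p w m t = cut (CVec n) (ρ / ε) (w t) := by
  rw [h.mild.duhamel t ht, cut_evol, hS.eigen.evol_eq_sum h.pos.ne']
  rfl

theorem IsNonresonant.norm_sub_cut_le (hS : S.IsNonresonant eig vec ω κ ℓ₁ Λ b ρ C)
    (h : S.IsControlled ε ω κ T M K p w) {t : ℝ} (ht : t ∈ Icc 0 (T / ε)) :
    ‖w t - cut (CVec n) (ρ / ε) (w t)‖ ≤ K / ρ ^ 2 * ε ^ 2 := by
  obtain ⟨H, hH, hHw⟩ := h.weighted t ht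
  rw [← hHw]
  have hε := h.pos
  have hρ := hS.radius_pos
  refine (norm_sub_cut_sm_le (div_pos hρ hε) H).trans ?_
  rw [div_pow, inv_div, div_mul_eq_mul_div, div_mul_eq_mul_div, mul_comm K]
  gcongr

/-- Interactions producing the `m`-th mode of the envelope. -/
theorem IsNonresonant.norm_integral_le (hS : S.IsNonresonant eig vec ω κ ℓ₁ Λ b ρ C)
    (h : S.IsControlled ε ω κ T M K p w) {μ θ₁ θ₂ θ₃ : Pos d → ℝ} {m t₁ t₂ t₃ : ℝ}
    (hμ : IsLipPhase Λ μ (m / ε)) (h₁ : IsLipPhase Λ θ₁ (t₁ / ε)) (h₂ : IsLipPhase Λ θ₂ (t₂ / ε))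
    (h₃ : IsLipPhase Λ θ₃ (t₃ / ε)) (hbt : b ≤ |m + t₁ + t₂ + t₃|)
    {a₁ a₁' a₂ a₂' a₃ a₃' : ℝ → FreqL1 d n}
    (ha₁ : IsSlow (ρ / ε) M (3 * C * M ^ 3 * ε) (T / ε) a₁ a₁')
    (ha₂ : IsSlow (ρ / ε) M (3 * C * M ^ 3 * ε) (T / ε) a₂ a₂')
    (ha₃ : IsSlow (ρ / ε) M (3 * C * M ^ 3 * ε) (T / ε) a₃ a₃') {t : ℝ} (ht : t ∈ Icc 0 (T / ε)) :
    ‖∫ s in (0 : ℝ)..t, phaseOp n μ s (S.That (phaseOp n θ₁ s (a₁ s)) (phaseOp n θ₂ s (a₂ s))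
      (phaseOp n θ₃ s (a₃ s)))‖ ≤ oscConst b C M T * ε := by
  have hε := h.pos
  have hb := hS.gap_pos
  refine (S.norm_integral_lipPhase_le hS.tri_nonneg hS.tri_le hS.lip_nonneg hμ h₁ h₂ h₃
    (div_pos hb hε) ?_ ?_ ha₁ ha₂ ha₃ ht).trans_eq ?_
  · rw [← add_div, ← add_div, ← add_div, abs_div, abs_of_pos hε]
    gcongr
  · rw [mul_div_assoc', div_right_comm]
    gcongr
    exact hS.radius_small
  -- The derivative bound $3CM^3\varepsilon$ times the length $T/\varepsilon$ is independent of
  -- $\varepsilon$: $3CM^2\cdot3CM^3\,T=9C^2M^5T$. The gain is $\varepsilon/b$ from the phase.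
  · rw [oscConst]
    field_simp
    ring

theorem IsNonresonant.isLipPhase (hS : S.IsNonresonant eig vec ω κ ℓ₁ Λ b ρ C) (hε : 0 < ε)
    (m : Fin n) : IsLipPhase Λ (modePhase eig ε ω κ m) (-(eig m κ - ω) / ε) := by
  rw [neg_div]; exact hS.eigen.isLipPhase hS.lip hε ω κ m

theorem IsNonresonant.isLipPhase_neg (hS : S.IsNonresonant eig vec ω κ ℓ₁ Λ b ρ C) (hε : 0 < ε)
    (α : ℝ) (β : Pos d) (m : Fin n) :
    IsLipPhase Λ (fun k => -modePhase eig ε α β m k) ((eig m β - α) / ε) := by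
  simpa using (hS.eigen.isLipPhase hS.lip hε α β m).neg

theorem IsNonresonant.isLipPhase_bar (hS : S.IsNonresonant eig vec ω κ ℓ₁ Λ b ρ C) (hε : 0 < ε)
    (m : Fin n) : IsLipPhase Λ (fun k => -modePhase eig ε ω κ m (-k)) ((eig m κ - ω) / ε) := by
  simpa using (hS.eigen.isLipPhase hS.lip hε ω κ m).neg_neg

/-- The carrier mode does not force the other modes. -/
theorem IsNonresonant.norm_integral_envCubic_le (hS : S.IsNonresonant eig vec ω κ ℓ₁ Λ b ρ C)
    (h : S.IsControlled ε ω κ T M K p w) {m : Fin n} (hm : m ≠ ℓ₁) {t : ℝ}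
    (ht : t ∈ Icc 0 (T / ε)) :
    ‖∫ s in (0 : ℝ)..t, phaseOp n (fun k => -modePhase eig ε ω κ m k) s
      (envCubic S.That (S.modePart eig vec ε ω κ ρ p w ℓ₁ s))‖ ≤ 3 * oscConst b C M T * ε := by
  have hε := h.pos
  have hμ := hS.isLipPhase_neg hε ω κ m
  have hθ := hS.isLipPhase hε ℓ₁
  have hθ' := hS.isLipPhase_bar hε ℓ₁
  have ha := hS.isSlow h ℓ₁
  have hb := ha.bar
  -- At zero frequency the three carrier phases vanish because `eig ℓ₁ κ = ω`; what remains is the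
  -- output phase.
  have hgap : ∀ {x : ℝ}, x = eig m κ - ω → b ≤ |x| := fun hx => hx ▸ hS.gap m hm
  have e0 := hS.carrier
  have i1 := hS.norm_integral_le h hμ hθ hθ hθ' (hgap (by rw [e0]; ring)) ha ha hb ht
  have i2 := hS.norm_integral_le h hμ hθ hθ' hθ (hgap (by rw [e0]; ring)) ha hb ha ht
  have i3 := hS.norm_integral_le h hμ hθ' hθ hθ (hgap (by rw [e0]; ring)) hb ha ha ht
  have hA := hS.continuous_modePart h ℓ₁
  have hB := (bar d n).continuous.comp hA
  have hc : ∀ {f g l : ℝ → FreqL1 d n}, Continuous f → Continuous g → Continuous l →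
      IntervalIntegrable (fun s => phaseOp n (fun k => -modePhase eig ε ω κ m k) s
        (S.That (f s) (g s) (l s))) volume 0 t := fun hf hg hl =>
    (continuous_phaseOp_apply hμ.measurable (S.isTri_That.continuous hf hg hl)).intervalIntegrable _ _
  simp only [envCubic, map_add]
  have c1 := hc hA hA hB
  have c2 := hc hA hB hA
  have c3 := hc hB hA hA
  simp only [Function.comp_def] at c1 c2 c3
  rw [intervalIntegral.integral_add (c1.add c2) c3, intervalIntegral.integral_add c1 c2]
  simp only [modePart, bar_phaseOp (hS.eigen.measurable_modePhase ε ω κ ℓ₁)]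
  refine norm_add₃_le.trans ((add_le_add_three i1 i2 i3).trans_eq ?_)
  ring

end Estimates

end FriedrichsSystem
namespace FriedrichsSystem

variable {d n : ℕ} {S : FriedrichsSystem d n} {eig : Fin n → Pos d → ℝ} {vec : Fin n → Pos d → CVec n}
  {ω : ℝ} {κ : Pos d} {ℓ₁ : Fin n} {Λ b ρ C : ℝ} {ε T M K : ℝ} {p : FreqL1 d n}
  {w : ℝ → FreqL1 d n}

/-! ### The modes other than the carrier mode are small -/

theorem oscConst_nonneg (hb : 0 ≤ b) (hC : 0 ≤ C) (hM : 0 ≤ M) (hT : 0 ≤ T) :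
    0 ≤ oscConst b C M T := by
  unfold oscConst; positivity

/-- The total size of the amplitudes of the modes other than the carrier mode. -/
def offSize (S : FriedrichsSystem d n) (vec : Fin n → Pos d → CVec n) (ε ω : ℝ) (κ : Pos d)
    (ρ : ℝ) (p : FreqL1 d n) (w : ℝ → FreqL1 d n) (ℓ₁ : Fin n) (t : ℝ) : ℝ :=
  ∑ m ∈ Finset.univ.erase ℓ₁, ‖S.modeAmp vec ε ω κ ρ p w m t‖

theorem offSize_nonneg (t : ℝ) : 0 ≤ S.offSize vec ε ω κ ρ p w ℓ₁ t :=
  Finset.sum_nonneg fun _ _ => norm_nonneg _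

theorem IsNonresonant.continuous_offSize (hS : S.IsNonresonant eig vec ω κ ℓ₁ Λ b ρ C)
    (h : S.IsControlled ε ω κ T M K p w) : Continuous (S.offSize vec ε ω κ ρ p w ℓ₁) :=
  continuous_finsetSum _ fun m _ => (hS.isSlow h m).continuous.norm

theorem IsNonresonant.sub_eq (hS : S.IsNonresonant eig vec ω κ ℓ₁ Λ b ρ C)
    (h : S.IsControlled ε ω κ T M K p w) {t : ℝ} (ht : t ∈ Icc 0 (T / ε)) :
    w t - S.modePart eig vec ε ω κ ρ p w ℓ₁ t =
      (∑ m ∈ Finset.univ.erase ℓ₁, S.modePart eig vec ε ω κ ρ p w m t) +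
        (w t - cut (CVec n) (ρ / ε) (w t)) := by
  rw [← hS.sum_modePart h ht, ← Finset.add_sum_erase _ _ (Finset.mem_univ ℓ₁)]
  abel

theorem IsNonresonant.norm_sub_le (hS : S.IsNonresonant eig vec ω κ ℓ₁ Λ b ρ C)
    (h : S.IsControlled ε ω κ T M K p w) {t : ℝ} (ht : t ∈ Icc 0 (T / ε)) :
    ‖w t - S.modePart eig vec ε ω κ ρ p w ℓ₁ t‖ ≤
      S.offSize vec ε ω κ ρ p w ℓ₁ t + K / ρ ^ 2 * ε ^ 2 := by
  rw [hS.sub_eq h ht]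
  refine (norm_add_le _ _).trans (add_le_add ((norm_sum_le _ _).trans_eq ?_)
    (hS.norm_sub_cut_le h ht))
  exact Finset.sum_congr rfl fun m _ => hS.norm_modePart m t

theorem IsNonresonant.norm_modePart_le (hS : S.IsNonresonant eig vec ω κ ℓ₁ Λ b ρ C)
    (h : S.IsControlled ε ω κ T M K p w) (m : Fin n) {t : ℝ} (ht : t ∈ Icc 0 (T / ε)) :
    ‖S.modePart eig vec ε ω κ ρ p w m t‖ ≤ M := by
  rw [hS.norm_modePart]; exact (hS.isSlow h m).norm_le t ht

/-- The forcing is split into the cubic term of the carrier part, which oscillates and integrates to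
$O(\varepsilon)$, and a difference controlled by the other modes and the tail. The factor 9 is 3 for
a cubic difference times the three terms of `envCubic`. -/
theorem IsNonresonant.norm_modeAmp_le (hS : S.IsNonresonant eig vec ω κ ℓ₁ Λ b ρ C)
    (h : S.IsControlled ε ω κ T M K p w) {m : Fin n} (hm : m ≠ ℓ₁) {t : ℝ}
    (ht : t ∈ Icc 0 (T / ε)) : ‖S.modeAmp vec ε ω κ ρ p w m t‖ ≤
      ‖modeProj vec ε κ m p‖ + ε * (9 * C * M ^ 2 * (∫ s in (0 : ℝ)..t,
        (S.offSize vec ε ω κ ρ p w ℓ₁ s + K / ρ ^ 2 * ε ^ 2)) + 3 * oscConst b C M T * ε) := by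
  have hε := h.pos
  have hC := hS.tri_nonneg
  have hM := h.bound_nonneg
  set A := S.modePart eig vec ε ω κ ρ p w ℓ₁ with hA
  have hAc : Continuous A := hS.continuous_modePart h ℓ₁
  have hcub := continuous_envCubic S.isTri_That
  have hμ := (hS.isLipPhase_neg hε ω κ m).measurable
  set μ : Pos d → ℝ := fun k => -modePhase eig ε ω κ m k with hμdef
  have hproj : modeProj vec ε κ m (S.slowV ε ω κ p w t) = modeProj vec ε κ m p +
      ε • modeProj vec ε κ m ((∫ s in (0 : ℝ)..t, phaseOp n μ s
        (envCubic S.That (w s) - envCubic S.That (A s))) +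
        ∫ s in (0 : ℝ)..t, phaseOp n μ s (envCubic S.That (A s))) := by
    rw [slowV, map_add, map_smul]
    congr 2
    have hc1 : Continuous fun s => phaseOp n μ s
        (envCubic S.That (w s) - envCubic S.That (A s)) :=
      continuous_phaseOp_apply hμ ((hcub.comp h.mild.continuous).sub (hcub.comp hAc))
    have hc2 : Continuous fun s => phaseOp n μ s (envCubic S.That (A s)) :=
      continuous_phaseOp_apply hμ (hcub.comp hAc)
    have hc3 : Continuous fun s => phaseOp n μ s (envCubic S.That (w s)) :=
      continuous_phaseOp_apply hμ (hcub.comp h.mild.continuous)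
    rw [← intervalIntegral.integral_add (hc1.intervalIntegrable _ _) (hc2.intervalIntegrable _ _)]
    simp only [map_sub, sub_add_cancel]
    rw [← ContinuousLinearMap.intervalIntegral_comp_comm _
        (h.continuous_forcing.intervalIntegrable 0 t),
      ← ContinuousLinearMap.intervalIntegral_comp_comm _
        (hc3.intervalIntegrable 0 t)]
    congr 1
    funext s
    rw [hS.eigen.modeProj_evol hε.ne', phaseOp_neg_time, hS.eigen.modeProj_phaseOp ε κ m hμ]
  -- The cutoff commutes with the mode projection and is a contraction, so it may be dropped here.
  have h1 : ‖S.modeAmp vec ε ω κ ρ p w m t‖ ≤ ‖modeProj vec ε κ m (S.slowV ε ω κ p w t)‖ := by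
    rw [modeAmp, modeProj, ← cut_mulOp_comm (hS.eigen.isSymbol_modeProj ε κ m)]
    exact norm_cut_le _ _
  refine h1.trans ?_
  rw [hproj]
  refine (norm_add_le _ _).trans (add_le_add_right ?_ _)
  rw [norm_smul, Real.norm_of_nonneg hε.le]
  refine mul_le_mul_of_nonneg_left ((hS.eigen.norm_modeProj_le ε κ m _).trans
    ((norm_add_le _ _).trans (add_le_add ?_ (hS.norm_integral_envCubic_le h hm ht)))) hε.le
  rw [← intervalIntegral.integral_const_mul]
  refine norm_integral_le_integral_of_le ht.1 (fun s hs => ?_)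
    (((hS.continuous_offSize h).add continuous_const).const_mul _)
  have hs' : s ∈ Icc 0 (T / ε) := ⟨hs.1, hs.2.trans ht.2⟩
  rw [norm_phaseOp hμ]
  refine ((isCubic_envCubic S.isTri_That hC (S.norm_That_le hS.tri_le)).sub_le _ _ M
    (h.norm_le s hs') (hS.norm_modePart_le h ℓ₁ hs')).trans ?_
  have := mul_le_mul_of_nonneg_left (hS.norm_sub_le h hs')
    (by positivity : 0 ≤ 9 * C * M ^ 2)
  refine le_trans (le_of_eq ?_) this
  ring

/-- The bound for `offSize / ε`. -/
def offConst (n : ℕ) (b ρ C T M K K₀ : ℝ) : ℝ :=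
  n * (K₀ + 9 * C * M ^ 2 * (K / ρ ^ 2) * T + 3 * oscConst b C M T) *
    Real.exp (n * (9 * C * M ^ 2) * T)

/-- Summing over the modes closes a Grönwall inequality with rate of order `ε` on an interval of
length `T / ε`. Hence smallness of order `ε` at time zero persists. -/
theorem IsNonresonant.offSize_le (hS : S.IsNonresonant eig vec ω κ ℓ₁ Λ b ρ C)
    (h : S.IsControlled ε ω κ T M K p w) {K₀ : ℝ} (hK₀ : 0 ≤ K₀)
    (hp : ∀ m, m ≠ ℓ₁ → ‖modeProj vec ε κ m p‖ ≤ K₀ * ε) {t : ℝ} (ht : t ∈ Icc 0 (T / ε)) :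
    S.offSize vec ε ω κ ρ p w ℓ₁ t ≤ offConst n b ρ C T M K K₀ * ε := by
  have hε := h.pos
  have hC := hS.tri_nonneg
  have hM := h.bound_nonneg
  have hK := h.weight_nonneg
  have hρ := hS.radius_pos
  have hT := h.time_pos
  have hO := oscConst_nonneg hS.gap_pos.le hC hM hT.le
  set g := S.offSize vec ε ω κ ρ p w ℓ₁ with hg
  have hgc : Continuous g := hS.continuous_offSize h
  set q := 9 * C * M ^ 2 with hq
  have hq0 : 0 ≤ q := by positivity
  set A₀ := K₀ + q * (K / ρ ^ 2) * T + 3 * oscConst b C M T with hA₀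
  have hA₀0 : 0 ≤ A₀ := by positivity
  have key := le_mul_exp_of_le_integral (φ := g) (A := n * A₀ * ε) (B := ε * (n * q))
    (τ := T / ε) (by positivity) hgc fun t ht => ?_
  · refine (key t ht).trans ?_
    have h1 : ε * (n * q) * t ≤ n * q * T := by
      have := mul_le_mul_of_nonneg_left ht.2 (by positivity : 0 ≤ ε * (n * q))
      refine this.trans_eq ?_
      field_simp
    rw [offConst, mul_right_comm]
    gcongr
  · have hI : 0 ≤ ∫ s in (0 : ℝ)..t, g s :=
      intervalIntegral.integral_nonneg ht.1 fun s _ => offSize_nonneg s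
    have hone : ∀ m ∈ Finset.univ.erase ℓ₁, ‖S.modeAmp vec ε ω κ ρ p w m t‖ ≤
        A₀ * ε + ε * q * ∫ s in (0 : ℝ)..t, g s := by
      intro m hm
      have hm' := Finset.ne_of_mem_erase hm
      refine (hS.norm_modeAmp_le h hm' ht).trans ?_
      rw [intervalIntegral.integral_add (hgc.intervalIntegrable _ _)
        intervalIntegrable_const, intervalIntegral.integral_const, sub_zero, smul_eq_mul]
      -- The tail is $O(\varepsilon^2)$ and time is at most $T/\varepsilon$; the spare power of `ε`
      -- is bounded by 1.
      have h2 : t * (K / ρ ^ 2 * ε ^ 2) ≤ K / ρ ^ 2 * T := by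
        have := mul_le_mul_of_nonneg_right ht.2 (by positivity : 0 ≤ K / ρ ^ 2 * ε ^ 2)
        refine this.trans ?_
        have h3 : T / ε * (K / ρ ^ 2 * ε ^ 2) = K / ρ ^ 2 * T * ε := by field_simp
        rw [h3]
        exact mul_le_of_le_one_right (by positivity) h.le_one
      have h4 : 3 * oscConst b C M T * ε ≤ 3 * oscConst b C M T :=
        mul_le_of_le_one_right (by positivity) h.le_one
      have h5 := mul_le_mul_of_nonneg_left h2 hq0
      have h6 := hp m hm'
      have h7 : ε * (q * (∫ s in (0 : ℝ)..t, g s) + q * (t * (K / ρ ^ 2 * ε ^ 2)) +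
          3 * oscConst b C M T * ε) ≤ ε * (q * (∫ s in (0 : ℝ)..t, g s) + q * (K / ρ ^ 2 * T) +
          3 * oscConst b C M T) := by gcongr
      rw [mul_add q]
      refine (add_le_add h6 h7).trans_eq ?_
      rw [hA₀]; ring
    have hsum := Finset.sum_le_sum hone
    rw [Finset.sum_const, nsmul_eq_mul] at hsum
    have hcard : ((Finset.univ.erase ℓ₁).card : ℝ) ≤ n := by
      have := Finset.card_erase_le (s := Finset.univ) (a := ℓ₁)
      rw [Finset.card_univ, Fintype.card_fin] at this
      exact_mod_cast this
    refine hsum.trans ((mul_le_mul_of_nonneg_right hcard (by positivity)).trans_eq ?_)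
    ring

/-! ### The third harmonic is not generated -/

/-- The condition `hm` encodes that at most one input, `m`, lies outside the carrier mode; `m = ℓ₁`
is allowed. The phases then add up to the difference of an eigenvalue of $\mathcal
L(3\omega,3\kappa)$ and one of $\mathcal L(\omega,\kappa)$. The factor `n` counts the output modes.
-/
theorem IsNonresonant.norm_integral_third_le (hS : S.IsNonresonant eig vec ω κ ℓ₁ Λ b ρ C)
    (h : S.IsControlled ε ω κ T M K p w) {m₁ m₂ m₃ m : Fin n}
    (hm : ∀ {f : Fin n → ℝ}, f ℓ₁ = 0 → f m₁ + f m₂ + f m₃ = f m) {t : ℝ}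
    (ht : t ∈ Icc 0 (T / ε)) :
    ‖∫ s in (0 : ℝ)..t, S.evol ε (3 * ω) ((3 : ℝ) • κ) (-s)
      (S.That (S.modePart eig vec ε ω κ ρ p w m₁ s) (S.modePart eig vec ε ω κ ρ p w m₂ s)
        (S.modePart eig vec ε ω κ ρ p w m₃ s))‖ ≤ n * (oscConst b C M T * ε) := by
  have hε := h.pos
  have hX : Continuous fun s => S.That (S.modePart eig vec ε ω κ ρ p w m₁ s)
      (S.modePart eig vec ε ω κ ρ p w m₂ s) (S.modePart eig vec ε ω κ ρ p w m₃ s) :=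
    S.isTri_That.continuous (hS.continuous_modePart h m₁) (hS.continuous_modePart h m₂)
      (hS.continuous_modePart h m₃)
  have hμ := fun j => hS.isLipPhase_neg hε (3 * ω) ((3 : ℝ) • κ) j
  simp only [hS.eigen.evol_neg_eq_sum hε.ne']
  have hc := fun j => continuous_phaseOp_apply (hμ j).measurable hX
  have hci : ∀ j, Continuous fun s => modeProj vec ε ((3 : ℝ) • κ) j
      (phaseOp n (fun k => -modePhase eig ε (3 * ω) ((3 : ℝ) • κ) j k) s
        (S.That (S.modePart eig vec ε ω κ ρ p w m₁ s) (S.modePart eig vec ε ω κ ρ p w m₂ s)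
          (S.modePart eig vec ε ω κ ρ p w m₃ s))) := fun j =>
    (modeProj vec ε ((3 : ℝ) • κ) j).continuous.comp (hc j)
  rw [intervalIntegral.integral_finsetSum fun j _ => (hci j).intervalIntegrable _ _]
  refine (norm_sum_le_of_le _ (f := fun j => ∫ s in (0 : ℝ)..t, modeProj vec ε ((3 : ℝ) • κ) j
    (phaseOp n (fun k => -modePhase eig ε (3 * ω) ((3 : ℝ) • κ) j k) s
      (S.That (S.modePart eig vec ε ω κ ρ p w m₁ s) (S.modePart eig vec ε ω κ ρ p w m₂ s)
        (S.modePart eig vec ε ω κ ρ p w m₃ s)))) (n := fun _ => oscConst b C M T * ε)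
    fun j _ => ?_).trans_eq (by simp)
  rw [ContinuousLinearMap.intervalIntegral_comp_comm _ ((hc j).intervalIntegrable _ _)]
  refine (hS.eigen.norm_modeProj_le ε _ j _).trans ?_
  refine hS.norm_integral_le h (hμ j) (hS.isLipPhase hε m₁) (hS.isLipPhase hε m₂)
    (hS.isLipPhase hε m₃) ?_ (hS.isSlow h m₁) (hS.isSlow h m₂) (hS.isSlow h m₃) ht
  -- The eigenvalue of the carrier mode relative to `ω` is zero, so only the input `m` contributes.
  have e := hm (f := fun i => -(eig i κ - ω)) (by simp [hS.carrier])
  have e' : eig j ((3 : ℝ) • κ) - 3 * ω + -(eig m₁ κ - ω) + -(eig m₂ κ - ω) + -(eig m₃ κ - ω) =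
      eig j ((3 : ℝ) • κ) - 3 * ω - (eig m κ - ω) := by linarith
  rw [e']
  exact hS.nonres j m

/-- The expansion of a cubic expression to first order. -/
theorem That_expand (a q r x : FreqL1 d n) (hx : x = a + (q + r)) :
    S.That x x x = S.That a a a + (S.That q a a + S.That a q a + S.That a a q) +
      ((S.That r a a + S.That a r a + S.That a a r) +
        (S.That (x - a) (x - a) x + S.That (x - a) a (x - a) + S.That a (x - a) (x - a))) := by
  have hT := S.isTri_That
  have e : x - a = q + r := by rw [hx]; abel
  rw [e, hx]
  simp only [hT.add_left, hT.add_middle, hT.add_right]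
  abel

/-- The bound for the third harmonic. -/
def thirdConst (n : ℕ) (b ρ C T M K K₁ : ℝ) : ℝ :=
  n * oscConst b C M T + n * (3 * (n * oscConst b C M T)) +
    (3 * C * M ^ 2 * (K / ρ ^ 2) + 3 * C * M * (K₁ + K / ρ ^ 2) ^ 2) * T

/-- Terms linear in the other modes are only $O(\varepsilon)$ pointwise in time, which would
integrate to $O(1)$; hence they too must be nonresonant. Terms quadratic in the deviation from the
carrier mode, and those linear in the tail, are small enough by size alone. -/
theorem IsNonresonant.norm_third_harmonic_le (hS : S.IsNonresonant eig vec ω κ ℓ₁ Λ b ρ C)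
    (h : S.IsControlled ε ω κ T M K p w) {K₁ : ℝ}
    (hK₁ : ∀ t ∈ Icc 0 (T / ε), S.offSize vec ε ω κ ρ p w ℓ₁ t ≤ K₁ * ε) {t : ℝ}
    (ht : t ∈ Icc 0 (T / ε)) :
    ‖∫ s in (0 : ℝ)..t, S.evol ε (3 * ω) ((3 : ℝ) • κ) (-s) (S.That (w s) (w s) (w s))‖ ≤
      thirdConst n b ρ C T M K K₁ * ε := by
  have hε := h.pos
  have hC := hS.tri_nonneg
  have hM := h.bound_nonneg
  have hK := h.weight_nonneg
  have hρ := hS.radius_pos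
  have hT := h.time_pos
  have hO := oscConst_nonneg hS.gap_pos.le hC hM hT.le
  have hTri := S.isTri_That
  set X := S.modePart eig vec ε ω κ ρ p w with hX
  set A := X ℓ₁ with hA
  set Q : ℝ → FreqL1 d n := fun s => ∑ m ∈ Finset.univ.erase ℓ₁, X m s with hQ
  -- Carrier mode `A`, other low-frequency modes `Q`, high-frequency tail `R`.
  set R : ℝ → FreqL1 d n := fun s => w s - A s - Q s with hR
  have hXc : ∀ m, Continuous (X m) := hS.continuous_modePart h
  have hwc := h.mild.continuous
  have hQc : Continuous Q := continuous_finsetSum _ fun m _ => hXc m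
  have hRc : Continuous R := (hwc.sub (hXc ℓ₁)).sub hQc
  have hDc : Continuous fun s => w s - A s := hwc.sub (hXc ℓ₁)
  have hexp : ∀ s, S.That (w s) (w s) (w s) = S.That (A s) (A s) (A s) +
      (S.That (Q s) (A s) (A s) + S.That (A s) (Q s) (A s) + S.That (A s) (A s) (Q s)) +
      ((S.That (R s) (A s) (A s) + S.That (A s) (R s) (A s) + S.That (A s) (A s) (R s)) +
        (S.That (w s - A s) (w s - A s) (w s) + S.That (w s - A s) (A s) (w s - A s) +
          S.That (A s) (w s - A s) (w s - A s))) := fun s =>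
    That_expand (A s) (Q s) (R s) (w s) (by simp only [hR]; abel)
  set U : ℝ → FreqL1 d n →L[ℝ] FreqL1 d n := fun s => S.evol ε (3 * ω) ((3 : ℝ) • κ) (-s) with hU
  have hUc := fun (f : ℝ → FreqL1 d n) (hf : Continuous f) =>
    S.continuous_evol_neg_apply ε (3 * ω) ((3 : ℝ) • κ) hf
  have hUn : ∀ s f, ‖U s f‖ = ‖f‖ := fun s f => S.norm_evol_apply ε (3 * ω) ((3 : ℝ) • κ) (-s) f
  set F₁ : ℝ → FreqL1 d n := fun s => S.That (A s) (A s) (A s) with hF₁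
  set F₂ : ℝ → FreqL1 d n := fun s => S.That (Q s) (A s) (A s) + S.That (A s) (Q s) (A s) +
    S.That (A s) (A s) (Q s) with hF₂
  set F₃ : ℝ → FreqL1 d n := fun s => (S.That (R s) (A s) (A s) + S.That (A s) (R s) (A s) +
    S.That (A s) (A s) (R s)) + (S.That (w s - A s) (w s - A s) (w s) +
      S.That (w s - A s) (A s) (w s - A s) + S.That (A s) (w s - A s) (w s - A s)) with hF₃
  have hAc : Continuous A := hXc ℓ₁
  have hF₁c : Continuous F₁ := hTri.continuous hAc hAc hAc
  have hF₂c : Continuous F₂ := ((hTri.continuous hQc hAc hAc).add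
    (hTri.continuous hAc hQc hAc)).add (hTri.continuous hAc hAc hQc)
  have hF₃c : Continuous F₃ := (((hTri.continuous hRc hAc hAc).add
    (hTri.continuous hAc hRc hAc)).add (hTri.continuous hAc hAc hRc)).add
    (((hTri.continuous hDc hDc hwc).add (hTri.continuous hDc hAc hDc)).add
      (hTri.continuous hAc hDc hDc))
  have hF₂s : ∀ s, F₂ s = ∑ m ∈ Finset.univ.erase ℓ₁, (S.That (X m s) (A s) (A s) +
      S.That (A s) (X m s) (A s) + S.That (A s) (A s) (X m s)) := by
    intro s
    obtain ⟨B, hB⟩ := hTri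
    simp only [hF₂, hQ, hB, map_sum, sum_apply, Finset.sum_add_distrib]
  have i1 : ‖∫ s in (0 : ℝ)..t, U s (F₁ s)‖ ≤ n * (oscConst b C M T * ε) :=
    hS.norm_integral_third_le h (m := ℓ₁) (fun hf => by rw [hf]; ring) ht
  -- Each summand has exactly one factor outside the carrier mode, in one of three positions; at
  -- most `n` modes and `n` outputs occur.
  have i2 : ‖∫ s in (0 : ℝ)..t, U s (F₂ s)‖ ≤ n * (3 * (n * (oscConst b C M T * ε))) := by
    have hi : ∀ {f : ℝ → FreqL1 d n}, Continuous f →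
        IntervalIntegrable (fun s => U s (f s)) volume 0 t := fun hf =>
      (hUc _ hf).intervalIntegrable _ _
    have hc1 := fun m => hTri.continuous (hXc m) hAc hAc
    have hc2 := fun m => hTri.continuous hAc (hXc m) hAc
    have hc3 := fun m => hTri.continuous hAc hAc (hXc m)
    simp only [hF₂s, map_sum, map_add]
    rw [intervalIntegral.integral_finsetSum fun m _ =>
      ((hi (hc1 m)).add (hi (hc2 m))).add (hi (hc3 m))]
    refine (norm_sum_le_of_le _ (n := fun _ => 3 * (n * (oscConst b C M T * ε)))
      fun m _ => ?_).trans ?_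
    · rw [intervalIntegral.integral_add ((hi (hc1 m)).add (hi (hc2 m))) (hi (hc3 m)),
        intervalIntegral.integral_add (hi (hc1 m)) (hi (hc2 m))]
      have j1 := hS.norm_integral_third_le h (m₁ := m) (m₂ := ℓ₁) (m₃ := ℓ₁) (m := m)
        (fun hf => by rw [hf]; ring) ht
      have j2 := hS.norm_integral_third_le h (m₁ := ℓ₁) (m₂ := m) (m₃ := ℓ₁) (m := m)
        (fun hf => by rw [hf]; ring) ht
      have j3 := hS.norm_integral_third_le h (m₁ := ℓ₁) (m₂ := ℓ₁) (m₃ := m) (m := m)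
        (fun hf => by rw [hf]; ring) ht
      exact norm_add₃_le.trans ((add_le_add_three j1 j2 j3).trans_eq (by ring))
    · rw [Finset.sum_const, nsmul_eq_mul]
      have hcard : ((Finset.univ.erase ℓ₁).card : ℝ) ≤ n := by
        have := Finset.card_erase_le (s := Finset.univ) (a := ℓ₁)
        rw [Finset.card_univ, Fintype.card_fin] at this
        exact_mod_cast this
      exact mul_le_mul_of_nonneg_right hcard (by positivity)
  -- The integrand is $O(\varepsilon^2)$: either one factor `R`, or two factors `w - A`, each
  -- $O(\varepsilon)$. Integration up to $T/\varepsilon$ loses one power.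
  have i3 : ‖∫ s in (0 : ℝ)..t, U s (F₃ s)‖ ≤
      (3 * C * M ^ 2 * (K / ρ ^ 2) + 3 * C * M * (K₁ + K / ρ ^ 2) ^ 2) * ε ^ 2 * t := by
    refine norm_integral_le_const_mul ht.1 fun s hs => ?_
    have hs' : s ∈ Icc 0 (T / ε) := ⟨hs.1, hs.2.trans ht.2⟩
    rw [hUn]
    have hTn := S.norm_That_le hS.tri_le
    have bA : ‖A s‖ ≤ M := hS.norm_modePart_le h ℓ₁ hs'
    have bw := h.norm_le s hs'
    have bR : ‖R s‖ ≤ K / ρ ^ 2 * ε ^ 2 := by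
      have : R s = w s - cut (CVec n) (ρ / ε) (w s) := by
        simp only [hR, hA, hX, hQ]
        rw [hS.sub_eq h hs']; abel
      rw [this]; exact hS.norm_sub_cut_le h hs'
    have bD : ‖w s - A s‖ ≤ (K₁ + K / ρ ^ 2) * ε := by
      refine (hS.norm_sub_le h hs').trans ?_
      have h1 := hK₁ s hs'
      have h2 : K / ρ ^ 2 * ε ^ 2 ≤ K / ρ ^ 2 * ε :=
        mul_le_mul_of_nonneg_left (by nlinarith [h.le_one]) (by positivity)
      linarith
    have n0 : ∀ f : FreqL1 d n, 0 ≤ ‖f‖ := fun _ => norm_nonneg _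
    have e1 := (hTn (R s) (A s) (A s)).trans (mul_three_le hC (n0 _) (n0 _) (n0 _) bR bA bA)
    have e2 := (hTn (A s) (R s) (A s)).trans (mul_three_le hC (n0 _) (n0 _) (n0 _) bA bR bA)
    have e3 := (hTn (A s) (A s) (R s)).trans (mul_three_le hC (n0 _) (n0 _) (n0 _) bA bA bR)
    have e4 := (hTn (w s - A s) (w s - A s) (w s)).trans
      (mul_three_le hC (n0 _) (n0 _) (n0 _) bD bD bw)
    have e5 := (hTn (w s - A s) (A s) (w s - A s)).trans
      (mul_three_le hC (n0 _) (n0 _) (n0 _) bD bA bD)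
    have e6 := (hTn (A s) (w s - A s) (w s - A s)).trans
      (mul_three_le hC (n0 _) (n0 _) (n0 _) bA bD bD)
    refine (norm_add_le _ _).trans ((add_le_add (norm_add₃_le.trans (add_le_add_three e1 e2 e3))
      (norm_add₃_le.trans (add_le_add_three e4 e5 e6))).trans_eq ?_)
    ring
  have hsplit : ∫ s in (0 : ℝ)..t, S.evol ε (3 * ω) ((3 : ℝ) • κ) (-s) (S.That (w s) (w s) (w s)) =
      (∫ s in (0 : ℝ)..t, U s (F₁ s)) + (∫ s in (0 : ℝ)..t, U s (F₂ s)) +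
        ∫ s in (0 : ℝ)..t, U s (F₃ s) := by
    have c1 := (hUc _ hF₁c).intervalIntegrable (μ := volume) 0 t
    have c2 := (hUc _ hF₂c).intervalIntegrable (μ := volume) 0 t
    have c3 := (hUc _ hF₃c).intervalIntegrable (μ := volume) 0 t
    rw [← intervalIntegral.integral_add c1 c2, ← intervalIntegral.integral_add (c1.add c2) c3]
    simp only [hexp, map_add, hF₁, hF₂, hF₃]
  rw [hsplit]
  refine norm_add₃_le.trans ((add_le_add_three i1 i2 i3).trans ?_)
  have h8 : (3 * C * M ^ 2 * (K / ρ ^ 2) + 3 * C * M * (K₁ + K / ρ ^ 2) ^ 2) * ε ^ 2 * t ≤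
      (3 * C * M ^ 2 * (K / ρ ^ 2) + 3 * C * M * (K₁ + K / ρ ^ 2) ^ 2) * ε ^ 2 * (T / ε) :=
    mul_le_mul_of_nonneg_left ht.2 (by positivity)
  refine (add_le_add_right h8 _).trans_eq ?_
  rw [thirdConst]
  field_simp

end FriedrichsSystem

variable {d n : ℕ}

/-! ### Polarized initial data -/

theorem continuous_invFourier (f : FreqL1 d n) : Continuous (invFourier d n f) := by
  have h : Continuous fun x : Pos d => ∫ k, chr x k • f k := by
    refine continuous_of_dominated (bound := fun k => ‖f k‖) (fun x => ?_) (fun x => ?_)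
      (L1.integrable_coeFn f).norm ?_
    · exact (continuous_chr x).aestronglyMeasurable.smul (L1.integrable_coeFn f).1
    · exact ae_of_all _ fun k => by rw [norm_smul, norm_chr, one_mul]
    · refine ae_of_all _ fun k => ?_
      unfold chr
      fun_prop
  rw [show invFourier d n f = fun x => fourierConst d • ∫ k, chr x k • f k from
    funext (invFourier_eq' f)]
  exact h.const_smul (fourierConst d)

/-- A constant matrix commutes with the Fourier transform. The continuous function $Bp$ vanishes
everywhere once it vanishes almost everywhere, and injectivity applies. -/
theorem ae_act_hat_eq_zero {B : Matrix (Fin n) (Fin n) ℂ} {p : Wiener d n}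
    (h : ∀ᵐ x, act B (p x) = 0) : ∀ᵐ k, act B (p.hat k) = 0 := by
  set A : CVec n →L[ℂ] CVec n := Matrix.toEuclideanCLM (n := Fin n) (𝕜 := ℂ) B with hA
  have h0 : mulOp volume (fun _ => A.restrictScalars ℝ) p.hat = 0 := by
    refine invFourier_ext fun x => ?_
    have h1 : (invFourier d n (mulOp volume (fun _ => A.restrictScalars ℝ) p.hat)) =
        fun _ => 0 := by
      refine (Continuous.ae_eq_iff_eq volume (continuous_invFourier _) continuous_const).1 ?_
      filter_upwards [h] with x hx
      rw [FriedrichsSystem.invFourier_mulOp_const, ← Wiener.coe_eq]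
      exact hx
    rw [h1, map_zero]; rfl
  filter_upwards [coeFn_mulOp (isSymbol_const (A.restrictScalars ℝ)) p.hat,
    Lp.coeFn_zero (CVec n) 1 (volume : Measure (Pos d))] with k h1 h2
  rw [h0, h2] at h1
  exact h1.symm

namespace FriedrichsSystem

variable {S : FriedrichsSystem d n} {eig : Fin n → Pos d → ℝ} {vec : Fin n → Pos d → CVec n}
  {ω : ℝ} {κ : Pos d} {ℓ₁ : Fin n}

theorem act_L_add (S : FriedrichsSystem d n) (α : ℝ) (β γ : Pos d) (v : CVec n) :
    act (S.L α (β + γ)) v = act (S.L α β) v + act (S.symbol γ) v := by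
  rw [act_L, act_L, act_symbol_add]; abel

/-- Away from the carrier mode, polarized data have small components. -/
theorem IsSmoothEigendecomposition.norm_modeProj_le_of_act_eq_zero
    (h : S.IsSmoothEigendecomposition eig vec) {m : Fin n} {c : ℝ} (hc : 0 < c)
    (hgap : ∀ β, c ≤ |ω - eig m β|) {P : FreqL1 d n}
    (hP : ∀ᵐ k, act (S.L ω κ) (sm d n P k) = 0) {ε : ℝ} (hε : 0 ≤ ε) :
    ‖modeProj vec ε κ m (sm d n P)‖ ≤ S.symbolBound / c * ‖P‖ * ε := by
  have hsb := S.symbolBound_nonneg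
  rw [mul_right_comm]
  refine Lp.norm_le_mul_norm_of_ae_le_mul ?_
  filter_upwards [hP, coeFn_mulOp (h.isSymbol_modeProj ε κ m) (sm d n P), coeFn_sm P]
    with k h1 h2 h3
  rw [modeProj, h2]
  set v := sm d n P k with hv
  set ψ := vec m (κ + ε • k) with hψ
  -- Polarization annihilates the part at `κ`, leaving only $\varepsilon A(k)$. Comparing with the
  -- eigenvalue, which is at least `c` in modulus, bounds the component by $\varepsilon|k|\,|v|$ up
  -- to constants.
  have h4 : act (S.L ω (κ + ε • k)) v = (ε : ℂ) • act (S.symbol k) v := by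
    rw [act_L_add, h1, zero_add, act_symbol_smul]
  have h5 := h.proj_act_L ω (κ + ε • k) m v
  rw [h4, ← hψ] at h5
  have h6 : |ω - eig m (κ + ε • k)| * ‖proj ψ v‖ ≤ ε * (S.symbolBound * ‖k‖ * ‖v‖) := by
    have h7 := congrArg norm h5
    rw [norm_smul, Complex.norm_real, Real.norm_eq_abs, abs_sub_comm] at h7
    rw [← h7]
    refine ((proj ψ).le_opNorm _).trans ((mul_le_mul_of_nonneg_right
      (norm_proj_le (h.norm_vec m _)) (norm_nonneg _)).trans ?_)
    rw [one_mul, norm_smul, Complex.norm_real, Real.norm_of_nonneg hε]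
    exact mul_le_mul_of_nonneg_left (S.norm_act_symbol_le k v) hε
  -- The loss of one power of `k` is paid for by the regularity of the datum.
  have h8 : ‖k‖ * ‖v‖ ≤ ‖P k‖ := by
    rw [h3, norm_smul, Real.norm_of_nonneg (inv_nonneg.2 (wt_pos k).le), ← mul_assoc,
      ← div_eq_mul_inv]
    exact mul_le_of_le_one_left (norm_nonneg _) ((div_le_one (wt_pos k)).2 (norm_le_wt k))
  have h9 := (mul_le_mul_of_nonneg_right (hgap (κ + ε • k)) (norm_nonneg (proj ψ v))).trans h6
  rw [div_mul_eq_mul_div, div_mul_eq_mul_div, le_div_iff₀ hc, mul_comm]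
  refine h9.trans ?_
  have := mul_le_mul_of_nonneg_left h8 (mul_nonneg hsb hε)
  linarith

/-! ### The nonresonance conditions -/

theorem IsSmoothEigendecomposition.act_L_vec (h : S.IsSmoothEigendecomposition eig vec) (α : ℝ)
    (β : Pos d) (m : Fin n) : act (S.L α β) (vec m β) = ((eig m β - α : ℝ) : ℂ) • vec m β := by
  have h1 := h.act_L_proj α β m (vec m β)
  have h2 : proj (vec m β) (vec m β) = vec m β := by
    rw [proj_apply, inner_self_eq_norm_sq_to_K, h.norm_vec]; simp
  rwa [h2] at h1

theorem IsSmoothEigendecomposition.mem_spectrum (h : S.IsSmoothEigendecomposition eig vec) (α : ℝ)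
    (β : Pos d) (m : Fin n) : ((eig m β - α : ℝ) : ℂ) ∈ spectrum ℂ (S.L α β) := by
  rw [spectrum.mem_iff]
  intro hu
  obtain ⟨B, hB⟩ := hu.exists_left_inv
  have h1 : act (algebraMap ℂ (Matrix (Fin n) (Fin n) ℂ) ((eig m β - α : ℝ) : ℂ) - S.L α β)
      (vec m β) = 0 := by
    rw [Algebra.algebraMap_eq_smul_one, sub_eq_add_neg, ← neg_one_smul ℂ (S.L α β), act_add_left,
      act_smul_left, act_smul_left, act_one, h.act_L_vec, neg_one_smul, add_neg_cancel]
  have h2 := congrArg (act B) h1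
  have h3 : act B (act (algebraMap ℂ (Matrix (Fin n) (Fin n) ℂ) ((eig m β - α : ℝ) : ℂ) - S.L α β)
      (vec m β)) = vec m β := by
    refine Eq.trans ?_ (act_one (vec m β))
    rw [← hB]
    simp only [act, map_mul]
    rfl
  rw [h3] at h2
  have h4 := h.norm_vec m β
  rw [h2] at h4
  simp [act] at h4

theorem _root_.Finite.exists_pos_forall_le {ι : Type*} [Finite ι] {f : ι → ℝ}
    (hf : ∀ i, 0 < f i) : ∃ b, 0 < b ∧ ∀ i, b ≤ f i := by
  rcases isEmpty_or_nonempty ι with hι | hι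
  · exact ⟨1, one_pos, fun i => hι.elim i⟩
  · obtain ⟨i, hi⟩ := Finite.exists_min f
    exact ⟨f i, hf i, hi⟩

/-- Disjoint spectra make finitely many eigenvalue differences nonzero, hence bounded below
together. The pairs with `m = ℓ₁` bound the eigenvalues of $\mathcal L(3\omega,3\kappa)$ away from
zero. -/
theorem IsSmoothEigendecomposition.exists_isNonresonant
    (h : S.IsSmoothEigendecomposition eig vec)
    (hLip : ∃ C : ℝ, ∀ ℓ β β', |eig ℓ β' - eig ℓ β| ≤ C * ∑ μ, |β' μ - β μ|)
    (hω : ω = eig ℓ₁ κ)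
    (hgap : ∃ c : ℝ, 0 < c ∧ ∀ β, ∀ ℓ, ℓ ≠ ℓ₁ → c ≤ |ω - eig ℓ β|)
    (hres : Disjoint (spectrum ℂ (S.L (3 * ω) ((3 : ℝ) • κ))) (spectrum ℂ (S.L ω κ))) :
    ∃ Λ b ρ C, S.IsNonresonant eig vec ω κ ℓ₁ Λ b ρ C := by
  obtain ⟨C₀, hC₀⟩ := hLip
  obtain ⟨c, hc, hgap⟩ := hgap
  obtain ⟨C, hC0, hC⟩ := IsTri.bound (B := fun a b c => S.TL a b c) ⟨S.TL, fun _ _ _ => rfl⟩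
  obtain ⟨b, hb, hbr⟩ := Finite.exists_pos_forall_le
    (f := fun i : Fin n × Fin n => |(eig i.1 ((3 : ℝ) • κ) - 3 * ω) - (eig i.2 κ - ω)|)
    fun i => abs_pos.2 fun h0 => Set.disjoint_left.1 hres (h.mem_spectrum (3 * ω) _ i.1)
      (by rw [sub_eq_zero.1 h0]; exact h.mem_spectrum ω κ i.2)
  have hΛ : 0 ≤ |C₀| * d := by positivity
  have hcb : 0 < min c b := lt_min hc hb
  -- The factor `d` compares the $\ell^1$ norm with the Euclidean one. The radius is chosen for `6 *
  -- Λ * ρ ≤ b / 2`, with `+ 1` to allow `Λ = 0`.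
  refine ⟨|C₀| * d, min c b, min c b / (12 * (|C₀| * d + 1)), C, h, fun m β β' => ?_, hΛ, hcb,
    by positivity, ?_, hω.symm, fun m hm => ?_, fun j m => ?_, hC0, hC⟩
  · refine (hC₀ m β β').trans ((mul_le_mul_of_nonneg_right (le_abs_self C₀)
      (Finset.sum_nonneg fun _ _ => abs_nonneg _)).trans ?_)
    rw [mul_assoc]
    refine mul_le_mul_of_nonneg_left ((Finset.sum_le_card_nsmul _ _ ‖β' - β‖ fun μ _ => ?_).trans_eq
      (by simp)) (abs_nonneg _)
    exact PiLp.norm_apply_le (β' - β) μ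
  · rw [mul_div_assoc', div_le_iff₀ (by positivity)]
    nlinarith
  · rw [abs_sub_comm]; exact (min_le_left _ _).trans (hgap κ m hm)
  · exact (min_le_right _ _).trans (hbr (j, m))

/-! ### Multiplication with the carrier wave -/

theorem That_smul (S : FriedrichsSystem d n) (x y z : ℂ) (f g h : FreqL1 d n) :
    S.That (x • f) (y • g) (z • h) = (x * y * z) • S.That f g h :=
  invFourier_ext fun v => by
    rw [invFourier_That]
    simp only [map_smul, Pi.smul_apply]
    rw [TC_smul, invFourier_That]

/-- Multiplication with the carrier wave `e^{i(κ·x - ωt)/ε}`, on the Fourier side. -/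
def carry (n : ℕ) (ε ω : ℝ) (κ : Pos d) (t : ℝ) (f : FreqL1 d n) : FreqL1 d n :=
  Complex.exp (-(Complex.I * ω / ε * t)) • shift _ (ε⁻¹ • κ) f

theorem invFourier_carry (ε ω : ℝ) (κ : Pos d) (t : ℝ) (f : FreqL1 d n) (x : Pos d) :
    invFourier d n (carry n ε ω κ t f) x =
      Complex.exp (Complex.I * ((inner ℝ κ x : ℝ) - ω * t) / ε) • invFourier d n f x := by
  rw [carry, map_smul, Pi.smul_apply, invFourier_shift, chr_inv_smul, smul_smul,
    ← Complex.exp_add]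
  congr 2
  ring

theorem bar_carry (ε ω : ℝ) (κ : Pos d) (t : ℝ) (f : FreqL1 d n) :
    bar d n (carry n ε ω κ t f) = carry n ε (-ω) (-κ) t (bar d n f) :=
  invFourier_ext fun x => by
    rw [invFourier_bar, invFourier_carry, conjVec_smul, invFourier_carry, invFourier_bar,
      ← Complex.exp_conj]
    congr 2
    simp only [map_div₀, map_mul, map_sub, Complex.conj_I, Complex.conj_ofReal, inner_neg_left]
    push_cast
    ring

theorem carry_add (ε ω : ℝ) (κ : Pos d) (t : ℝ) (f g : FreqL1 d n) :
    carry n ε ω κ t (f + g) = carry n ε ω κ t f + carry n ε ω κ t g := by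
  rw [carry, map_add, smul_add]; rfl

theorem That_carry (S : FriedrichsSystem d n) (ε a₁ a₂ a₃ : ℝ) (b₁ b₂ b₃ : Pos d) (t : ℝ)
    (f g h : FreqL1 d n) :
    S.That (carry n ε a₁ b₁ t f) (carry n ε a₂ b₂ t g) (carry n ε a₃ b₃ t h) =
      carry n ε (a₁ + a₂ + a₃) (b₁ + b₂ + b₃) t (S.That f g h) := by
  rw [carry, carry, carry, That_smul, shift_That, carry, ← Complex.exp_add, ← Complex.exp_add,
    ← smul_add, ← smul_add]
  congr 2
  push_cast
  ring

theorem norm_carry (ε ω : ℝ) (κ : Pos d) (t : ℝ) (f : FreqL1 d n) :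
    ‖carry n ε ω κ t f‖ = ‖f‖ := by
  rw [carry, norm_smul, norm_shift, Complex.norm_exp]
  simp

theorem continuous_carry (ε ω : ℝ) (κ : Pos d) {f : ℝ → FreqL1 d n} (hf : Continuous f) :
    Continuous fun t => carry n ε ω κ t (f t) := by
  have h1 : Continuous fun t => shift (CVec n) (ε⁻¹ • κ) (f t) := (shift _ _).continuous.comp hf
  have h2 : Continuous fun t : ℝ => Complex.exp (-(Complex.I * ω / ε * t)) := by fun_prop
  exact h2.smul h1

theorem evol_shift_eq_carry (S : FriedrichsSystem d n) (ε ω : ℝ) (κ : Pos d) (t : ℝ)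
    (f : FreqL1 d n) : S.evol ε 0 0 t (shift _ (ε⁻¹ • κ) f) =
      carry n ε ω κ t (S.evol ε ω κ t f) :=
  S.evol_shift ε ω κ t f

/-- In the frame of its carrier the time oscillation is absorbed by the evolution; only the
translation to the carrier wave vector remains. -/
theorem evol_neg_carry (S : FriedrichsSystem d n) (ε ω : ℝ) (κ : Pos d) (t : ℝ)
    (f : FreqL1 d n) : S.evol ε 0 0 (-t) (carry n ε ω κ t f) =
      shift _ (ε⁻¹ • κ) (S.evol ε ω κ (-t) f) := by
  rw [← S.evol_evol_neg ε ω κ t f, ← evol_shift_eq_carry, evol_neg_evol, evol_evol_neg]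

/-- Two carriers and one conjugate carrier multiply to the same carrier; this singles out the three
terms of the envelope equation. -/
theorem envCubic_carry (S : FriedrichsSystem d n) (ε ω : ℝ) (κ : Pos d) (t : ℝ)
    (f : FreqL1 d n) : envCubic S.That (carry n ε ω κ t f) =
      carry n ε ω κ t (envCubic S.That f) := by
  simp only [envCubic, bar_carry, That_carry, carry_add]
  simp

/-- The cubic nonlinearity at `f` plus its conjugate. -/
theorem That_add_bar (S : FriedrichsSystem d n) (f : FreqL1 d n) :
    S.That (f + bar d n f) (f + bar d n f) (f + bar d n f) =
      (envCubic S.That f + bar d n (envCubic S.That f)) +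
        (S.That f f f + bar d n (S.That f f f)) := by
  have hT := S.isTri_That
  simp only [envCubic, map_add, bar_That, bar_bar, hT.add_left, hT.add_middle, hT.add_right]
  abel

/-- Duhamel's formula for the approximation. -/
theorem IsMildEnvelope.evol_neg_approx {ε τ : ℝ} {p : FreqL1 d n} {w : ℝ → FreqL1 d n}
    (h : S.IsMildEnvelope ε ω κ τ p w) {t : ℝ} (ht : t ∈ Icc 0 τ) {Z : ℝ → FreqL1 d n}
    (hZ : Z = fun s => carry n ε ω κ s (w s) + bar d n (carry n ε ω κ s (w s))) :
    S.evol ε 0 0 (-t) (Z t) =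
      (initHat κ ε p + ε • ∫ s in (0 : ℝ)..t, S.evol ε 0 0 (-s) (S.That (Z s) (Z s) (Z s))) -
        ε • (shift _ (ε⁻¹ • (3 : ℝ) • κ) (∫ s in (0 : ℝ)..t,
            S.evol ε (3 * ω) ((3 : ℝ) • κ) (-s) (S.That (w s) (w s) (w s))) +
          bar d n (shift _ (ε⁻¹ • (3 : ℝ) • κ) (∫ s in (0 : ℝ)..t,
            S.evol ε (3 * ω) ((3 : ℝ) • κ) (-s) (S.That (w s) (w s) (w s))))) := by
  have hw := h.continuous
  set Y : ℝ → FreqL1 d n := fun s => carry n ε ω κ s (w s) with hY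
  have hYc : Continuous Y := continuous_carry ε ω κ hw
  set F : ℝ → FreqL1 d n := fun s => S.evol ε 0 0 (-s) (envCubic S.That (Y s)) with hF
  set G : ℝ → FreqL1 d n := fun s => S.evol ε 0 0 (-s) (S.That (Y s) (Y s) (Y s)) with hG
  have hFc : Continuous F :=
    S.continuous_evol_neg_apply ε 0 0 ((continuous_envCubic S.isTri_That).comp hYc)
  have hGc : Continuous G :=
    S.continuous_evol_neg_apply ε 0 0 (S.isTri_That.continuous hYc hYc hYc)
  have hbar : ∀ {f : ℝ → FreqL1 d n}, Continuous f → Continuous fun s => bar d n (f s) :=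
    fun hf => (bar d n).continuous.comp hf
  -- Of the eight terms of the full nonlinearity, `F` and its conjugate are accounted for by the
  -- envelope equation; `G` and its conjugate are the third harmonics, the whole defect.
  have hsplit : ∀ s, S.evol ε 0 0 (-s) (S.That (Z s) (Z s) (Z s)) =
      (F s + bar d n (F s)) + (G s + bar d n (G s)) := by
    intro s
    simp only [hZ, That_add_bar, map_add, hF, hG, hY, bar_evol]
  have hFs : ∀ s, F s = shift _ (ε⁻¹ • κ) (S.evol ε ω κ (-s) (envCubic S.That (w s))) := by
    intro s
    simp only [hF, hY, envCubic_carry, evol_neg_carry]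
  have hGs : ∀ s, G s = shift _ (ε⁻¹ • (3 : ℝ) • κ)
      (S.evol ε (3 * ω) ((3 : ℝ) • κ) (-s) (S.That (w s) (w s) (w s))) := by
    intro s
    have h3 : κ + κ + κ = (3 : ℝ) • κ := by module
    have h3' : ω + ω + ω = 3 * ω := by ring
    simp only [hG, hY, That_carry, evol_neg_carry, h3, h3']
  have hE : Continuous fun s => S.evol ε ω κ (-s) (envCubic S.That (w s)) :=
    S.continuous_evol_neg_apply ε ω κ ((continuous_envCubic S.isTri_That).comp hw)
  have hE3 : Continuous fun s => S.evol ε (3 * ω) ((3 : ℝ) • κ) (-s) (S.That (w s) (w s) (w s)) :=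
    S.continuous_evol_neg_apply ε (3 * ω) ((3 : ℝ) • κ) (S.isTri_That.continuous hw hw hw)
  have hYt : S.evol ε 0 0 (-t) (Y t) =
      shift _ (ε⁻¹ • κ) p + ε • ∫ s in (0 : ℝ)..t, F s := by
    simp only [hY, evol_neg_carry]
    rw [h.duhamel t ht, evol_neg_evol, map_add, map_smul,
      ← ContinuousLinearMap.intervalIntegral_comp_comm _ (hE.intervalIntegrable 0 t)]
    simp only [hFs]
  have hGint : shift _ (ε⁻¹ • (3 : ℝ) • κ) (∫ s in (0 : ℝ)..t,
      S.evol ε (3 * ω) ((3 : ℝ) • κ) (-s) (S.That (w s) (w s) (w s))) =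
        ∫ s in (0 : ℝ)..t, G s := by
    rw [← ContinuousLinearMap.intervalIntegral_comp_comm _ (hE3.intervalIntegrable 0 t)]
    simp only [hGs]
  have hint : ∫ s in (0 : ℝ)..t, S.evol ε 0 0 (-s) (S.That (Z s) (Z s) (Z s)) =
      ((∫ s in (0 : ℝ)..t, F s) + bar d n (∫ s in (0 : ℝ)..t, F s)) +
        ((∫ s in (0 : ℝ)..t, G s) + bar d n (∫ s in (0 : ℝ)..t, G s)) := by
    have i1 := hFc.intervalIntegrable (μ := volume) 0 t
    have i2 := (hbar hFc).intervalIntegrable (μ := volume) 0 t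
    have i3 := hGc.intervalIntegrable (μ := volume) 0 t
    have i4 := (hbar hGc).intervalIntegrable (μ := volume) 0 t
    simp only [hsplit]
    rw [intervalIntegral.integral_add (i1.add i2) (i3.add i4), intervalIntegral.integral_add i1 i2,
      intervalIntegral.integral_add i3 i4, ContinuousLinearMap.intervalIntegral_comp_comm _ i1,
      ContinuousLinearMap.intervalIntegral_comp_comm _ i3]
  rw [hGint, hint, initHat]
  have hZt : S.evol ε 0 0 (-t) (Z t) = S.evol ε 0 0 (-t) (Y t) +
      bar d n (S.evol ε 0 0 (-t) (Y t)) := by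
    simp only [hZ, hY, map_add, bar_evol]
  rw [hZt, hYt, map_add, map_smul]
  module

end FriedrichsSystem
namespace FriedrichsSystem

variable {d n : ℕ} {S : FriedrichsSystem d n} {eig : Fin n → Pos d → ℝ}
  {vec : Fin n → Pos d → CVec n} {ω : ℝ} {κ : Pos d} {ℓ₁ : Fin n}

/-! ### The error bound -/

/-- Duhamel's formula for mild solutions, on the Fourier side. -/
theorem IsMildSolution.evol_neg_hat {ε τ : ℝ} {p : Wiener d n}
    {u : ℝ → Wiener d n} (h : S.IsMildSolution κ ε τ (fun x => p x) u) {t : ℝ}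
    (ht : t ∈ Icc 0 τ) {f : ℝ → FreqL1 d n} (hf : Continuous f)
    (hfu : ∀ s ∈ Icc 0 τ, f s = (u s).hat) :
    S.evol ε 0 0 (-t) (f t) = initHat κ ε p.hat +
      ε • ∫ s in (0 : ℝ)..t, S.evol ε 0 0 (-s) (S.That (f s) (f s) (f s)) := by
  obtain ⟨N, hN, hd⟩ := h.duhamel
  have h0 : (u 0).hat = initHat κ ε p.hat := invFourier_ext fun x => by
    rw [invFourier_initHat, ← Wiener.coe_eq]
    exact h.initial x
  have hNf : ∀ s ∈ Icc 0 τ, (N s).hat = S.That (f s) (f s) (f s) := fun s hs =>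
    invFourier_ext fun x => by
      rw [invFourier_That, hfu s hs, ← Wiener.coe_eq, ← Wiener.coe_eq]
      exact hN s hs x
  have hc : Continuous fun s => S.evol ε 0 0 (-s) (S.That (f s) (f s) (f s)) :=
    S.continuous_evol_neg_apply ε 0 0 (S.isTri_That.continuous hf hf hf)
  have h1 : (∫ s in (0 : ℝ)..t, S.flow ε (t - s) (N s).hat) =
      S.evol ε 0 0 t (∫ s in (0 : ℝ)..t, S.evol ε 0 0 (-s) (S.That (f s) (f s) (f s))) := by
    rw [← ContinuousLinearMap.intervalIntegral_comp_comm _ (hc.intervalIntegrable 0 t)]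
    refine intervalIntegral.integral_congr fun s hs => ?_
    rw [uIcc_of_le ht.1] at hs
    simp only [flow_eq_evol, evol_evol, ← sub_eq_add_neg, hNf s ⟨hs.1, hs.2.trans ht.2⟩]
  rw [hfu t ht, hd t ht, h1, flow_eq_evol, h0, map_add, map_smul, evol_neg_evol, evol_neg_evol]

/-- The difference between the solution and its approximation, given a bound for the third
harmonic. -/
theorem norm_sub_approx_le {ε T M C D : ℝ} (hε : 0 < ε) (hC0 : 0 ≤ C)
    (hC : ∀ x y z, ‖S.TL x y z‖ ≤ C * (‖x‖ * ‖y‖ * ‖z‖)) {p : FreqL1 d n}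
    {f w : ℝ → FreqL1 d n} (hf : Continuous f)
    (hfd : ∀ t ∈ Icc 0 (T / ε), S.evol ε 0 0 (-t) (f t) = initHat κ ε p +
      ε • ∫ s in (0 : ℝ)..t, S.evol ε 0 0 (-s) (S.That (f s) (f s) (f s)))
    (hw : S.IsMildEnvelope ε ω κ (T / ε) p w) (hfM : ∀ t ∈ Icc 0 (T / ε), ‖f t‖ ≤ M)
    (hwM : ∀ t ∈ Icc 0 (T / ε), ‖w t‖ ≤ M)
    (hI : ∀ t ∈ Icc 0 (T / ε), ‖∫ s in (0 : ℝ)..t,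
      S.evol ε (3 * ω) ((3 : ℝ) • κ) (-s) (S.That (w s) (w s) (w s))‖ ≤ D * ε)
    {t : ℝ} (ht : t ∈ Icc 0 (T / ε)) :
    ‖f t - (carry n ε ω κ t (w t) + bar d n (carry n ε ω κ t (w t)))‖ ≤
      2 * D * Real.exp (12 * C * M ^ 2 * T) * ε ^ 2 := by
  set Z : ℝ → FreqL1 d n := fun s => carry n ε ω κ s (w s) + bar d n (carry n ε ω κ s (w s))
    with hZ
  have hYc : Continuous fun s => carry n ε ω κ s (w s) := continuous_carry ε ω κ hw.continuous
  have hZc : Continuous Z := hYc.add ((bar d n).continuous.comp hYc)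
  have hQ := S.isCubic_That hC0 (S.norm_That_le hC)
  have hZM : ∀ s ∈ Icc 0 (T / ε), ‖Z s‖ ≤ 2 * M := fun s hs => by
    refine (norm_add_le _ _).trans ?_
    rw [norm_bar, norm_carry]
    linarith [hwM s hs]
  have hM : 0 ≤ M := (norm_nonneg _).trans (hwM t ht)
  have hD : 0 ≤ D * ε := (norm_nonneg _).trans (hI t ht)
  -- The approximation has norm at most `2 * M` because of the conjugate, so the Lipschitz constant
  -- is $3C(2M)^2=12CM^2$.
  have key := le_mul_exp_of_le_integral (φ := fun s => ‖f s - Z s‖) (A := 2 * D * ε ^ 2)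
    (B := ε * (12 * C * M ^ 2)) (τ := T / ε) (by positivity) (hf.sub hZc).norm fun t ht => ?_
  · refine (key t ht).trans ?_
    have h1 : ε * (12 * C * M ^ 2) * t ≤ 12 * C * M ^ 2 * T := by
      refine (mul_le_mul_of_nonneg_left ht.2 (by positivity)).trans_eq ?_
      field_simp
    rw [mul_right_comm (2 * D) (Real.exp _)]
    refine mul_le_mul_of_nonneg_left (Real.exp_le_exp.2 h1) ?_
    nlinarith
  · have hc1 : Continuous fun s => S.evol ε 0 0 (-s) (S.That (f s) (f s) (f s)) :=
      S.continuous_evol_neg_apply ε 0 0 (hQ.continuous.comp hf)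
    have hc2 : Continuous fun s => S.evol ε 0 0 (-s) (S.That (Z s) (Z s) (Z s)) :=
      S.continuous_evol_neg_apply ε 0 0 (hQ.continuous.comp hZc)
    set J := shift (CVec n) (ε⁻¹ • (3 : ℝ) • κ) (∫ s in (0 : ℝ)..t,
      S.evol ε (3 * ω) ((3 : ℝ) • κ) (-s) (S.That (w s) (w s) (w s))) with hJ
    have hJn : ‖J‖ ≤ D * ε := (norm_shift _ _).trans_le (hI t ht)
    -- The difference of the two Duhamel formulas: the defect contributes $\varepsilon\cdot
    -- O(\varepsilon)$, the rest is handled by Grönwall.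
    have hdiff : S.evol ε 0 0 (-t) (f t - Z t) = ε • (J + bar d n J) +
        ε • ∫ s in (0 : ℝ)..t, (S.evol ε 0 0 (-s) (S.That (f s) (f s) (f s)) -
          S.evol ε 0 0 (-s) (S.That (Z s) (Z s) (Z s))) := by
      rw [map_sub, hfd t ht, hw.evol_neg_approx ht hZ, ← hJ,
        intervalIntegral.integral_sub (hc1.intervalIntegrable _ _) (hc2.intervalIntegrable _ _)]
      module
    rw [← S.norm_evol_apply ε 0 0 (-t), hdiff]
    refine (norm_add_le _ _).trans (add_le_add ?_ ?_)
    · rw [norm_smul, Real.norm_of_nonneg hε.le]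
      have h2 : ‖J + bar d n J‖ ≤ 2 * (D * ε) := by
        refine (norm_add_le _ _).trans ?_
        rw [norm_bar]; linarith
      refine (mul_le_mul_of_nonneg_left h2 hε.le).trans_eq ?_
      ring
    · rw [norm_smul, Real.norm_of_nonneg hε.le, mul_assoc ε, ← intervalIntegral.integral_const_mul]
      refine mul_le_mul_of_nonneg_left (norm_integral_le_integral_of_le ht.1 (fun s hs => ?_)
        ((hf.sub hZc).norm.const_mul _)) hε.le
      have hs' : s ∈ Icc 0 (T / ε) := ⟨hs.1, hs.2.trans ht.2⟩
      rw [← map_sub, norm_evol_apply]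
      refine (hQ.sub_le (f s) (Z s) (2 * M) ((hfM s hs').trans (by linarith))
        (hZM s hs')).trans_eq ?_
      ring

/-- The weight bound depends on `ε` neither through the datum nor through the length of the time
interval, since growth rate times length is at most `27 * C * M ^ 2 * T`. -/
theorem IsEnvelope.isControlled {ε T M C : ℝ} (hε : ε ∈ Ioc (0 : ℝ) 1) (hT : 0 < T)
    {p : Wiener d n} {P : FreqL1 d n} (hP : sm d n P = p.hat) {u₁ : ℝ → Wiener d n}
    (h : S.IsEnvelope ω κ ε (T / ε) (fun x => p x) u₁) (hM : ∀ t ∈ Icc 0 (T / ε), ‖u₁ t‖ ≤ M)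
    (hC0 : 0 ≤ C) (hC : ∀ x y z, ‖S.TL x y z‖ ≤ C * (‖x‖ * ‖y‖ * ‖z‖)) {R : ℝ} (hR : ‖P‖ ≤ R) :
    S.IsControlled ε ω κ T M (R * Real.exp (27 * C * M ^ 2 * T)) p.hat
      fun t => (u₁ (clamp (T / ε) t)).hat := by
  have hτ : 0 < T / ε := div_pos hT hε.1
  have hmild := h.isMildEnvelope hε.1 hτ
  have hwM : ∀ t ∈ Icc 0 (T / ε), ‖(u₁ (clamp (T / ε) t)).hat‖ ≤ M := fun t ht => by
    rw [clamp_of_mem ht]; exact hM t ht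
  refine ⟨hε.1, hε.2, hT, hmild, hwM, fun t ht => ?_⟩
  obtain ⟨H, hH, hHw⟩ := h.exists_sm_eq
  have hHw' : ∀ t ∈ Icc 0 (T / ε), sm d n (H t) = (u₁ (clamp (T / ε) t)).hat := fun t ht => by
    rw [clamp_of_mem ht]; exact hHw t ht
  refine ⟨H t, (hmild.norm_weighted_le hε.1.le hP hH hHw' hC0 hC hwM t ht).trans ?_, hHw' t ht⟩
  have h1 : ε * (27 * C * M ^ 2) * t ≤ 27 * C * M ^ 2 * T := by
    refine (mul_le_mul_of_nonneg_left ht.2 (mul_nonneg hε.1.le (by positivity))).trans_eq ?_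
    have := hε.1.ne'
    field_simp
  have := (norm_nonneg P).trans hR
  gcongr

theorem invFourier_approx (ε ω : ℝ) (κ : Pos d) (u₁ : ℝ → Wiener d n) (t : ℝ) (x : Pos d) :
    invFourier d n (carry n ε ω κ t (u₁ t).hat + bar d n (carry n ε ω κ t (u₁ t).hat)) x =
      approx ω κ ε u₁ t x := by
  rw [map_add, Pi.add_apply, invFourier_bar, invFourier_carry, ← Wiener.coe_eq, approx, addCC]

theorem _root_.SVEA.Wiener.eLpNorm_top_le (f : Wiener d n) {B : ℝ} (hB : ‖f‖ ≤ B) :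
    eLpNorm (fun x => f x) ⊤ volume ≤ ENNReal.ofReal B := by
  refine (eLpNorm_le_of_ae_bound (C := B) (ae_of_all _ fun x => ?_)).trans_eq (by simp)
  rw [Wiener.coe_eq]
  exact (norm_invFourier_le _ x).trans hB

theorem error_bound {p₀ p₁ : Wiener d n} (hp₀ : Wiener.MemW 2 p₀) (hp₁ : Wiener.MemW 2 p₁)
    (hpol : ∀ᵐ x, act (S.L ω κ) (p₀ x) = 0) (heig : S.IsSmoothEigendecomposition eig vec)
    (hLip : ∃ C : ℝ, ∀ ℓ β β', |eig ℓ β' - eig ℓ β| ≤ C * ∑ μ, |β' μ - β μ|)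
    (hω : ω = eig ℓ₁ κ)
    (hgap : ∃ c : ℝ, 0 < c ∧ ∀ β, ∀ ℓ, ℓ ≠ ℓ₁ → c ≤ |ω - eig ℓ β|)
    (hres : Disjoint (spectrum ℂ (S.L (3 * ω) ((3 : ℝ) • κ))) (spectrum ℂ (S.L ω κ)))
    {T : ℝ} (hT : 0 < T) (M : ℝ) :
    ∃ C : ℝ, ∀ ε ∈ Ioc (0 : ℝ) 1, ∀ u u₁ : ℝ → Wiener d n,
      S.IsMildSolution κ ε (T / ε) (fun x => p₀ x + ε • p₁ x) u →
      S.IsEnvelope ω κ ε (T / ε) (fun x => p₀ x + ε • p₁ x) u₁ →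
      (∀ t ∈ Icc 0 (T / ε), ‖u t‖ ≤ M ∧ ‖u₁ t‖ ≤ M) →
      ∀ t ∈ Icc 0 (T / ε), ∃ δ : Wiener d n,
        (∀ x, δ x = u t x - approx ω κ ε u₁ t x) ∧ ‖δ‖ ≤ C * ε ^ 2 := by
  obtain ⟨Λ, b, ρ, C, hS⟩ := heig.exists_isNonresonant hLip hω hgap hres
  obtain ⟨c, hc, hgap⟩ := hgap
  obtain ⟨P₀, hP₀⟩ := hp₀.exists_sm_eq
  obtain ⟨P₁, hP₁⟩ := hp₁.exists_sm_eq
  set K := (‖P₀‖ + ‖P₁‖) * Real.exp (27 * C * M ^ 2 * T) with hK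
  -- The polarized part `p₀` contributes through the gap, while `p₁` is not polarized but carries
  -- its own factor `ε`.
  set K₀ := S.symbolBound / c * ‖P₀‖ + ‖p₁.hat‖ with hK₀
  have hK₀0 : 0 ≤ K₀ := by have := S.symbolBound_nonneg; positivity
  refine ⟨2 * thirdConst n b ρ C T M K (offConst n b ρ C T M K K₀) *
    Real.exp (12 * C * M ^ 2 * T), fun ε hε u u₁ hu hu₁ hM t ht => ?_⟩
  have hτ : 0 ≤ T / ε := div_nonneg hT.le hε.1.le
  have hp : (p₀ + ε • p₁).hat = p₀.hat + ε • p₁.hat :=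
    (map_add (Wiener.hatₗᵢ d n) _ _).trans (congrArg _ (map_smul (Wiener.hatₗᵢ d n) _ _))
  have hP : sm d n (P₀ + ε • P₁) = (p₀ + ε • p₁).hat := by
    rw [map_add, map_smul, hP₀, hP₁, hp]
  have hPn : ‖P₀ + ε • P₁‖ ≤ ‖P₀‖ + ‖P₁‖ := by
    refine (norm_add_le _ _).trans (add_le_add_right ?_ _)
    rw [norm_smul, Real.norm_of_nonneg hε.1.le]
    exact mul_le_of_le_one_left (norm_nonneg _) hε.2
  have hcoe : (fun x => p₀ x + ε • p₁ x) = fun x => (p₀ + ε • p₁ : Wiener d n) x := by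
    funext x
    rw [Wiener.coe_add, Wiener.coe_real_smul]
  rw [hcoe] at hu hu₁
  have hctl := hu₁.isControlled hε hT hP (fun t ht => (hM t ht).2) hS.tri_nonneg hS.tri_le hPn
  have hinit : ∀ m, m ≠ ℓ₁ → ‖modeProj vec ε κ m (p₀ + ε • p₁).hat‖ ≤ K₀ * ε := by
    intro m hm
    have hpol' : ∀ᵐ k, act (S.L ω κ) (sm d n P₀ k) = 0 := by
      rw [hP₀]; exact ae_act_hat_eq_zero hpol
    have e1 := heig.norm_modeProj_le_of_act_eq_zero hc (fun β => hgap β m hm) hpol' hε.1.le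
    have e2 := heig.norm_modeProj_le ε κ m p₁.hat
    rw [hp, map_add, map_smul, ← hP₀]
    refine (norm_add_le _ _).trans ?_
    rw [norm_smul, Real.norm_of_nonneg hε.1.le, hK₀, add_mul, mul_comm ‖p₁.hat‖]
    exact add_le_add e1 (mul_le_mul_of_nonneg_left e2 hε.1.le)
  have hI := fun t ht => hS.norm_third_harmonic_le hctl (t := t)
    (fun s hs => hS.offSize_le hctl hK₀0 hinit hs) ht
  have hfc : Continuous fun t => (u (clamp (T / ε) t)).hat :=
    continuous_comp_clamp hτ ((Wiener.hatₗᵢ d n).continuous.comp_continuousOn hu.continuousOn)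
  have hfu : ∀ s ∈ Icc 0 (T / ε), (u (clamp (T / ε) s)).hat = (u s).hat := fun s hs => by
    rw [clamp_of_mem hs]
  have hfM : ∀ s ∈ Icc 0 (T / ε), ‖(u (clamp (T / ε) s)).hat‖ ≤ M := fun s hs => by
    rw [hfu s hs]; exact (hM s hs).1
  have herr := norm_sub_approx_le hε.1 hS.tri_nonneg hS.tri_le hfc
    (fun t ht => hu.evol_neg_hat ht hfc hfu) hctl.mild hfM hctl.norm_le hI ht
  rw [clamp_of_mem ht] at herr
  refine ⟨u t - Wiener.hat.symm (carry n ε ω κ t (u₁ t).hat +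
    bar d n (carry n ε ω κ t (u₁ t).hat)), fun x => ?_, ?_⟩
  · rw [Wiener.coe_sub, Wiener.coe_hat_symm, invFourier_approx]
  · rw [← Wiener.norm_hat, map_sub, LinearEquiv.apply_symm_apply]
    exact herr

end FriedrichsSystem
end SVEA

end

/-! ### The error bound for the slowly varying envelope approximation. -/

theorem theorem4p2 {d n : ℕ} (S : SVEA.FriedrichsSystem d n)
    (κ : SVEA.Pos d) (hκ : κ ≠ 0) (ω : ℝ)
    -- the kernel of `L(ω,κ)` is one-dimensional
    (hker : Module.finrank ℂ
      (LinearMap.ker (Matrix.toEuclideanLin (𝕜 := ℂ) (S.L ω κ))) = 1)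
    -- initial envelope `p = p₀ + ε p₁`, with polarized `p₀`
    (p₀ p₁ : SVEA.Wiener d n) (hp₀ : SVEA.Wiener.MemW 2 p₀) (hp₁ : SVEA.Wiener.MemW 2 p₁)
    (hpol : ∀ᵐ x, SVEA.act (S.L ω κ) (p₀ x) = 0)
    -- smooth eigendecomposition, Lipschitz eigenvalues, spectral gap
    (eig : Fin n → SVEA.Pos d → ℝ) (vec : Fin n → SVEA.Pos d → SVEA.CVec n)
    (heig : S.IsSmoothEigendecomposition eig vec)
    (hLip : ∃ C : ℝ, ∀ ℓ β β', |eig ℓ β' - eig ℓ β| ≤ C * ∑ μ, |β' μ - β μ|)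
    (ℓ₁ : Fin n) (hω : ω = eig ℓ₁ κ)
    (hgap : ∃ c : ℝ, 0 < c ∧ ∀ β, ∀ ℓ, ℓ ≠ ℓ₁ → c ≤ |ω - eig ℓ β|)
    -- non-resonance
    (hreg : IsUnit (S.L (3 * ω) ((3 : ℝ) • κ)))
    (hres : Disjoint (spectrum ℂ (S.L (3 * ω) ((3 : ℝ) • κ))) (spectrum ℂ (S.L ω κ))) :
    -- bounded solutions exist on `[0, tEnd/ε]` for some `tEnd > 0`, uniformly in `ε`
    (∃ tEnd : ℝ, 0 < tEnd ∧ ∃ M : ℝ, ∀ ε ∈ Set.Ioc (0 : ℝ) 1,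
      ∃ u u₁ : ℝ → SVEA.Wiener d n,
        S.IsMildSolution κ ε (tEnd / ε) (fun x => p₀ x + ε • p₁ x) u ∧
        S.IsEnvelope ω κ ε (tEnd / ε) (fun x => p₀ x + ε • p₁ x) u₁ ∧
        ∀ t ∈ Set.Icc 0 (tEnd / ε), ‖u t‖ ≤ M ∧ ‖u₁ t‖ ≤ M) ∧
    -- the error bound on every such time interval
    (∀ tEnd : ℝ, 0 < tEnd → ∀ M : ℝ, ∃ C : ℝ, ∀ ε ∈ Set.Ioc (0 : ℝ) 1,
      ∀ u u₁ : ℝ → SVEA.Wiener d n,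
        S.IsMildSolution κ ε (tEnd / ε) (fun x => p₀ x + ε • p₁ x) u →
        S.IsEnvelope ω κ ε (tEnd / ε) (fun x => p₀ x + ε • p₁ x) u₁ →
        (∀ t ∈ Set.Icc 0 (tEnd / ε), ‖u t‖ ≤ M ∧ ‖u₁ t‖ ≤ M) →
        ∀ t ∈ Set.Icc 0 (tEnd / ε),
          (∃ δ : SVEA.Wiener d n,
            (∀ x, δ x = u t x - SVEA.approx ω κ ε u₁ t x) ∧ ‖δ‖ ≤ C * ε ^ 2) ∧
          MeasureTheory.eLpNorm (fun x => u t x - SVEA.approx ω κ ε u₁ t x) ⊤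
            MeasureTheory.volume ≤ ENNReal.ofReal (C * ε ^ 2)) := by
  refine ⟨S.exists_bounded_solutions κ ω hp₀ hp₁, fun tEnd hT M => ?_⟩
  obtain ⟨C, hC⟩ := SVEA.FriedrichsSystem.error_bound hp₀ hp₁ hpol heig hLip hω hgap hres hT M
  refine ⟨C, fun ε hε u u₁ hu hu₁ hM t ht => ?_⟩
  obtain ⟨δ, hδ, hδC⟩ := hC ε hε u u₁ hu hu₁ hM t ht
  refine ⟨⟨δ, hδ, hδC⟩, ?_⟩
  -- The supremum norm is dominated by the norm of $W$, as the Fourier constant is at most 1.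
  rw [← show (fun x => δ x) = _ from funext hδ]
  exact δ.eLpNorm_top_le hδC
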